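/- Let $p$ be a prime and let $\mathbb{Q}_{p^2}$ be the unramified quadratic extension of $\mathbb{Q}_p$. Let $H$ be a definite quaternion algebra over $\mathbb{Q}$ of discriminant $D$ with $p\nmid D$, fix an isomorphism of $\mathbb{Q}_p$-algebras $\Phi_p\colon H\otimes_{\mathbb{Q}}\mathbb{Q}_p\simeq \mathrm{M}_2(\mathbb{Q}_p)$, and let $\mathcal{O}\subseteq H$ be an Eichler order over $\mathbb{Z}$ of level $N$ with $p\nmid N$. Let $K=\mathbb{Q}(\sqrt d)$, with $d$ a square-free integer, be a quadratic field that is imaginary at $p$ and at $\infty$, i.e. $K\otimes_{\mathbb{Q}}\mathbb{Q}_p\simeq\mathbb{Q}_{p^2}$ and $K\otimes_{\mathbb{Q}}\mathbb{R}\simeq\mathbb{C}$. Let $m\ge 1$ and let $\mathcal{O}_{K,m}=\mathbb{Z}+m\mathcal{O}_K$ be the order of conductor $m$ of $K$. Put $\mathcal{O}[1/p]=\mathcal{O}\otimes_{\mathbb{Z}}\mathbb{Z}[1/p]$ and $\mathcal{O}_{K,m}[1/p]=\mathcal{O}_{K,m}\otimes_{\mathbb{Z}}\mathbb{Z}[1/p]$.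 An embedding $\varphi\colon\mathcal{O}_{K,m}[1/p]\hookrightarrow\mathcal{O}[1/p]$, extended to an embedding of $\mathbb{Q}$-algebras $\varphi\colon K\hookrightarrow H$, is called optimal if $\varphi(\mathcal{O}_{K,m}[1/p])=\mathcal{O}[1/p]\cap\varphi(K)$. The group $$\mathcal{O}[1/p]^*_+=\{\alpha\in\mathcal{O}[1/p]^*\mid v_p(\mathrm{Nm}(\alpha))\equiv 0 \pmod 2\},$$ where $\mathrm{Nm}$ is the reduced norm, acts on the set of optimal embeddings by $(\varphi\cdot\alpha)(x)=\alpha^{-1}\varphi(x)\alpha$; let $\nu(D,N,d,m;\mathcal{O}[1/p]^*_+)$ be the number of orbits. Let $\Gamma_{p,+}\subseteq\mathrm{PGL}_2(\mathbb{Q}_p)$ be the image of $\mathcal{O}[1/p]^*_+$ under $\Phi_p$. It acts by Möbius transformations on $\mathcal{H}_p(\mathbb{Q}_{p^2})=\mathbb{P}^1(\mathbb{Q}_{p^2})\smallsetminus\mathbb{P}^1(\mathbb{Q}_p)=\mathbb{Q}_{p^2}\smallsetminus\mathbb{Q}_p$. A point $\tau\in\mathcal{H}_p(\mathbb{Q}_{p^2})$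 is a fixed point of $\varphi$ if $\Phi_p(\varphi(a))\cdot\tau=\tau$ for all $a\in K^*$. Let $\mathrm{CM}_p(D,N,d,m)$ be the set of classes in $\Gamma_{p,+}\backslash\mathcal{H}_p(\mathbb{Q}_{p^2})$ of the fixed points of optimal embeddings $\mathcal{O}_{K,m}[1/p]\hookrightarrow\mathcal{O}[1/p]$. Then the set $\mathrm{CM}_p(D,N,d,m)$ is finite, its cardinality is $$\#\,\mathrm{CM}_p(D,N,d,m)=\nu(D,N,d,m;\mathcal{O}[1/p]^*_+),$$ and this cardinality is even. -/

import Mathlib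

open scoped TensorProduct Quaternion MatrixGroups

noncomputable section

namespace ShimuraCM

/-! ### Orders over `ℤ` and over `ℤ[1/p]` in `ℚ`-algebras -/

section Orders

variable {A : Type*} [Ring A] [Algebra ℚ A]

/-- A `ℤ`-order in a `ℚ`-algebra: a subring that is finitely generated as an abelian group and
spans the algebra over `ℚ`. -/
def IsOrder (O : Subring A) : Prop :=
  O.toAddSubgroup.FG ∧ Submodule.span ℚ (O : Set A) = ⊤

/-- An Eichler order of level `N` in a quaternion algebra: the intersection `O₁ ∩ O₂` of two
maximal orders, whose index in `O₁` is `N`. -/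
def IsEichlerOrder (O : Subring A) (N : ℕ) : Prop :=
  ∃ O₁ O₂ : Subring A, Maximal IsOrder O₁ ∧ Maximal IsOrder O₂ ∧ O = O₁ ⊓ O₂ ∧
    O.toAddSubgroup.relIndex O₁.toAddSubgroup = N

/-- `O[1/p] = O ⊗ ℤ[1/p]`, as a subring of the ambient `ℚ`-algebra. -/
def invertPrime (p : ℕ) (O : Subring A) : Subring A where
  carrier := {x | ∃ k : ℕ, (p : A) ^ k * x ∈ O}
  zero_mem' := ⟨0, by simp⟩
  one_mem' := ⟨0, by simp⟩
  add_mem' := by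
    rintro x y ⟨k, hk⟩ ⟨l, hl⟩
    refine ⟨k + l, ?_⟩
    have hp : ∀ n : ℕ, (p : A) ^ n ∈ O := fun n => O.pow_mem (natCast_mem O p) n
    have h1 : (p : A) ^ (k + l) * (x + y)
        = (p : A) ^ l * ((p : A) ^ k * x) + (p : A) ^ k * ((p : A) ^ l * y) := by
      rw [mul_add, ← mul_assoc, ← mul_assoc, ← pow_add, ← pow_add, add_comm l k]
    rw [h1]
    exact O.add_mem (O.mul_mem (hp l) hk) (O.mul_mem (hp k) hl)
  neg_mem' := by
    rintro x ⟨k, hk⟩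
    exact ⟨k, by rw [mul_neg]; exact O.neg_mem hk⟩
  mul_mem' := by
    rintro x y ⟨k, hk⟩ ⟨l, hl⟩
    refine ⟨k + l, ?_⟩
    have h1 : (p : A) ^ (k + l) * (x * y) = ((p : A) ^ k * x) * ((p : A) ^ l * y) := by
      have hc : (p : A) ^ l * x = x * (p : A) ^ l := ((Nat.cast_commute p x).pow_left l).eq
      rw [pow_add, mul_assoc, ← mul_assoc _ x y, hc]
      simp only [mul_assoc]
    rw [h1]
    exact O.mul_mem hk hl

end Orders

/-! ### Quadratic fields and their orders -/

/-- `K = ℚ(√d)` is a quadratic field, with `d` a square-free integer. -/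
def IsQuadraticFieldOf (K : Type*) [Field K] [Algebra ℚ K] (d : ℤ) : Prop :=
  Squarefree d ∧ Module.finrank ℚ K = 2 ∧
    ∃ s : K, s ^ 2 = (d : K) ∧ IntermediateField.adjoin ℚ {s} = ⊤

/-- For a place with completion `F` of `ℚ` and unramified quadratic extension `F₂` of `F`, the field
`K` is imaginary at that place if `K ⊗ F ≃ F₂` as `F`-algebras. -/
def IsImaginaryAt (F F₂ K : Type*) [Field F] [Algebra ℚ F] [Field F₂] [Algebra F F₂]
    [Field K] [Algebra ℚ K] : Prop :=
  Nonempty ((F ⊗[ℚ] K) ≃ₐ[F] F₂)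

/-- The order `ℤ + m 𝓞_K` of conductor `m` of a number field `K` (where `𝓞_K` is the ring of
integers). -/
def conductorOrder (K : Type*) [Field K] (m : ℕ) : Subring K where
  carrier := {x | ∃ a : ℤ, ∃ y ∈ integralClosure ℤ K, x = (a : K) + (m : K) * y}
  zero_mem' := ⟨0, 0, zero_mem _, by simp⟩
  one_mem' := ⟨1, 0, zero_mem _, by simp⟩
  add_mem' := by
    rintro _ _ ⟨a, y, hy, rfl⟩ ⟨b, z, hz, rfl⟩
    exact ⟨a + b, y + z, add_mem hy hz, by push_cast; ring⟩
  neg_mem' := by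
    rintro _ ⟨a, y, hy, rfl⟩
    exact ⟨-a, -y, neg_mem hy, by push_cast; ring⟩
  mul_mem' := by
    rintro _ _ ⟨a, y, hy, rfl⟩ ⟨b, z, hz, rfl⟩
    refine ⟨a * b, (a : K) * z + (b : K) * y + (m : K) * (y * z), ?_, by push_cast; ring⟩
    exact add_mem (add_mem (mul_mem (intCast_mem _ a) hz) (mul_mem (intCast_mem _ b) hy))
      (mul_mem (natCast_mem _ m) (mul_mem hy hz))

/-! ### Quaternion algebras over `ℚ` -/

section Quaternion

/-- The `ℚ`-algebra `A` is ramified at the place of `ℚ` with completion `F` if `F ⊗ A` is a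
division algebra. -/
def IsRamifiedOver (F A : Type*) [Field F] [Algebra ℚ F] [Ring A] [Algebra ℚ A] : Prop :=
  ∀ x : F ⊗[ℚ] A, x ≠ 0 → IsUnit x

/-- A quaternion algebra over `ℚ` is definite if it is ramified at the archimedean place. -/
def IsDefinite (A : Type*) [Ring A] [Algebra ℚ A] : Prop := IsRamifiedOver ℝ A

/-- The discriminant of the quaternion algebra `A` is `D`: the positive integer `D` is the product
of the finite primes at which `A` is ramified. -/
def HasDiscriminant (A : Type*) [Ring A] [Algebra ℚ A] (D : ℕ) : Prop :=
  Squarefree D ∧ ∀ (l : ℕ) [Fact l.Prime], l ∣ D ↔ IsRamifiedOver ℚ_[l] A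

variable {α β : ℚ}

/-- The reduced norm `Nm(x + yi + zj + tk) = x² - αy² - βz² + αβt²` of the quaternion algebra
`(α, β / ℚ)`. -/
def reducedNorm (x : ℍ[ℚ,α,β]) : ℚ :=
  x.re ^ 2 - α * x.imI ^ 2 - β * x.imJ ^ 2 + α * β * x.imK ^ 2

theorem mul_star_eq_reducedNorm (x : ℍ[ℚ,α,β]) :
    x * star x = algebraMap ℚ ℍ[ℚ,α,β] (reducedNorm x) := by
  have h : x * star x = ((reducedNorm x : ℚ) : ℍ[ℚ,α,β]) := by
    ext
    · rw [QuaternionAlgebra.re_coe]; simp [reducedNorm]; ring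
    · rw [QuaternionAlgebra.imI_coe]; simp; ring
    · rw [QuaternionAlgebra.imJ_coe]; simp; ring
    · rw [QuaternionAlgebra.imK_coe]; simp; ring
  exact h

theorem reducedNorm_one : reducedNorm (1 : ℍ[ℚ,α,β]) = 1 := by
  simp [reducedNorm]

theorem reducedNorm_mul (x y : ℍ[ℚ,α,β]) :
    reducedNorm (x * y) = reducedNorm x * reducedNorm y := by
  simp [reducedNorm]; ring

theorem reducedNorm_mul_inv (u : (ℍ[ℚ,α,β])ˣ) :
    reducedNorm (u : ℍ[ℚ,α,β]) * reducedNorm (↑u⁻¹ : ℍ[ℚ,α,β]) = 1 := by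
  rw [← reducedNorm_mul, Units.mul_inv, reducedNorm_one]

theorem reducedNorm_unit_ne_zero (u : (ℍ[ℚ,α,β])ˣ) : reducedNorm (u : ℍ[ℚ,α,β]) ≠ 0 :=
  left_ne_zero_of_mul_eq_one (reducedNorm_mul_inv u)

/-- `R^*_+ = {α ∈ R^* : v_p(Nm α) ≡ 0 (mod 2)}` for a subring `R` of a quaternion algebra. -/
def unitsPlus (p : ℕ) [Fact p.Prime] (R : Subring ℍ[ℚ,α,β]) : Subgroup (ℍ[ℚ,α,β])ˣ where
  carrier := {u | (u : ℍ[ℚ,α,β]) ∈ R ∧ (↑u⁻¹ : ℍ[ℚ,α,β]) ∈ R ∧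
    Even (padicValRat p (reducedNorm (u : ℍ[ℚ,α,β])))}
  one_mem' := ⟨R.one_mem, by simp, by simp [reducedNorm_one]⟩
  mul_mem' := by
    rintro u v ⟨hu, hu', hun⟩ ⟨hv, hv', hvn⟩
    refine ⟨R.mul_mem hu hv, by rw [mul_inv_rev]; exact R.mul_mem hv' hu', ?_⟩
    rw [Units.val_mul, reducedNorm_mul, padicValRat.mul (reducedNorm_unit_ne_zero u)
      (reducedNorm_unit_ne_zero v)]
    exact hun.add hvn
  inv_mem' := by
    rintro u ⟨hu, hu', hun⟩
    refine ⟨hu', by simpa using hu, ?_⟩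
    have h := reducedNorm_mul_inv u
    rw [eq_inv_of_mul_eq_one_right h, padicValRat.inv]
    exact hun.neg

end Quaternion

/-! ### Optimal embeddings -/

section Embeddings

variable {K : Type*} [Field K] [Algebra ℚ K]

/-- The optimal embeddings `R ↪ S` of an order `R` of `K` into an order `S` of `A`. An embedding
`R ↪ S` extends uniquely to a `ℚ`-algebra embedding `φ : K ↪ A`, and is represented by this
extension; it is optimal if `φ(R) = S ∩ φ(K)`. -/
def OptimalEmbedding {A : Type*} [Ring A] [Algebra ℚ A] (R : Subring K) (S : Subring A) : Type _ :=
  {φ : K →ₐ[ℚ] A // φ '' (R : Set K) = (S : Set A) ∩ Set.range φ}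

/-- Two optimal embeddings are equivalent under a group `G` of units if `φ' = φ · g` for some
`g ∈ G`, where `(φ · g)(x) = g⁻¹ φ(x) g`. -/
def embeddingSetoid {A : Type*} [Ring A] [Algebra ℚ A] (R : Subring K) (S : Subring A)
    (G : Subgroup Aˣ) : Setoid (OptimalEmbedding R S) where
  r φ φ' := ∃ g ∈ G, ∀ x : K, φ'.1 x = (↑g⁻¹ : A) * φ.1 x * (g : A)
  iseqv :=
    { refl := fun φ => ⟨1, G.one_mem, fun x => by simp⟩
      symm := by
        rintro φ φ' ⟨g, hg, h⟩
        exact ⟨g⁻¹, G.inv_mem hg, fun x => by simp [h, mul_assoc]⟩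
      trans := by
        rintro φ φ' φ'' ⟨g, hg, h⟩ ⟨g', hg', h'⟩
        exact ⟨g * g', G.mul_mem hg hg', fun x => by simp [h, h', mul_assoc]⟩ }

/-- The cardinality (possibly infinite, a priori) of the set of `G`-conjugacy classes of optimal
embeddings `R ↪ S`. -/
def numOptimalEmbeddings {A : Type*} [Ring A] [Algebra ℚ A] (R : Subring K) (S : Subring A)
    (G : Subgroup Aˣ) : ℕ∞ :=
  ENat.card (Quotient (embeddingSetoid R S G))

end Embeddings

/-! ### The `p`-adic upper half-plane -/

section HalfPlane

/-- For a field extension `L / F`, the set `ℙ¹(L) ∖ ℙ¹(F) = L ∖ F`. For `F = ℚ_p` and `L = ℚ_{p²}`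
this is the set of `ℚ_{p²}`-points of the `p`-adic upper half-plane. -/
@[ext]
structure HalfPlane (F L : Type*) [Field F] [Field L] [Algebra F L] where
  /-- The underlying element of `L`. -/
  val : L
  /-- It does not lie in `F`. -/
  notMem : val ∉ Set.range (algebraMap F L)

variable {F L : Type*} [Field F] [Field L] [Algebra F L]

theorem HalfPlane.eq_zero_of_linear (z : HalfPlane F L) {x y : F}
    (h : algebraMap F L x * z.val + algebraMap F L y = 0) : x = 0 ∧ y = 0 := by
  have hx : x = 0 := by
    by_contra hx
    apply z.notMem
    refine ⟨-y / x, ?_⟩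
    have hx' : algebraMap F L x ≠ 0 := by simpa using hx
    rw [map_div₀, map_neg, div_eq_iff hx']
    linear_combination -h
  subst hx
  refine ⟨rfl, ?_⟩
  simpa using h

/-- The numerator `a z + b`. -/
def mobNum (g : GL (Fin 2) F) (z : L) : L :=
  algebraMap F L (g 0 0) * z + algebraMap F L (g 0 1)

/-- The denominator `c z + d`. -/
def mobDenom (g : GL (Fin 2) F) (z : L) : L :=
  algebraMap F L (g 1 0) * z + algebraMap F L (g 1 1)

theorem det_fin_two_ne_zero (g : GL (Fin 2) F) : g 0 0 * g 1 1 - g 0 1 * g 1 0 ≠ 0 := by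
  have h := g.det_ne_zero
  rwa [Matrix.det_fin_two] at h

theorem mobDenom_ne_zero (g : GL (Fin 2) F) (z : HalfPlane F L) : mobDenom g z.val ≠ 0 := by
  intro h
  obtain ⟨h1, h2⟩ := z.eq_zero_of_linear h
  apply det_fin_two_ne_zero g
  rw [h1, h2]
  ring

/-- `GL₂(F)` acts on `L ∖ F` by `z ↦ (a z + b) / (c z + d)`. -/
instance : SMul (GL (Fin 2) F) (HalfPlane F L) where
  smul g z :=
    ⟨mobNum g z.val / mobDenom g z.val, by
      rintro ⟨t, ht⟩
      rw [eq_div_iff (mobDenom_ne_zero g z)] at ht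
      have h : algebraMap F L (g 0 0 - t * g 1 0) * z.val
          + algebraMap F L (g 0 1 - t * g 1 1) = 0 := by
        simp only [mobNum, mobDenom] at ht
        simp only [map_sub, map_mul]
        linear_combination -ht
      obtain ⟨h1, h2⟩ := z.eq_zero_of_linear h
      apply det_fin_two_ne_zero g
      linear_combination g 1 1 * h1 - g 1 0 * h2⟩

theorem HalfPlane.smul_val (g : GL (Fin 2) F) (z : HalfPlane F L) :
    (g • z).val = mobNum g z.val / mobDenom g z.val := rfl

instance : MulAction (GL (Fin 2) F) (HalfPlane F L) where
  one_smul z := by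
    ext
    simp [HalfPlane.smul_val, mobNum, mobDenom]
  mul_smul g h z := by
    ext
    have h1 := mobDenom_ne_zero (g * h) z
    have h2 := mobDenom_ne_zero h z
    have h3 := mobDenom_ne_zero g (h • z)
    rw [HalfPlane.smul_val, HalfPlane.smul_val g, div_eq_div_iff h1 h3]
    have key : (h • z).val * mobDenom h z.val = mobNum h z.val := by
      rw [HalfPlane.smul_val, div_mul_cancel₀ _ h2]
    have hn : mobNum (g * h) z.val = mobNum g (h • z).val * mobDenom h z.val := by
      simp only [mobNum, mobDenom, Units.val_mul, Matrix.mul_apply, Fin.sum_univ_two, map_add,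
        map_mul] at key ⊢
      linear_combination (-algebraMap F L (g 0 0)) * key
    have hd : mobDenom (g * h) z.val = mobDenom g (h • z).val * mobDenom h z.val := by
      simp only [mobNum, mobDenom, Units.val_mul, Matrix.mul_apply, Fin.sum_univ_two, map_add,
        map_mul] at key ⊢
      linear_combination (-algebraMap F L (g 1 0)) * key
    rw [hn, hd]
    ring

/-- The induced action of `PGL₂(F)` on `L ∖ F`. -/
instance : MulAction PGL(2, F) (HalfPlane F L) :=
  Matrix.ProjGenLinGroup.mulActionOfGL (by
    intro u z
    ext
    simp [HalfPlane.smul_val, mobNum, mobDenom])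

end HalfPlane

/-! ### The groups `Γ_{p,+}` and the `p`-imaginary multiplication parameters -/

section Parameters

variable {p : ℕ} [Fact p.Prime] {α β : ℚ}

/-- The group homomorphism `H^* → GL₂(ℚ_p)` given by an isomorphism `Φ : H ⊗ ℚ_p ≃ M₂(ℚ_p)`. -/
def toGL (Φ : (ℚ_[p] ⊗[ℚ] ℍ[ℚ,α,β]) ≃ₐ[ℚ_[p]] Matrix (Fin 2) (Fin 2) ℚ_[p]) :
    (ℍ[ℚ,α,β])ˣ →* GL (Fin 2) ℚ_[p] :=
  Units.map (Φ.toRingEquiv.toRingHom.comp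
    (Algebra.TensorProduct.includeRight :
      ℍ[ℚ,α,β] →ₐ[ℚ] (ℚ_[p] ⊗[ℚ] ℍ[ℚ,α,β])).toRingHom).toMonoidHom

/-- `Γ_{p,+}`: the image in `PGL₂(ℚ_p)` of the group `R^*_+`, where `R = O[1/p]`. -/
def GammaPlus (Φ : (ℚ_[p] ⊗[ℚ] ℍ[ℚ,α,β]) ≃ₐ[ℚ_[p]] Matrix (Fin 2) (Fin 2) ℚ_[p])
    (R : Subring ℍ[ℚ,α,β]) : Subgroup PGL(2, ℚ_[p]) :=
  (unitsPlus p R).map (Matrix.ProjGenLinGroup.mk.comp (toGL Φ))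

variable {K : Type*} [Field K] [Algebra ℚ K] {L : Type*} [Field L] [Algebra ℚ_[p] L]

/-- `τ` is a fixed point of the embedding `φ : K ↪ H`: it is fixed by all the transformations
`Φ(φ(a))`, `a ∈ K^*`. -/
def IsFixedPoint (Φ : (ℚ_[p] ⊗[ℚ] ℍ[ℚ,α,β]) ≃ₐ[ℚ_[p]] Matrix (Fin 2) (Fin 2) ℚ_[p])
    (φ : K →ₐ[ℚ] ℍ[ℚ,α,β]) (τ : HalfPlane ℚ_[p] L) : Prop :=
  ∀ a : Kˣ, toGL Φ (Units.map (φ : K →* ℍ[ℚ,α,β]) a) • τ = τ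

/-- The set of `p`-imaginary multiplication parameters by `O_{K,m}[1/p]`, for the order
`O[1/p]`: the classes in `Γ_{p,+} \ ℋ_p(ℚ_{p²})` of fixed points of optimal embeddings
`O_{K,m}[1/p] ↪ O[1/p]`. -/
def CMp (Φ : (ℚ_[p] ⊗[ℚ] ℍ[ℚ,α,β]) ≃ₐ[ℚ_[p]] Matrix (Fin 2) (Fin 2) ℚ_[p])
    (O : Subring ℍ[ℚ,α,β]) (K : Type*) [Field K] [Algebra ℚ K] (m : ℕ)
    (L : Type*) [Field L] [Algebra ℚ_[p] L] :
    Set (MulAction.orbitRel.Quotient (GammaPlus Φ (invertPrime p O)) (HalfPlane ℚ_[p] L)) :=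
  {c | ∃ (φ : OptimalEmbedding (invertPrime p (conductorOrder K m)) (invertPrime p O))
      (τ : HalfPlane ℚ_[p] L), IsFixedPoint Φ φ.1 τ ∧ c = Quotient.mk _ τ}

end Parameters

end ShimuraCM

end

/-!
An embedding `φ` of `K = ℚ(s)`, `s² = d`, is determined by the matrix `M` of `φ(s)` in `M₂(ℚ_p)`,
and `M` by the point `τ` for which `(τ, 1)` is an eigenvector with eigenvalue a fixed square root
`θ` of `d` in `ℚ_{p²}`. The second fixed point of `φ`, with eigenvalue `-θ`, is the point attached
to the composite of `φ` with the conjugation of `K`, which is optimal as well. Since `φ ↦ τ` is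
injective and equivariant, it identifies the classes of optimal embeddings with the set `CM_p`
(`exists_injective_range_eq_CMp`).

Finiteness is a reduction theory (`finite_quotient_embeddingSetoid`): for `y = φ(m s)`, an element
`a` of minimal norm in the module `O + y O` generates it up to a bounded denominator, so that
`a⁻¹ y a` and the class of `a⁻¹` modulo `O` take finitely many values. Embeddings for which these
values and the parity of the valuation of the norm of `a` agree are conjugate.

The cardinality is even because an element `x ∈ O[1/p]` of reduced norm `p` acts by conjugation as
an involution on the classes, without fixed points: a fixed class would give an element of `K` with
norm of odd valuation at `p`, but `p` is inert in `K` (`even_card_quotient_embeddingSetoid`).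

The existence of `x` is the main difficulty (`IsEichlerOrder.exists_mem_reducedNorm_eq_prime`).
First, `p` is the norm of a rational quaternion `δ`: the algebra contains imaginary quadratic
fields `ℚ(√-a)` and `ℚ(√-a')`, and for a suitable prime `q`, found by Dirichlet's theorem,
Legendre's theorem on conics shows that `q` is a norm from the first and `p q` a norm from the
second. Then the primes `l ≠ p` in the denominator of `δ` are removed one at a time. Where the
algebra is ramified at `l`, integrality of the norm suffices. Where it splits at `l`, the two
maximal orders that define `O` are stabilisers of lattices, which are both stable under a matrix of
determinant `p`; this matrix is approximated at `l` by a multiple `γ δ` with `γ` of norm one, and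
integral away from `l` and `p`. This is strong approximation (`IsOrder.exists_approximation`),
which holds because the closure in `SL₂(ℚ_l)` of the group of such `γ` contains a hyperbolic element
together with elements close to `1` that do not commute with it; conjugating these by powers of the
hyperbolic element yields all unipotent matrices (`specialLinear_le_of_hyperbolic`).
-/

namespace ShimuraCM

/-! ### Arithmetic of the quaternion algebra -/

section QuaternionBasics

variable {α β : ℚ}

theorem reducedNorm_star (x : ℍ[ℚ,α,β]) : reducedNorm (star x) = reducedNorm x := by
  simp [reducedNorm]

theorem mul_star_eq_smul (x : ℍ[ℚ,α,β]) : x * star x = reducedNorm x • 1 := by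
  rw [mul_star_eq_reducedNorm, Algebra.algebraMap_eq_smul_one]

theorem star_mul_eq_smul (x : ℍ[ℚ,α,β]) : star x * x = reducedNorm x • 1 := by
  have := mul_star_eq_smul (star x)
  rwa [star_star, reducedNorm_star] at this

theorem star_eq_trace_sub (x : ℍ[ℚ,α,β]) : star x = (2 * x.re) • 1 - x := by
  ext <;> simp
  ring

theorem mul_self_eq (x : ℍ[ℚ,α,β]) : x * x = (2 * x.re) • x - reducedNorm x • 1 := by
  rw [← mul_star_eq_smul, star_eq_trace_sub, mul_sub, mul_smul_comm, mul_one]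
  abel

theorem reducedNorm_one_add (x : ℍ[ℚ,α,β]) :
    reducedNorm (1 + x) = 1 + 2 * x.re + reducedNorm x := by
  simp [reducedNorm]; ring

theorem reducedNorm_smul (r : ℚ) (x : ℍ[ℚ,α,β]) :
    reducedNorm (r • x) = r ^ 2 * reducedNorm x := by
  simp [reducedNorm]; ring

theorem reducedNorm_smul_one (r : ℚ) : reducedNorm (r • (1 : ℍ[ℚ,α,β])) = r ^ 2 := by
  rw [reducedNorm_smul, reducedNorm_one, mul_one]

theorem reducedNorm_pow (x : ℍ[ℚ,α,β]) (n : ℕ) : reducedNorm (x ^ n) = reducedNorm x ^ n := by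
  induction n with
  | zero => simp [reducedNorm_one]
  | succ n ih => rw [pow_succ, pow_succ, reducedNorm_mul, ih]

/-- An element of non-zero reduced norm, as a unit. -/
def unitOfNorm (x : ℍ[ℚ,α,β]) (h : reducedNorm x ≠ 0) : (ℍ[ℚ,α,β])ˣ where
  val := x
  inv := (reducedNorm x)⁻¹ • star x
  val_inv := by rw [mul_smul_comm, mul_star_eq_smul, smul_smul, inv_mul_cancel₀ h, one_smul]
  inv_val := by rw [smul_mul_assoc, star_mul_eq_smul, smul_smul, inv_mul_cancel₀ h, one_smul]

@[simp] theorem unitOfNorm_val (x : ℍ[ℚ,α,β]) (h : reducedNorm x ≠ 0) :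
    (unitOfNorm x h : ℍ[ℚ,α,β]) = x := rfl

theorem unitOfNorm_inv_val (x : ℍ[ℚ,α,β]) (h : reducedNorm x ≠ 0) :
    (↑(unitOfNorm x h)⁻¹ : ℍ[ℚ,α,β]) = (reducedNorm x)⁻¹ • star x := rfl

theorem reducedNorm_nonneg (hα : α < 0) (hβ : β < 0) (x : ℍ[ℚ,α,β]) : 0 ≤ reducedNorm x := by
  have h1 := mul_nonneg (neg_nonneg.2 hα.le) (sq_nonneg x.imI)
  have h2 := mul_nonneg (neg_nonneg.2 hβ.le) (sq_nonneg x.imJ)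
  have h3 := mul_nonneg (mul_pos_of_neg_of_neg hα hβ).le (sq_nonneg x.imK)
  have h4 := sq_nonneg x.re
  simp only [reducedNorm]; linarith

theorem reducedNorm_eq_zero (hα : α < 0) (hβ : β < 0) {x : ℍ[ℚ,α,β]} (h : reducedNorm x = 0) :
    x = 0 := by
  have h1 := mul_nonneg (neg_nonneg.2 hα.le) (sq_nonneg x.imI)
  have h2 := mul_nonneg (neg_nonneg.2 hβ.le) (sq_nonneg x.imJ)
  have h3 := mul_nonneg (mul_pos_of_neg_of_neg hα hβ).le (sq_nonneg x.imK)
  have h4 := sq_nonneg x.re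
  simp only [reducedNorm] at h
  have e1 : x.re ^ 2 = 0 := by linarith
  have e2 : -α * x.imI ^ 2 = 0 := by linarith
  have e3 : -β * x.imJ ^ 2 = 0 := by linarith
  have e4 : α * β * x.imK ^ 2 = 0 := by linarith
  have hα' := hα.ne
  have hβ' := hβ.ne
  ext <;> simp_all

theorem reducedNorm_pos (hα : α < 0) (hβ : β < 0) {x : ℍ[ℚ,α,β]} (h : x ≠ 0) :
    0 < reducedNorm x :=
  lt_of_le_of_ne (reducedNorm_nonneg hα hβ x) fun e => h (reducedNorm_eq_zero hα hβ e.symm)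

/-- An element commuting with a non-scalar `w` lies in `ℚ(w)`. -/
theorem exists_of_commute (hα : α ≠ 0) (hβ : β ≠ 0) {w x : ℍ[ℚ,α,β]}
    (hw : ∀ r : ℚ, w ≠ r • 1) (h : x * w = w * x) : ∃ a b : ℚ, x = a • 1 + b • w := by
  have hI := congrArg QuaternionAlgebra.imI h
  have hJ := congrArg QuaternionAlgebra.imJ h
  have hK := congrArg QuaternionAlgebra.imK h
  simp only [QuaternionAlgebra.imI_mul, QuaternionAlgebra.imJ_mul, QuaternionAlgebra.imK_mul]
    at hI hJ hK
  have c1 : x.imJ * w.imK = x.imK * w.imJ := by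
    apply mul_left_cancel₀ hβ; linear_combination -hI / 2
  have c2 : x.imI * w.imK = x.imK * w.imI := by
    apply mul_left_cancel₀ hα; linear_combination hJ / 2
  have c3 : x.imI * w.imJ = x.imJ * w.imI := by linear_combination hK / 2
  by_cases h1 : w.imI = 0
  · by_cases h2 : w.imJ = 0
    · by_cases h3 : w.imK = 0
      · exact absurd (by ext <;> simp [h1, h2, h3]) (hw w.re)
      · refine ⟨x.re - x.imK / w.imK * w.re, x.imK / w.imK, ?_⟩
        ext <;> simp <;> field_simp <;> first | linear_combination c1 | linear_combination c2
    · refine ⟨x.re - x.imJ / w.imJ * w.re, x.imJ / w.imJ, ?_⟩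
      ext <;> simp <;> field_simp <;> first | linear_combination c3 | linear_combination -c1
  · refine ⟨x.re - x.imI / w.imI * w.re, x.imI / w.imI, ?_⟩
    ext <;> simp <;> field_simp <;> first | linear_combination -c3 | linear_combination -c2

theorem commute_of_commute (hα : α ≠ 0) (hβ : β ≠ 0) {w x y : ℍ[ℚ,α,β]}
    (hw : ∀ r : ℚ, w ≠ r • 1) (hx : x * w = w * x) (hy : y * w = w * y) : x * y = y * x := by
  obtain ⟨a, b, rfl⟩ := exists_of_commute hα hβ hw hx
  simp only [add_mul, mul_add, smul_mul_assoc, mul_smul_comm, one_mul, mul_one, hy]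

theorem exists_not_commute (hα : α ≠ 0) (hβ : β ≠ 0) {w : ℍ[ℚ,α,β]} (hw : ∀ r : ℚ, w ≠ r • 1) :
    ∃ b e f : ℚ, (⟨0, b, e, f⟩ : ℍ[ℚ,α,β]) * w ≠ w * ⟨0, b, e, f⟩ := by
  by_contra! h
  have h1 := h 1 0 0
  have h2 := h 0 1 0
  have := commute_of_commute hα hβ hw h1 h2
  have := congrArg QuaternionAlgebra.imK this
  simp at this
  norm_num at this

end QuaternionBasics

/-! ### Orders of the quaternion algebra -/

section QuaternionOrders

variable {α β : ℚ}

/-- The quaternions with integral coordinates. -/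
def IntCoord (x : ℍ[ℚ,α,β]) : Prop := ∃ a b e f : ℤ, x = ⟨a, b, e, f⟩

theorem IntCoord.add {x y : ℍ[ℚ,α,β]} (hx : IntCoord x) (hy : IntCoord y) : IntCoord (x + y) := by
  obtain ⟨a, b, e, f, rfl⟩ := hx
  obtain ⟨a', b', e', f', rfl⟩ := hy
  exact ⟨a + a', b + b', e + e', f + f', by ext <;> simp⟩

theorem IntCoord.neg {x : ℍ[ℚ,α,β]} (hx : IntCoord x) : IntCoord (-x) := by
  obtain ⟨a, b, e, f, rfl⟩ := hx
  exact ⟨-a, -b, -e, -f, by ext <;> simp⟩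

theorem IntCoord.smul {x : ℍ[ℚ,α,β]} (hx : IntCoord x) (n : ℤ) : IntCoord ((n : ℚ) • x) := by
  obtain ⟨a, b, e, f, rfl⟩ := hx
  exact ⟨n * a, n * b, n * e, n * f, by ext <;> simp⟩

theorem exists_smul_intCoord (x : ℍ[ℚ,α,β]) : ∃ n : ℕ, 0 < n ∧ IntCoord ((n : ℚ) • x) := by
  have key : ∀ q : ℚ, (q.den : ℚ) * q = q.num := fun q => Rat.den_mul_eq_num q
  refine ⟨x.re.den * x.imI.den * x.imJ.den * x.imK.den, by positivity,
    x.re.num * x.imI.den * x.imJ.den * x.imK.den, x.re.den * x.imI.num * x.imJ.den * x.imK.den,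
    x.re.den * x.imI.den * x.imJ.num * x.imK.den, x.re.den * x.imI.den * x.imJ.den * x.imK.num, ?_⟩
  ext <;> simp
  · rw [← key x.re]; ring
  · rw [← key x.imI]; ring
  · rw [← key x.imJ]; ring
  · rw [← key x.imK]; ring

theorem AddSubgroup.fg_of_intCoord (S : AddSubgroup ℍ[ℚ,α,β]) {n : ℕ} (hn : 0 < n)
    (h : ∀ x ∈ S, IntCoord ((n : ℚ) • x)) : S.FG := by
  have hn' : (n : ℚ) ≠ 0 := by positivity
  let B : Submodule ℤ ℍ[ℚ,α,β] := Submodule.span ℤ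
    {⟨(n : ℚ)⁻¹, 0, 0, 0⟩, ⟨0, (n : ℚ)⁻¹, 0, 0⟩, ⟨0, 0, (n : ℚ)⁻¹, 0⟩, ⟨0, 0, 0, (n : ℚ)⁻¹⟩}
  have hB : B.FG := Submodule.fg_span (Set.toFinite _)
  have hle : AddSubgroup.toIntSubmodule S ≤ B := by
    intro x hx
    obtain ⟨a, b, e, f, hx⟩ := h x hx
    have : x = a • (⟨(n : ℚ)⁻¹, 0, 0, 0⟩ : ℍ[ℚ,α,β]) + b • (⟨0, (n : ℚ)⁻¹, 0, 0⟩ : ℍ[ℚ,α,β])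
        + e • (⟨0, 0, (n : ℚ)⁻¹, 0⟩ : ℍ[ℚ,α,β]) + f • (⟨0, 0, 0, (n : ℚ)⁻¹⟩ : ℍ[ℚ,α,β]) := by
      rw [← inv_smul_smul₀ hn' x, hx]
      ext <;> simp <;> ring
    rw [this]
    refine add_mem (add_mem (add_mem ?_ ?_) ?_) ?_ <;>
      exact B.smul_mem _ (Submodule.subset_span (by simp))
  have : (AddSubgroup.toIntSubmodule S).FG := by
    have : IsNoetherian ℤ B := isNoetherian_of_fg_of_noetherian B hB
    exact Submodule.FG.of_le hB hle
  rw [Submodule.fg_iff_addSubgroup_fg] at this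
  simpa using this

theorem IsOrder.exists_intCoord {O : Subring ℍ[ℚ,α,β]} (hO : IsOrder O) :
    ∃ n : ℕ, 0 < n ∧ ∀ x ∈ O, IntCoord ((n : ℚ) • x) := by
  obtain ⟨S, hS⟩ := hO.1
  suffices h : ∃ n : ℕ, 0 < n ∧ ∀ x ∈ S, IntCoord ((n : ℚ) • x) by
    obtain ⟨n, hn, h⟩ := h
    refine ⟨n, hn, fun x hx => ?_⟩
    replace hx : x ∈ AddSubgroup.closure (S : Set ℍ[ℚ,α,β]) := by rw [hS]; exact hx
    induction hx using AddSubgroup.closure_induction with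
    | mem x hx => exact h x hx
    | zero => exact ⟨0, 0, 0, 0, by ext <;> simp⟩
    | add x y _ _ ihx ihy => rw [smul_add]; exact ihx.add ihy
    | neg x _ ihx => rw [smul_neg]; exact ihx.neg
  clear hS
  classical
  induction S using Finset.induction_on with
  | empty => exact ⟨1, one_pos, by simp⟩
  | insert x S _ ih =>
    obtain ⟨n, hn, h⟩ := ih
    obtain ⟨k, hk, hx⟩ := exists_smul_intCoord x
    refine ⟨n * k, by positivity, fun y hy => ?_⟩
    rcases Finset.mem_insert.1 hy with rfl | hy
    · have := hx.smul n
      rw [smul_smul] at this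
      simpa using this
    · have := (h y hy).smul k
      rw [smul_smul] at this
      simpa [mul_comm] using this

theorem IsOrder.exists_smul_mem {A : Type*} [Ring A] [Algebra ℚ A] {O : Subring A}
    (hO : IsOrder O) (x : A) : ∃ n : ℕ, 0 < n ∧ (n : ℚ) • x ∈ O := by
  have hx : x ∈ Submodule.span ℚ (O : Set A) := by rw [hO.2]; trivial
  have hc : ∀ (n : ℕ) (y : A), y ∈ O → (n : ℚ) • y ∈ O := fun n y hy => by
    rw [Nat.cast_smul_eq_nsmul]; exact O.nsmul_mem hy n
  induction hx using Submodule.span_induction with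
  | mem x hx => exact ⟨1, one_pos, by simpa using hx⟩
  | zero => exact ⟨1, one_pos, by simp⟩
  | add x y _ _ ihx ihy =>
    obtain ⟨n, hn, hx⟩ := ihx
    obtain ⟨k, hk, hy⟩ := ihy
    refine ⟨n * k, by positivity, ?_⟩
    rw [smul_add]
    refine O.add_mem ?_ ?_
    · have := hc k _ hx
      rw [smul_smul] at this
      simpa [mul_comm] using this
    · have := hc n _ hy
      rw [smul_smul] at this
      simpa using this
  | smul q x _ ih =>
    obtain ⟨n, hn, hx⟩ := ih
    refine ⟨n * q.den, mul_pos hn q.den_pos, ?_⟩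
    have : ((n * q.den : ℕ) : ℚ) • q • x = q.num • ((n : ℚ) • x) := by
      rw [← Int.cast_smul_eq_zsmul ℚ, smul_smul, smul_smul, ← Rat.den_mul_eq_num q]
      push_cast; congr 1; ring
    rw [this]
    exact O.zsmul_mem hx _

theorem IsOrder.exists_smul_intCoord_mem {O : Subring ℍ[ℚ,α,β]} (hO : IsOrder O) :
    ∃ c : ℕ, 0 < c ∧ ∀ x : ℍ[ℚ,α,β], IntCoord x → (c : ℚ) • x ∈ O := by
  obtain ⟨n1, h1, m1⟩ := hO.exists_smul_mem ⟨1, 0, 0, 0⟩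
  obtain ⟨n2, h2, m2⟩ := hO.exists_smul_mem ⟨0, 1, 0, 0⟩
  obtain ⟨n3, h3, m3⟩ := hO.exists_smul_mem ⟨0, 0, 1, 0⟩
  obtain ⟨n4, h4, m4⟩ := hO.exists_smul_mem ⟨0, 0, 0, 1⟩
  refine ⟨n1 * n2 * n3 * n4, by positivity, ?_⟩
  rintro _ ⟨a, b, e, f, rfl⟩
  have : ((n1 * n2 * n3 * n4 : ℕ) : ℚ) • (⟨a, b, e, f⟩ : ℍ[ℚ,α,β]) =
      (n2 * n3 * n4 * a : ℤ) • ((n1 : ℚ) • (⟨1, 0, 0, 0⟩ : ℍ[ℚ,α,β])) +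
      (n1 * n3 * n4 * b : ℤ) • ((n2 : ℚ) • (⟨0, 1, 0, 0⟩ : ℍ[ℚ,α,β])) +
      (n1 * n2 * n4 * e : ℤ) • ((n3 : ℚ) • (⟨0, 0, 1, 0⟩ : ℍ[ℚ,α,β])) +
      (n1 * n2 * n3 * f : ℤ) • ((n4 : ℚ) • (⟨0, 0, 0, 1⟩ : ℍ[ℚ,α,β])) := by
    ext <;> simp <;> ring
  rw [this]
  exact O.add_mem (O.add_mem (O.add_mem (O.zsmul_mem m1 _) (O.zsmul_mem m2 _))
    (O.zsmul_mem m3 _)) (O.zsmul_mem m4 _)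

theorem IsOrder.inf {O₁ O₂ : Subring ℍ[ℚ,α,β]} (h₁ : IsOrder O₁) (h₂ : IsOrder O₂) :
    IsOrder (O₁ ⊓ O₂) := by
  constructor
  · obtain ⟨n, hn, h⟩ := h₁.exists_intCoord
    exact AddSubgroup.fg_of_intCoord _ hn fun x hx => h x hx.1
  · rw [eq_top_iff]
    rintro x -
    obtain ⟨n, hn, hx⟩ := h₁.exists_smul_mem x
    obtain ⟨k, hk, hy⟩ := h₂.exists_smul_mem x
    have hne : ((n * k : ℕ) : ℚ) ≠ 0 := by positivity
    rw [← inv_smul_smul₀ hne x]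
    refine Submodule.smul_mem _ _ (Submodule.subset_span ⟨?_, ?_⟩)
    · have := O₁.nsmul_mem hx k
      rw [← Nat.cast_smul_eq_nsmul ℚ, smul_smul] at this
      simpa [mul_comm] using this
    · have := O₂.nsmul_mem hy n
      rw [← Nat.cast_smul_eq_nsmul ℚ, smul_smul] at this
      simpa using this

theorem IsEichlerOrder.isOrder {O : Subring ℍ[ℚ,α,β]} {N : ℕ} (h : IsEichlerOrder O N) :
    IsOrder O := by
  obtain ⟨O₁, O₂, h₁, h₂, rfl, -⟩ := h
  exact h₁.prop.inf h₂.prop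

/-- A rational number whose powers have a common denominator is an integer. -/
theorem exists_int_of_pow_denominator {r : ℚ} {D : ℕ} (hD : 0 < D)
    (h : ∀ n : ℕ, ∃ z : ℤ, (D : ℚ) * r ^ n = z) : ∃ z : ℤ, r = z := by
  have hdvd : ∀ n : ℕ, r.den ^ n ∣ D := by
    intro n
    obtain ⟨z, hz⟩ := h n
    have h1 : (D : ℤ) * r.num ^ n = z * (r.den : ℤ) ^ n := by
      have : (r.den : ℚ) ^ n ≠ 0 := by positivity
      have e : r ^ n = (r.num : ℚ) ^ n / (r.den : ℚ) ^ n := by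
        rw [← div_pow, Rat.num_div_den]
      rw [e, ← mul_div_assoc, div_eq_iff this] at hz
      exact_mod_cast hz
    have h2 : ((r.den : ℤ) ^ n) ∣ (D : ℤ) * r.num ^ n := ⟨z, by rw [h1]; ring⟩
    have h3 : IsCoprime ((r.den : ℤ) ^ n) (r.num ^ n) := by
      apply IsCoprime.pow
      rw [Int.isCoprime_iff_gcd_eq_one, Int.gcd_comm]
      exact r.reduced
    have := h3.dvd_of_dvd_mul_right h2
    exact_mod_cast this
  have : r.den = 1 := by
    by_contra hne
    have h2 : 1 < r.den := lt_of_le_of_ne r.den_pos (Ne.symm hne)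
    have := Nat.le_of_dvd hD (hdvd D)
    exact absurd (Nat.lt_pow_self h2 (n := D)) (by omega)
  exact ⟨r.num, by rw [← Rat.den_mul_eq_num r, this]; simp⟩

theorem IsOrder.exists_reducedNorm_eq {O : Subring ℍ[ℚ,α,β]} (hO : IsOrder O) {x : ℍ[ℚ,α,β]}
    (hx : x ∈ O) : ∃ z : ℤ, reducedNorm x = z := by
  obtain ⟨n, hn, h⟩ := hO.exists_intCoord
  refine exists_int_of_pow_denominator (D := n ^ 2 * α.den * β.den) (by positivity) fun k => ?_
  obtain ⟨a, b, e, f, hy⟩ := h _ (O.pow_mem hx k)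
  refine ⟨α.den * β.den * a ^ 2 - α.num * β.den * b ^ 2 - α.den * β.num * e ^ 2
    + α.num * β.num * f ^ 2, ?_⟩
  rw [← reducedNorm_pow]
  have := reducedNorm_smul (n : ℚ) (x ^ k)
  rw [hy] at this
  push_cast
  rw [show (n : ℚ) ^ 2 * α.den * β.den * reducedNorm (x ^ k)
    = α.den * β.den * (n ^ 2 * reducedNorm (x ^ k)) by ring, ← this]
  simp only [reducedNorm]
  rw [← Rat.den_mul_eq_num α, ← Rat.den_mul_eq_num β]
  ring

theorem IsOrder.exists_trace_eq {O : Subring ℍ[ℚ,α,β]} (hO : IsOrder O) {x : ℍ[ℚ,α,β]}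
    (hx : x ∈ O) : ∃ z : ℤ, 2 * x.re = z := by
  obtain ⟨a, ha⟩ := hO.exists_reducedNorm_eq hx
  obtain ⟨b, hb⟩ := hO.exists_reducedNorm_eq (O.add_mem O.one_mem hx)
  rw [reducedNorm_one_add] at hb
  exact ⟨b - 1 - a, by push_cast; linarith⟩

theorem IsOrder.star_mem {O : Subring ℍ[ℚ,α,β]} (hO : IsOrder O) {x : ℍ[ℚ,α,β]}
    (hx : x ∈ O) : star x ∈ O := by
  obtain ⟨z, hz⟩ := hO.exists_trace_eq hx
  rw [star_eq_trace_sub, hz, Int.cast_smul_eq_zsmul]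
  exact O.sub_mem (O.zsmul_mem O.one_mem z) hx

theorem mem_invertPrime {p : ℕ} {O : Subring ℍ[ℚ,α,β]} {x : ℍ[ℚ,α,β]} :
    x ∈ invertPrime p O ↔ ∃ k : ℕ, ((p : ℚ) ^ k) • x ∈ O := by
  have : ∀ k : ℕ, (p : ℍ[ℚ,α,β]) ^ k * x = ((p : ℚ) ^ k) • x := fun k => by
    rw [← Nat.cast_pow, ← nsmul_eq_mul, ← Nat.cast_smul_eq_nsmul ℚ]; push_cast; rfl
  exact exists_congr fun k => by rw [this]

theorem le_invertPrime {A : Type*} [Ring A] [Algebra ℚ A] (p : ℕ) (O : Subring A) :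
    O ≤ invertPrime p O := fun x hx => ⟨0, by simpa using hx⟩

theorem IsOrder.star_mem_invertPrime {O : Subring ℍ[ℚ,α,β]} (hO : IsOrder O) (p : ℕ)
    {x : ℍ[ℚ,α,β]} (hx : x ∈ invertPrime p O) : star x ∈ invertPrime p O := by
  rw [mem_invertPrime] at hx ⊢
  obtain ⟨k, hk⟩ := hx
  refine ⟨k, ?_⟩
  have := hO.star_mem hk
  rwa [star_smul, star_trivial] at this

theorem smul_mem_invertPrime {p : ℕ} (hp : p ≠ 0) {O : Subring ℍ[ℚ,α,β]} {x : ℍ[ℚ,α,β]}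
    (hx : x ∈ invertPrime p O) (k : ℤ) : ((p : ℚ) ^ k) • x ∈ invertPrime p O := by
  have hp' : (p : ℚ) ≠ 0 := by exact_mod_cast hp
  rw [mem_invertPrime] at hx ⊢
  obtain ⟨l, hl⟩ := hx
  obtain ⟨n, rfl | rfl⟩ := k.eq_nat_or_neg
  · refine ⟨l, ?_⟩
    have := O.nsmul_mem hl (p ^ n)
    rw [← Nat.cast_smul_eq_nsmul ℚ, smul_smul, Nat.cast_pow] at this
    rwa [smul_smul, zpow_natCast, mul_comm]
  · refine ⟨l + n, ?_⟩
    rwa [smul_smul, zpow_neg, zpow_natCast, pow_add, mul_assoc,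
      mul_inv_cancel₀ (pow_ne_zero _ hp'), mul_one]

end QuaternionOrders

/-! ### Splitting of the quaternion algebra over the completions of `ℚ` -/

section Padic

variable {p : ℕ} [Fact p.Prime]

/-- Hensel's lemma for quadratic polynomials. -/
theorem exists_quadratic_root {t n : ℚ_[p]} (h : ‖n‖ < ‖t‖ ^ 2) :
    ∃ r : ℚ_[p], r ^ 2 - t * r + n = 0 := by
  have ht : t ≠ 0 := by
    rintro rfl
    simp at h
    linarith [norm_nonneg n]
  have hc : ‖n / t ^ 2‖ < 1 := by
    rw [norm_div, norm_pow, div_lt_one (by positivity)]; exact h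
  let c : ℤ_[p] := ⟨n / t ^ 2, hc.le⟩
  have hc' : ‖c‖ < 1 := hc
  obtain ⟨z, hz, -⟩ := hensels_lemma (p := p) (R := ℤ_[p])
    (F := Polynomial.X ^ 2 - Polynomial.X + Polynomial.C c) (a := 0) (by simpa using hc')
  refine ⟨t * z, ?_⟩
  have hz' : (z : ℚ_[p]) ^ 2 - z + n / t ^ 2 = 0 := by
    have hz2 : z ^ 2 - z + c = 0 := by simpa using hz
    have := congrArg (fun x : ℤ_[p] => (x : ℚ_[p])) hz2
    push_cast at this
    exact this
  field_simp at hz'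
  linear_combination hz'

/-- The non-zero squares of `ℚ_p` form an open set. -/
theorem eventually_square {a : ℚ_[p]} (ha : a ≠ 0) :
    ∀ᶠ x in nhds (a ^ 2), ∃ s : ℚ_[p], s ≠ 0 ∧ s ^ 2 = x := by
  have h1 : ∀ᶠ x in nhds (a ^ 2), ‖a ^ 2 - x‖ < ‖2 * a‖ ^ 2 := by
    have : Filter.Tendsto (fun x => ‖a ^ 2 - x‖) (nhds (a ^ 2)) (nhds ‖a ^ 2 - a ^ 2‖) :=
      (continuous_const.sub continuous_id).norm.tendsto _
    refine this.eventually_lt_const ?_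
    rw [sub_self, norm_zero]
    have : 2 * a ≠ 0 := mul_ne_zero two_ne_zero ha
    positivity
  have h2 : ∀ᶠ x in nhds (a ^ 2), x ≠ 0 := eventually_ne_nhds (pow_ne_zero 2 ha)
  filter_upwards [h1, h2] with x hx hx0
  obtain ⟨r, hr⟩ := exists_quadratic_root hx
  have e : (r - a) ^ 2 = x := by linear_combination hr
  exact ⟨r - a, fun h => hx0 (by rw [← e, h]; ring), e⟩

end Padic

section Splitting

variable {α β : ℚ}

/-- Extension of scalars of a quaternion algebra, in coordinates. -/
def scalarExtension (F : Type*) [Field F] [Algebra ℚ F] :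
    F ⊗[ℚ] ℍ[ℚ,α,β] →ₐ[F] ℍ[F,(algebraMap ℚ F α),(algebraMap ℚ F β)] :=
  Algebra.TensorProduct.lift (Algebra.ofId F _)
    ({ toFun := fun x => ⟨algebraMap ℚ F x.re, algebraMap ℚ F x.imI, algebraMap ℚ F x.imJ,
          algebraMap ℚ F x.imK⟩
       map_one' := by ext <;> simp [-eq_ratCast]
       map_zero' := by ext <;> simp [-eq_ratCast]
       map_add' := fun x y => by ext <;> simp [-eq_ratCast]
       map_mul' := fun x y => by ext <;> simp [-eq_ratCast]
       commutes' := fun r => by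
        rw [IsScalarTower.algebraMap_apply ℚ F ℍ[F,(algebraMap ℚ F α),(algebraMap ℚ F β)] r,
          QuaternionAlgebra.algebraMap_eq, QuaternionAlgebra.algebraMap_eq]
        ext <;> simp only [map_zero] } :
      ℍ[ℚ,α,β] →ₐ[ℚ] ℍ[F,(algebraMap ℚ F α),(algebraMap ℚ F β)])
    (fun _ _ => Algebra.commutes _ _)

theorem scalarExtension_one_tmul (F : Type*) [Field F] [Algebra ℚ F] (x : ℍ[ℚ,α,β]) :
    scalarExtension F (1 ⊗ₜ[ℚ] x) = ⟨algebraMap ℚ F x.re, algebraMap ℚ F x.imI,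
      algebraMap ℚ F x.imJ, algebraMap ℚ F x.imK⟩ := by
  simp [scalarExtension]

/-- If `H` is ramified at a place, the field generated by a non-scalar element does not split
there. -/
theorem IsRamifiedOver.false_of_root {F : Type*} [Field F] [Algebra ℚ F]
    (h : IsRamifiedOver F ℍ[ℚ,α,β]) {z : ℍ[ℚ,α,β]} (hz : ∀ r : ℚ, z ≠ r • 1) {r : F}
    (hr : r ^ 2 - algebraMap ℚ F (2 * z.re) * r + algebraMap ℚ F (reducedNorm z) = 0) : False := by
  have hne : ∀ a : F, (1 : F) ⊗ₜ[ℚ] z - algebraMap F (F ⊗[ℚ] ℍ[ℚ,α,β]) a ≠ 0 := by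
    intro a ha
    have := congrArg (scalarExtension F) ha
    rw [map_sub, scalarExtension_one_tmul, AlgHom.commutes, map_zero] at this
    have hI := congrArg QuaternionAlgebra.imI this
    have hJ := congrArg QuaternionAlgebra.imJ this
    have hK := congrArg QuaternionAlgebra.imK this
    simp at hI hJ hK
    have : CharZero F := algebraRat.charZero F
    rw [Rat.cast_eq_zero] at hI hJ hK
    exact hz z.re (by ext <;> simp [hI, hJ, hK])
  have hu := h _ (hne r)
  apply hne (algebraMap ℚ F (2 * z.re) - r)
  refine hu.mul_right_eq_zero.1 ?_
  have e1 : (1 : F) ⊗ₜ[ℚ] z * (1 : F) ⊗ₜ[ℚ] z = algebraMap F _ (algebraMap ℚ F (2 * z.re)) *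
      (1 : F) ⊗ₜ[ℚ] z - algebraMap F _ (algebraMap ℚ F (reducedNorm z)) := by
    rw [Algebra.TensorProduct.tmul_mul_tmul, mul_self_eq, TensorProduct.tmul_sub, mul_one,
      TensorProduct.tmul_smul, TensorProduct.tmul_smul, ← IsScalarTower.algebraMap_apply,
      ← IsScalarTower.algebraMap_apply, ← Algebra.TensorProduct.one_def,
      Algebra.algebraMap_eq_smul_one, Algebra.algebraMap_eq_smul_one, smul_mul_assoc, one_mul]
  have e2 : (1 : F) ⊗ₜ[ℚ] z * algebraMap F (F ⊗[ℚ] ℍ[ℚ,α,β]) (algebraMap ℚ F (2 * z.re) - r) =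
      algebraMap F (F ⊗[ℚ] ℍ[ℚ,α,β]) (algebraMap ℚ F (2 * z.re) - r) * (1 : F) ⊗ₜ[ℚ] z :=
    (Algebra.commutes _ _).symm
  have e3 : algebraMap F (F ⊗[ℚ] ℍ[ℚ,α,β]) (algebraMap ℚ F (reducedNorm z)) =
      algebraMap F (F ⊗[ℚ] ℍ[ℚ,α,β]) r *
      (algebraMap F (F ⊗[ℚ] ℍ[ℚ,α,β]) (algebraMap ℚ F (2 * z.re) - r)) := by
    rw [← map_mul]; congr 1; linear_combination hr
  rw [sub_mul, mul_sub, mul_sub, e1, e2, e3, map_sub, sub_mul]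
  abel

theorem IsDefinite.neg (h : IsDefinite ℍ[ℚ,α,β]) : α < 0 ∧ β < 0 := by
  constructor <;> by_contra! h0
  · refine IsRamifiedOver.false_of_root h (z := ⟨0, 1, 0, 0⟩) (r := √(α : ℝ)) ?_ ?_
    · intro r hr
      simpa using congrArg QuaternionAlgebra.imI hr
    · have : (0 : ℝ) ≤ α := by exact_mod_cast h0
      simp [reducedNorm, Real.sq_sqrt this]
  · refine IsRamifiedOver.false_of_root h (z := ⟨0, 0, 1, 0⟩) (r := √(β : ℝ)) ?_ ?_
    · intro r hr
      simpa using congrArg QuaternionAlgebra.imJ hr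
    · have : (0 : ℝ) ≤ β := by exact_mod_cast h0
      simp [reducedNorm, Real.sq_sqrt this]

theorem not_isRamifiedOver_of_matrix {F : Type*} [Field F] [Algebra ℚ F]
    (Φ : (F ⊗[ℚ] ℍ[ℚ,α,β]) ≃ₐ[F] Matrix (Fin 2) (Fin 2) F) : ¬ IsRamifiedOver F ℍ[ℚ,α,β] := by
  intro h
  have h1 : !![(1 : F), 0; 0, 0] ≠ 0 := by
    intro h; simpa using congrFun (congrFun h 0) 0
  have h2 := (h (Φ.symm !![1, 0; 0, 0]) (by simpa using h1)).map Φ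
  rw [AlgEquiv.apply_symm_apply, Matrix.isUnit_iff_isUnit_det] at h2
  simp at h2

/-- The condition that the quaternion algebra `(α, β)` splits over `F`: the entry `β` is a norm from
`F(√α)`. -/
def IsSplitOver (F : Type*) [Field F] (α β : ℚ) : Prop :=
  ∃ r s : F, (β : F) = r ^ 2 - α * s ^ 2

theorem isRamifiedOver_of_not_isSplitOver {F : Type*} [Field F] [Algebra ℚ F] (hα : α ≠ 0)
    (h : ¬ IsSplitOver F α β) : IsRamifiedOver F ℍ[ℚ,α,β] := by
  have : CharZero F := algebraRat.charZero F
  let b : QuaternionAlgebra.Basis (F ⊗[ℚ] ℍ[ℚ,α,β]) (algebraMap ℚ F α) 0 (algebraMap ℚ F β) :=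
    { i := 1 ⊗ₜ ⟨0, 1, 0, 0⟩
      j := 1 ⊗ₜ ⟨0, 0, 1, 0⟩
      k := 1 ⊗ₜ ⟨0, 0, 0, 1⟩
      i_mul_i := by
        rw [Algebra.TensorProduct.tmul_mul_tmul, zero_smul, add_zero, algebraMap_smul,
          Algebra.TensorProduct.one_def, ← TensorProduct.tmul_smul, mul_one]
        congr 1; ext <;> simp
      j_mul_j := by
        rw [Algebra.TensorProduct.tmul_mul_tmul, algebraMap_smul,
          Algebra.TensorProduct.one_def, ← TensorProduct.tmul_smul, mul_one]
        congr 1; ext <;> simp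
      i_mul_j := by
        rw [Algebra.TensorProduct.tmul_mul_tmul, mul_one]
        congr 1; ext <;> simp
      j_mul_i := by
        rw [Algebra.TensorProduct.tmul_mul_tmul, mul_one, zero_smul, zero_sub,
          ← TensorProduct.tmul_neg]
        congr 1; ext <;> simp }
  have hsurj : ∀ z : F ⊗[ℚ] ℍ[ℚ,α,β], z ∈ (QuaternionAlgebra.lift b).range := by
    have hi : b.i ∈ (QuaternionAlgebra.lift b).range := ⟨⟨0, 1, 0, 0⟩, by
      simp [QuaternionAlgebra.lift, QuaternionAlgebra.Basis.liftHom,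
        QuaternionAlgebra.Basis.lift]⟩
    have hj : b.j ∈ (QuaternionAlgebra.lift b).range := ⟨⟨0, 0, 1, 0⟩, by
      simp [QuaternionAlgebra.lift, QuaternionAlgebra.Basis.liftHom,
        QuaternionAlgebra.Basis.lift]⟩
    have hk : b.k ∈ (QuaternionAlgebra.lift b).range := ⟨⟨0, 0, 0, 1⟩, by
      simp [QuaternionAlgebra.lift, QuaternionAlgebra.Basis.liftHom,
        QuaternionAlgebra.Basis.lift]⟩
    intro z
    induction z using TensorProduct.induction_on with
    | zero => exact zero_mem _
    | add x y hx hy => exact add_mem hx hy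
    | tmul a x =>
      have e : a ⊗ₜ[ℚ] x = a • (algebraMap ℚ F x.re • (1 : F ⊗[ℚ] ℍ[ℚ,α,β]) +
          algebraMap ℚ F x.imI • b.i + algebraMap ℚ F x.imJ • b.j +
          algebraMap ℚ F x.imK • b.k) := by
        simp only [b, algebraMap_smul, Algebra.TensorProduct.one_def, ← TensorProduct.tmul_smul,
          ← TensorProduct.tmul_add]
        rw [TensorProduct.smul_tmul', smul_eq_mul, mul_one]
        congr 1; ext <;> simp
      rw [e]
      exact Subalgebra.smul_mem _ (add_mem (add_mem (add_mem (Subalgebra.smul_mem _ (one_mem _) _)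
        (Subalgebra.smul_mem _ hi _)) (Subalgebra.smul_mem _ hj _)) (Subalgebra.smul_mem _ hk _)) _
  have eα : algebraMap ℚ F α = (α : F) := eq_ratCast _ _
  have eβ : algebraMap ℚ F β = (β : F) := eq_ratCast _ _
  have hα0 : (α : F) ≠ 0 := by exact_mod_cast hα
  -- over `F` the norm form is anisotropic, because `β` is not a norm from `F(√α)`
  have hns : ∀ σ : F, σ ^ 2 ≠ α := by
    intro σ hσ
    have hσ0 : σ ≠ 0 := by rintro rfl; simp at hσ; exact hα0 hσ.symm
    refine h ⟨(β + 1) / 2, (β - 1) / (2 * σ), ?_⟩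
    rw [← hσ]; field_simp; ring
  have hbin : ∀ x y : F, x ^ 2 - α * y ^ 2 = 0 → x = 0 ∧ y = 0 := by
    intro x y hxy
    by_cases hy : y = 0
    · subst hy; simpa using hxy
    · refine absurd ?_ (hns (x / y))
      field_simp; linear_combination hxy
  intro z hz
  obtain ⟨w, rfl⟩ := hsurj z
  have hw : w ≠ 0 := by rintro rfl; exact hz (map_zero _)
  have hN : (w.re ^ 2 - α * w.imI ^ 2) - β * (w.imJ ^ 2 - α * w.imK ^ 2) ≠ 0 := by
    intro h0
    by_cases hd : w.imJ ^ 2 - α * w.imK ^ 2 = 0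
    · obtain ⟨h3, h4⟩ := hbin _ _ hd
      rw [hd, mul_zero, sub_zero] at h0
      obtain ⟨h1, h2⟩ := hbin _ _ h0
      exact hw (by ext <;> simp [h1, h2, h3, h4])
    · refine h ⟨(w.re * w.imJ + α * w.imI * w.imK) / (w.imJ ^ 2 - α * w.imK ^ 2),
        (w.re * w.imK + w.imI * w.imJ) / (w.imJ ^ 2 - α * w.imK ^ 2), ?_⟩
      field_simp
      linear_combination (-(w.imJ ^ 2 - α * w.imK ^ 2)) * h0
  have hmul : ∀ v : ℍ[F,(algebraMap ℚ F α),(algebraMap ℚ F β)], v * star v = algebraMap F _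
      ((v.re ^ 2 - α * v.imI ^ 2) - β * (v.imJ ^ 2 - α * v.imK ^ 2)) := by
    intro v
    rw [← eα, ← eβ, QuaternionAlgebra.algebraMap_eq]
    ext <;> simp <;> ring
  have hmul' : star w * w = algebraMap F _
      ((w.re ^ 2 - α * w.imI ^ 2) - β * (w.imJ ^ 2 - α * w.imK ^ 2)) := by
    have := hmul (star w)
    rw [star_star] at this
    rw [this]; simp
  have hwu : IsUnit w := by
    set v := (w.re ^ 2 - α * w.imI ^ 2) - β * (w.imJ ^ 2 - α * w.imK ^ 2) with hv
    refine ⟨⟨w, v⁻¹ • star w, ?_, ?_⟩, rfl⟩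
    · rw [mul_smul_comm, hmul w, ← hv, Algebra.smul_def, ← map_mul, inv_mul_cancel₀ hN, map_one]
    · rw [smul_mul_assoc, hmul', Algebra.smul_def, ← map_mul, inv_mul_cancel₀ hN, map_one]
  exact hwu.map _

/-- The regular representation of `(α, β)` on `F(√α)`, when `β = r² - α s²` is a norm from
`F(√α)`: `i` acts as multiplication by `√α`, and `j` as conjugation followed by multiplication by
`r + s √α`. -/
def splitRep {F : Type*} [Field F] [CharZero F] {r s : F} (h : (β : F) = r ^ 2 - α * s ^ 2) :
    ℍ[ℚ,α,β] →+* Matrix (Fin 2) (Fin 2) F where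
  toFun x := !![x.re + r * x.imJ + α * s * x.imK, α * x.imI - s * α * x.imJ - α * r * x.imK;
    x.imI + s * x.imJ + r * x.imK, x.re - r * x.imJ - s * α * x.imK]
  map_one' := by simp [Matrix.one_fin_two]
  map_zero' := by
    ext i j; fin_cases i <;> fin_cases j <;> simp
  map_add' x y := by
    ext i j; fin_cases i <;> fin_cases j <;> simp <;> ring
  map_mul' x y := by
    rw [Matrix.mul_fin_two]
    ext i j; fin_cases i <;> fin_cases j <;> simp [h] <;> ring

variable {F : Type*} [Field F] [CharZero F] {r s : F} (h : (β : F) = r ^ 2 - α * s ^ 2)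

theorem splitRep_apply (x : ℍ[ℚ,α,β]) : splitRep h x =
    !![x.re + r * x.imJ + α * s * x.imK, α * x.imI - s * α * x.imJ - α * r * x.imK;
    x.imI + s * x.imJ + r * x.imK, x.re - r * x.imJ - s * α * x.imK] := rfl

theorem det_splitRep (x : ℍ[ℚ,α,β]) : (splitRep h x).det = (reducedNorm x : F) := by
  rw [splitRep_apply, Matrix.det_fin_two_of, reducedNorm]
  push_cast
  rw [h]
  ring

theorem trace_splitRep (x : ℍ[ℚ,α,β]) : (splitRep h x).trace = ((2 * x.re : ℚ) : F) := by
  rw [splitRep_apply, Matrix.trace_fin_two_of]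
  push_cast
  ring

theorem splitRep_smul (q : ℚ) (x : ℍ[ℚ,α,β]) : splitRep h (q • x) = (q : F) • splitRep h x := by
  rw [splitRep_apply, splitRep_apply]
  ext i j; fin_cases i <;> fin_cases j <;> simp <;> ring

/-- At a prime where the quaternion algebra splits there is a quadratic subfield that splits at this
prime too; it can be chosen not to contain a given non-scalar element. -/
theorem exists_pure_splitting {p : ℕ} [Fact p.Prime] (hα : α ≠ 0) (hβ : β ≠ 0)
    (hs : IsSplitOver ℚ_[p] α β) {w : ℍ[ℚ,α,β]} (hw : ∀ r : ℚ, w ≠ r • 1) :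
    ∃ y : ℍ[ℚ,α,β], y.re = 0 ∧ y * w ≠ w * y ∧
      ∃ σ : ℚ_[p], σ ≠ 0 ∧ σ ^ 2 = ((-reducedNorm y : ℚ) : ℚ_[p]) := by
  obtain ⟨r, s, h⟩ := hs
  have hα' : (α : ℚ_[p]) ≠ 0 := by exact_mod_cast hα
  have hβ' : (β : ℚ_[p]) ≠ 0 := by exact_mod_cast hβ
  -- a `p`-adic pure quaternion whose square is a non-zero square
  obtain ⟨η, σ, hσ, hη⟩ : ∃ η : ℚ_[p] × ℚ_[p] × ℚ_[p], ∃ σ : ℚ_[p], σ ≠ 0 ∧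
      σ ^ 2 = α * η.1 ^ 2 + β * η.2.1 ^ 2 - α * β * η.2.2 ^ 2 := by
    by_cases hr : r = 0
    · subst hr
      have hs : s ≠ 0 := by rintro rfl; simp at h; exact hβ h
      exact ⟨(0, 0, 1), α * s, mul_ne_zero hα' hs, by simp [h]; ring⟩
    · exact ⟨(s, 1, 0), r, hr, by simp [h]⟩
  let f : ℚ_[p] × ℚ_[p] × ℚ_[p] → ℚ_[p] :=
    fun η => α * η.1 ^ 2 + β * η.2.1 ^ 2 - α * β * η.2.2 ^ 2
  have hf : Continuous f := by fun_prop
  have hev : ∀ᶠ x in nhds η, ∃ s : ℚ_[p], s ≠ 0 ∧ s ^ 2 = f x := by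
    have := eventually_square hσ
    rw [hη] at this
    exact hf.continuousAt.eventually this
  obtain ⟨ε, hε, hball⟩ := Metric.eventually_nhds_iff.1 hev
  obtain ⟨q1, h1⟩ := Padic.rat_dense p η.1 hε
  obtain ⟨q2, h2⟩ := Padic.rat_dense p η.2.1 hε
  obtain ⟨q3, h3⟩ := Padic.rat_dense p η.2.2 hε
  obtain ⟨b, e, g, hbeg⟩ := exists_not_commute hα hβ hw
  have hgood : ∀ a1 a2 a3 : ℚ, ‖η.1 - a1‖ < ε → ‖η.2.1 - a2‖ < ε → ‖η.2.2 - a3‖ < ε →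
      ∃ σ : ℚ_[p], σ ≠ 0 ∧ σ ^ 2 = ((-reducedNorm (⟨0, a1, a2, a3⟩ : ℍ[ℚ,α,β]) : ℚ) : ℚ_[p]) := by
    intro a1 a2 a3 h1 h2 h3
    have hd : dist ((a1 : ℚ_[p]), (a2 : ℚ_[p]), (a3 : ℚ_[p])) η < ε := by
      rw [dist_comm, Prod.dist_eq, Prod.dist_eq, dist_eq_norm, dist_eq_norm, dist_eq_norm]
      exact max_lt h1 (max_lt h2 h3)
    obtain ⟨s, hs, e⟩ := hball hd
    refine ⟨s, hs, e.trans ?_⟩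
    simp only [f, reducedNorm]
    push_cast; ring
  by_cases hc : (⟨0, q1, q2, q3⟩ : ℍ[ℚ,α,β]) * w = w * ⟨0, q1, q2, q3⟩
  · have hsmall : ∃ k : ℕ, ∀ c ∈ ({b, e, g} : Finset ℚ), ‖((p ^ k * c : ℚ) : ℚ_[p])‖ < ε := by
      have : ∀ c : ℚ, ∀ᶠ k : ℕ in Filter.atTop, ‖((p ^ k * c : ℚ) : ℚ_[p])‖ < ε := by
        intro c
        have ht : Filter.Tendsto (fun k : ℕ => ‖((p : ℚ_[p]) ^ k) * c‖) Filter.atTop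
            (nhds ‖(0 : ℚ_[p]) * c‖) :=
          ((tendsto_pow_atTop_nhds_zero_of_norm_lt_one Padic.norm_p_lt_one).mul_const _).norm
        rw [zero_mul, norm_zero] at ht
        filter_upwards [ht.eventually_lt_const hε] with k hk
        simpa using hk
      exact ((Finset.eventually_all _).2 fun c _ => this c).exists
    obtain ⟨k, hk⟩ := hsmall
    have hadd : ∀ (x : ℚ_[p]) (q c : ℚ), ‖x - q‖ < ε → c ∈ ({b, e, g} : Finset ℚ) →
        ‖x - ((q + p ^ k * c : ℚ) : ℚ_[p])‖ < ε := by
      intro x q c hq hc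
      rw [Rat.cast_add, ← sub_sub, sub_eq_add_neg]
      refine (Padic.nonarchimedean _ _).trans_lt (max_lt hq ?_)
      rw [norm_neg]; exact hk c hc
    refine ⟨⟨0, q1 + p ^ k * b, q2 + p ^ k * e, q3 + p ^ k * g⟩, rfl, ?_,
      hgood _ _ _ (hadd _ _ _ h1 (by simp)) (hadd _ _ _ h2 (by simp)) (hadd _ _ _ h3 (by simp))⟩
    intro hcc
    have hsplit : (⟨0, q1 + p ^ k * b, q2 + p ^ k * e, q3 + p ^ k * g⟩ : ℍ[ℚ,α,β]) =
        ⟨0, q1, q2, q3⟩ + (p ^ k : ℚ) • ⟨0, b, e, g⟩ := by ext <;> simp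
    have hp : (p ^ k : ℚ) ≠ 0 := pow_ne_zero _ (by exact_mod_cast (Fact.out : p.Prime).ne_zero)
    rw [hsplit, add_mul, mul_add, hc, add_right_inj, smul_mul_assoc, mul_smul_comm] at hcc
    exact hbeg (smul_right_injective _ hp hcc)
  · exact ⟨⟨0, q1, q2, q3⟩, rfl, hc, hgood _ _ _ h1 h2 h3⟩

end Splitting

/-! ### Elements of norm one that are hyperbolic at a given prime -/

section Pell

variable {p : ℕ} [Fact p.Prime]

/-- Thue's lemma: if `-n` is a square in `ℤ_p`, small multiples of `p ^ k` are represented by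
`X² + n Y²`, with `X / Y` close to a given square root of `-n`. -/
theorem exists_small_norm {n : ℕ} (hn : 0 < n) {σ : ℤ_[p]} (hσ : σ ^ 2 = -n) (k : ℕ) :
    ∃ X Y c : ℤ, 0 < c ∧ c ≤ n + 1 ∧ X ^ 2 + n * Y ^ 2 = c * p ^ k ∧
      ‖(X : ℤ_[p]) - σ * Y‖ ≤ (p : ℝ) ^ (-k : ℤ) := by
  have hp : 0 < p := (Fact.out : p.Prime).pos
  have : NeZero (p ^ k) := ⟨(pow_pos hp k).ne'⟩
  set m := Nat.sqrt (p ^ k) with hm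
  let f : Fin (m + 1) × Fin (m + 1) → ZMod (p ^ k) :=
    fun v => (v.1 : ℕ) - PadicInt.toZModPow k σ * (v.2 : ℕ)
  have hcard : Fintype.card (ZMod (p ^ k)) < Fintype.card (Fin (m + 1) × Fin (m + 1)) := by
    rw [ZMod.card, Fintype.card_prod, Fintype.card_fin]
    exact Nat.lt_succ_sqrt _
  obtain ⟨v, v', hne, hf⟩ := Fintype.exists_ne_map_eq_of_card_lt f hcard
  set X : ℤ := (v.1 : ℕ) - (v'.1 : ℕ) with hX
  set Y : ℤ := (v.2 : ℕ) - (v'.2 : ℕ) with hY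
  have hXY : X ≠ 0 ∨ Y ≠ 0 := by
    by_contra! h
    apply hne
    ext <;> omega
  have hker : PadicInt.toZModPow k ((X : ℤ_[p]) - σ * (Y : ℤ_[p])) = 0 := by
    simp only [hX, hY, map_sub, map_mul, map_intCast]
    simp only [f] at hf
    push_cast
    linear_combination hf
  have hb : ∀ a b : Fin (m + 1), (((a : ℕ) : ℤ) - (b : ℕ)) ^ 2 ≤ p ^ k := by
    intro a b
    have h1 : (m : ℤ) * m ≤ p ^ k := by exact_mod_cast Nat.sqrt_le (p ^ k)
    have h2 : |((a : ℕ) : ℤ) - (b : ℕ)| ≤ m := by rw [abs_le]; constructor <;> omega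
    calc _ = |((a : ℕ) : ℤ) - (b : ℕ)| ^ 2 := (sq_abs _).symm
      _ ≤ (m : ℤ) ^ 2 := by gcongr
      _ ≤ _ := by rwa [sq]
  have hdvd : ((p ^ k : ℕ) : ℤ) ∣ X ^ 2 + n * Y ^ 2 := by
    rw [← ZMod.intCast_zmod_eq_zero_iff_dvd]
    have hσ' : (PadicInt.toZModPow k σ) ^ 2 = -(n : ZMod (p ^ k)) := by
      rw [← map_pow, hσ, map_neg, map_natCast]
    rw [map_sub, map_mul, map_intCast, map_intCast] at hker
    push_cast
    linear_combination ((X : ZMod (p ^ k)) + PadicInt.toZModPow k σ * Y) * hker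
      + (Y : ZMod (p ^ k)) ^ 2 * hσ'
  obtain ⟨c, hc⟩ := hdvd
  have hpk : (0 : ℤ) < p ^ k := by positivity
  have hpos : 0 < X ^ 2 + n * Y ^ 2 := by
    have hn' : (0 : ℤ) < n := by exact_mod_cast hn
    rcases hXY with h | h
    · have := mul_nonneg hn'.le (sq_nonneg Y)
      have := pow_pos (abs_pos.2 h) 2
      rw [sq_abs] at this; linarith
    · have := pow_pos (abs_pos.2 h) 2
      rw [sq_abs] at this
      have := mul_pos hn' this
      have := sq_nonneg X; linarith
  have hle : X ^ 2 + n * Y ^ 2 ≤ (n + 1) * p ^ k := by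
    have h1 := hb v.1 v'.1
    have h2 := mul_le_mul_of_nonneg_left (hb v.2 v'.2) (Int.natCast_nonneg n)
    simp only [hX, hY]; linarith
  rw [hc] at hpos hle
  push_cast at hpos hle hc
  refine ⟨X, Y, c, by
    by_contra! h; nlinarith, le_of_mul_le_mul_right (by linarith) hpk, by rw [hc]; ring, ?_⟩
  rw [PadicInt.norm_le_pow_iff_mem_span_pow, ← PadicInt.ker_toZModPow]
  exact hker

/-- A solution of the Pell-like equation `U² + n V² = p ^ k` for which `U + V √-n` has different
valuations at the two places above `p`. -/
theorem exists_pell {n : ℕ} (hn : 0 < n) {σ : ℤ_[p]} (hσ : σ ^ 2 = -n) :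
    ∃ (U V : ℤ) (k : ℕ), U ^ 2 + n * V ^ 2 = p ^ k ∧
      1 < ‖((2 * (U ^ 2 - n * V ^ 2) / p ^ k : ℚ) : ℚ_[p])‖ := by
  have hp1 : 1 < p := (Fact.out : p.Prime).one_lt
  have hp0 : (p : ℝ) ≠ 0 := by positivity
  obtain ⟨T, hT⟩ : ∃ T : ℕ, (n + 1) ^ 2 < p ^ T := ⟨_, Nat.lt_pow_self hp1⟩
  choose X Y c hc0 hc1 hXY hnorm using fun j : ℕ => exists_small_norm hn hσ (T * j)
  let I : Finset ℤ := Finset.Icc 0 (n + 1)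
  have hmod : ∀ j (Z : ℤ), Z % c j ∈ I := fun j Z => by
    have h1 := Int.emod_nonneg Z (hc0 j).ne'
    have h2 := Int.emod_lt_of_pos Z (hc0 j)
    have h3 := hc1 j
    simp only [I, Finset.mem_Icc]; omega
  let f : ℕ → I × I × I := fun j => (⟨c j, by
    have h1 := hc0 j
    have h3 := hc1 j
    simp only [I, Finset.mem_Icc]; omega⟩, ⟨X j % c j, hmod _ _⟩, ⟨Y j % c j, hmod _ _⟩)
  obtain ⟨i, j, hij, hf⟩ : ∃ i j, i < j ∧ f i = f j := by
    obtain ⟨i, j, hne, hf⟩ := Finite.exists_ne_map_eq_of_infinite f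
    rcases lt_or_gt_of_ne hne with h | h
    · exact ⟨i, j, h, hf⟩
    · exact ⟨j, i, h, hf.symm⟩
  have hcc : c i = c j := congrArg (fun t => ((t.1 : I) : ℤ)) hf
  have hXX : X i % c i = X j % c j := congrArg (fun t => ((t.2.1 : I) : ℤ)) hf
  have hYY : Y i % c i = Y j % c j := congrArg (fun t => ((t.2.2 : I) : ℤ)) hf
  rw [← hcc] at hXX hYY
  obtain ⟨u, hu⟩ : c i ∣ X j - X i := Int.ModEq.dvd hXX
  obtain ⟨v, hv⟩ : c i ∣ Y j - Y i := Int.ModEq.dvd hYY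
  have hXi := hXY i
  have hXj := hXY j
  rw [← hcc] at hXj
  set C := c i with hC
  have hC0 : C ≠ 0 := (hc0 i).ne'
  -- the quotient of the two solutions, `(X j + Y j √-n) (X i - Y i √-n) / C`
  obtain ⟨U, hU⟩ : ∃ U, X j * X i + n * (Y j * Y i) = C * U :=
    ⟨p ^ (T * i) + u * X i + n * (v * Y i), by linear_combination hXi + X i * hu + n * Y i * hv⟩
  obtain ⟨V, hV⟩ : ∃ V, Y j * X i - X j * Y i = C * V :=
    ⟨v * X i - u * Y i, by linear_combination X i * hv - Y i * hu⟩
  have hUV : U ^ 2 + n * V ^ 2 = p ^ (T * i + T * j) := by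
    have : C ^ 2 * (U ^ 2 + n * V ^ 2) = C ^ 2 * p ^ (T * i + T * j) := by
      calc _ = (C * U) ^ 2 + n * (C * V) ^ 2 := by ring
        _ = (X i ^ 2 + n * Y i ^ 2) * (X j ^ 2 + n * Y j ^ 2) := by rw [← hU, ← hV]; ring
        _ = _ := by rw [hXi, hXj]; ring
    exact mul_left_cancel₀ (pow_ne_zero 2 hC0) this
  refine ⟨U, V, _, hUV, ?_⟩
  have hσ' : (σ : ℚ_[p]) ^ 2 = -n := by
    have := congrArg (fun x : ℤ_[p] => (x : ℚ_[p])) hσ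
    push_cast at this; exact this
  set A : ℚ_[p] := U - σ * V with hA
  set B : ℚ_[p] := U + σ * V with hB
  have hAB : A * B = p ^ (T * i + T * j) := by
    have : ((U ^ 2 + n * V ^ 2 : ℤ) : ℚ_[p]) = ((p ^ (T * i + T * j) : ℤ) : ℚ_[p]) := by
      rw [hUV]
    push_cast at this
    rw [← this, hA, hB]
    linear_combination (-(V : ℚ_[p]) ^ 2) * hσ'
  have hpQ : (p : ℚ_[p]) ≠ 0 := by exact_mod_cast (by positivity : p ≠ 0)
  have hAne : A ≠ 0 := by
    intro h; rw [h, zero_mul] at hAB; exact pow_ne_zero _ hpQ hAB.symm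
  have hCA : (C : ℚ_[p]) * A = (X j - σ * Y j) * (X i + σ * Y i) := by
    have hU' : (X j : ℚ_[p]) * X i + n * (Y j * Y i) = C * U := by exact_mod_cast hU
    have hV' : (Y j : ℚ_[p]) * X i - X j * Y i = C * V := by exact_mod_cast hV
    rw [hA]
    linear_combination -hU' + σ * hV' + (Y i * Y j) * hσ'
  have hCn : (1 : ℝ) / (n + 1) ≤ ‖(C : ℚ_[p])‖ := by
    have hdvd : ¬ ((p ^ (Nat.log p C.natAbs + 1) : ℕ) : ℤ) ∣ C := by
      intro h
      have := Nat.le_of_dvd (Int.natAbs_pos.2 hC0) (Int.natCast_dvd.1 h)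
      exact absurd (Nat.lt_pow_succ_log_self hp1 C.natAbs) (not_lt.2 this)
    have h1 : (p : ℝ) ^ (-(Nat.log p C.natAbs : ℤ)) ≤ ‖(C : ℚ_[p])‖ := by
      by_contra! h
      apply hdvd
      have := (Padic.norm_int_le_pow_iff_dvd (p := p) C (Nat.log p C.natAbs + 1)).1 ?_
      · exact_mod_cast this
      · rw [Padic.norm_le_pow_iff_norm_lt_pow_add_one]
        push_cast
        simpa using h
    refine le_trans ?_ h1
    rw [zpow_neg, zpow_natCast, one_div]
    apply inv_anti₀ (by positivity)
    have h2 : p ^ Nat.log p C.natAbs ≤ C.natAbs := Nat.pow_log_le_self p (Int.natAbs_pos.2 hC0).ne'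
    have h3 : C.natAbs ≤ n + 1 := by have := hc0 i; have := hc1 i; omega
    exact_mod_cast h2.trans h3
  have hAnorm : ‖A‖ ≤ (n + 1) * (p : ℝ) ^ (-(T * j : ℕ) : ℤ) := by
    have h1 : ‖(C : ℚ_[p])‖ * ‖A‖ ≤ (p : ℝ) ^ (-(T * j : ℕ) : ℤ) := by
      rw [← norm_mul, hCA, norm_mul]
      have h2 : ‖(X j : ℚ_[p]) - σ * Y j‖ ≤ (p : ℝ) ^ (-(T * j : ℕ) : ℤ) := by
        have := hnorm j
        rw [PadicInt.norm_def] at this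
        push_cast at this ⊢
        exact this
      have h3 : ‖(X i : ℚ_[p]) + σ * Y i‖ ≤ 1 := by
        have := PadicInt.norm_le_one ((X i : ℤ_[p]) + σ * (Y i : ℤ_[p]))
        rw [PadicInt.norm_def] at this
        push_cast at this
        exact this
      calc _ ≤ (p : ℝ) ^ (-(T * j : ℕ) : ℤ) * 1 := by gcongr
        _ = _ := mul_one _
    have h4 : (1 : ℝ) / (n + 1) * ‖A‖ ≤ (p : ℝ) ^ (-(T * j : ℕ) : ℤ) :=
      (mul_le_mul_of_nonneg_right hCn (norm_nonneg _)).trans h1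
    rw [one_div, inv_mul_le_iff₀ (by positivity)] at h4
    exact h4
  have hABnorm : ‖A‖ * ‖B‖ = (p : ℝ) ^ (-(T * i + T * j : ℕ) : ℤ) := by
    rw [← norm_mul, hAB, Padic.norm_p_pow]
  have hlt : ‖A‖ < ‖B‖ := by
    have hA0 : 0 < ‖A‖ := norm_pos_iff.2 hAne
    have : ‖A‖ ^ 2 < ‖A‖ * ‖B‖ := by
      rw [hABnorm]
      calc ‖A‖ ^ 2 ≤ ((n + 1) * (p : ℝ) ^ (-(T * j : ℕ) : ℤ)) ^ 2 := by gcongr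
        _ = ((n + 1) ^ 2 : ℕ) * (p : ℝ) ^ (-(T * j : ℕ) + -(T * j : ℕ) : ℤ) := by
          rw [zpow_add₀ hp0]; push_cast; ring
        _ < (p ^ T : ℕ) * (p : ℝ) ^ (-(T * j : ℕ) + -(T * j : ℕ) : ℤ) := by
          gcongr
        _ = (p : ℝ) ^ ((T : ℤ) + (-(T * j : ℕ) + -(T * j : ℕ)) : ℤ) := by
          rw [zpow_add₀ hp0 (T : ℤ)]; push_cast; rfl
        _ ≤ _ := by
          apply zpow_le_zpow_right₀ (by exact_mod_cast hp1.le)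
          have : T * (i + 1) ≤ T * j := Nat.mul_le_mul_left _ hij
          have h' : T * (i + 1) = T * i + T := by ring
          push_cast
          have : ((T * (i + 1) : ℕ) : ℤ) ≤ (T * j : ℕ) := by exact_mod_cast this
          push_cast at this
          linarith
    rw [sq] at this
    exact lt_of_mul_lt_mul_left this hA0.le
  have htr : ((2 * (U ^ 2 - n * V ^ 2) / p ^ (T * i + T * j) : ℚ) : ℚ_[p]) =
      (A ^ 2 + B ^ 2) / (A * B) := by
    rw [hAB]; push_cast
    congr 1
    rw [hA, hB]
    linear_combination (-2 * (V : ℚ_[p]) ^ 2) * hσ'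
  have hsum : ‖A ^ 2 + B ^ 2‖ = ‖B‖ ^ 2 := by
    rw [← norm_pow, Padic.add_eq_max_of_ne, norm_pow, norm_pow, max_eq_right]
    · gcongr
    · rw [norm_pow, norm_pow]
      exact (pow_lt_pow_left₀ hlt (norm_nonneg _) two_ne_zero).ne
  have hA0 : 0 < ‖A‖ := norm_pos_iff.2 hAne
  rw [htr, norm_div, hsum, norm_mul, one_lt_div (mul_pos hA0 (hA0.trans hlt)), sq]
  exact mul_lt_mul_of_pos_right hlt (hA0.trans hlt)

variable {α β : ℚ}

/-- At a prime `p` where the quaternion algebra splits, `O[1/p]` contains an element of norm one with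
eigenvalues of absolute value `≠ 1` at `p`; it can be chosen not to commute with a given
non-scalar element. -/
theorem exists_hyperbolic (hα : α < 0) (hβ : β < 0) {O : Subring ℍ[ℚ,α,β]} (hO : IsOrder O)
    (hs : IsSplitOver ℚ_[p] α β) {w : ℍ[ℚ,α,β]} (hw : ∀ r : ℚ, w ≠ r • 1) :
    ∃ g ∈ invertPrime p O, reducedNorm g = 1 ∧ 1 < ‖((2 * g.re : ℚ) : ℚ_[p])‖ ∧
      g * w ≠ w * g := by
  have hp0 : p ≠ 0 := (Fact.out : p.Prime).ne_zero
  have hpQ : (p : ℚ) ≠ 0 := by exact_mod_cast hp0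
  obtain ⟨y₀, hre₀, hyw₀, σ₀, hσ0, hσ₀⟩ := exists_pure_splitting hα.ne hβ.ne hs hw
  obtain ⟨c, hc, hy⟩ := hO.exists_smul_mem y₀
  have hcQ : (c : ℚ) ≠ 0 := by positivity
  set y : ℍ[ℚ,α,β] := (c : ℚ) • y₀ with hydef
  have hre : y.re = 0 := by simp [hydef, hre₀]
  have hyw : y * w ≠ w * y := by
    rw [hydef, smul_mul_assoc, mul_smul_comm]
    exact fun h => hyw₀ (smul_right_injective _ hcQ h)
  have hy0 : y ≠ 0 := by rintro h; rw [h] at hyw; simp at hyw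
  obtain ⟨z, hz⟩ := hO.exists_reducedNorm_eq hy
  have hzpos : 0 < z := by
    have := reducedNorm_pos hα hβ hy0
    rw [hz] at this; exact_mod_cast this
  obtain ⟨n, rfl⟩ := Int.eq_ofNat_of_zero_le hzpos.le
  have hn : 0 < n := by exact_mod_cast hzpos
  push_cast at hz
  have hσ1 : ((c : ℚ_[p]) * σ₀) ^ 2 = -n := by
    rw [mul_pow, hσ₀]
    have : -(n : ℚ) = c ^ 2 * -reducedNorm y₀ := by rw [← hz, hydef, reducedNorm_smul]; ring
    have := congrArg (fun q : ℚ => (q : ℚ_[p])) this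
    push_cast at this ⊢
    exact this.symm
  have hle : ‖(c : ℚ_[p]) * σ₀‖ ≤ 1 := by
    have : ‖(c : ℚ_[p]) * σ₀‖ ^ 2 ≤ 1 := by
      rw [← norm_pow, hσ1, norm_neg]
      exact_mod_cast Padic.norm_int_le_one (p := p) n
    exact (pow_le_one_iff_of_nonneg (norm_nonneg _) two_ne_zero).1 this
  obtain ⟨U, V, k, hUV, hgt⟩ := exists_pell (p := p) hn (σ := ⟨_, hle⟩) (by
    apply PadicInt.ext
    push_cast
    exact hσ1)
  have hpk : (p : ℚ) ^ k ≠ 0 := pow_ne_zero _ hpQ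
  have hUVQ : (U : ℚ) ^ 2 + n * V ^ 2 = p ^ k := by exact_mod_cast hUV
  set x : ℍ[ℚ,α,β] := (U : ℚ) • 1 + (V : ℚ) • y with hx
  have hxO : x ∈ O := by
    rw [hx, Int.cast_smul_eq_zsmul, Int.cast_smul_eq_zsmul]
    exact O.add_mem (O.zsmul_mem O.one_mem _) (O.zsmul_mem hy _)
  have hxre : x.re = U := by simp [hx, hre]
  have hxn : reducedNorm x = p ^ k := by
    rw [← hUVQ, ← hz]
    simp only [hx, reducedNorm]
    simp [hre]
    ring
  have hxx : x * x = (2 * (U : ℚ)) • x - (p ^ k : ℚ) • 1 := by rw [mul_self_eq, hxre, hxn]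
  have htr : 2 * (((p : ℚ) ^ (-k : ℤ)) • (x * x)).re = 2 * (U ^ 2 - n * V ^ 2) / p ^ k := by
    rw [hxx, zpow_neg, zpow_natCast]
    simp [hxre]
    field_simp
    linear_combination hUVQ
  refine ⟨((p : ℚ) ^ (-k : ℤ)) • (x * x),
    smul_mem_invertPrime hp0 (le_invertPrime p O (O.mul_mem hxO hxO)) _, ?_, ?_, ?_⟩
  · rw [reducedNorm_smul, reducedNorm_mul, hxn, zpow_neg, zpow_natCast]
    field_simp
  · rw [htr]; exact hgt
  · have hU0 : (2 * (U : ℚ)) * V ≠ 0 := by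
      intro h
      have hUV0 : U = 0 ∨ V = 0 := by
        rcases mul_eq_zero.1 h with h | h
        · left; have := (mul_eq_zero.1 h).resolve_left two_ne_zero; exact_mod_cast this
        · right; exact_mod_cast h
      have : ‖((2 * (U ^ 2 - n * V ^ 2) / p ^ k : ℚ) : ℚ_[p])‖ ≤ 1 := by
        have h2 : ∀ z : ℤ, ‖((z : ℚ) : ℚ_[p])‖ ≤ 1 := fun z => by
          rw [Rat.cast_intCast]; exact Padic.norm_int_le_one z
        rcases hUV0 with h | h
        · have : (2 * (U ^ 2 - n * V ^ 2) / p ^ k : ℚ) = ((-2 : ℤ) : ℚ) := by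
            rw [← hUVQ] at hpk ⊢
            rw [h] at hpk ⊢; field_simp; push_cast; ring_nf at hpk ⊢
          rw [this]; exact h2 _
        · have : (2 * (U ^ 2 - n * V ^ 2) / p ^ k : ℚ) = ((2 : ℤ) : ℚ) := by
            rw [← hUVQ] at hpk ⊢
            rw [h] at hpk ⊢; field_simp; push_cast; ring_nf at hpk ⊢
          rw [this]; exact h2 _
      linarith
    intro h
    rw [smul_mul_assoc, mul_smul_comm] at h
    replace h := smul_right_injective _ (zpow_ne_zero _ hpQ) h
    rw [hxx, sub_mul, mul_sub, smul_mul_assoc, mul_smul_comm, smul_mul_assoc, mul_smul_comm,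
      one_mul, mul_one, sub_left_inj, hx, add_mul, mul_add, smul_mul_assoc, smul_mul_assoc,
      mul_smul_comm, mul_smul_comm, one_mul, mul_one, smul_add, smul_add, add_right_inj,
      smul_smul, smul_smul] at h
    exact hyw (smul_right_injective _ hU0 h)

end Pell

/-! ### Density of the units of norm one in `SL₂` -/

section ClosedSubmonoids

variable {p : ℕ} [Fact p.Prime]

/-- Conjugation by powers of a hyperbolic diagonal element turns elements tending to `1` into
unipotent elements. -/
theorem lower_unipotent_mem {C : Submonoid (Matrix (Fin 2) (Fin 2) ℚ_[p])}
    (hC : IsClosed (C : Set (Matrix (Fin 2) (Fin 2) ℚ_[p]))) {μ : ℚ_[p]} (h0 : μ ≠ 0)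
    (h1 : ‖μ‖ < 1) (hD : !![μ, 0; 0, μ⁻¹] ∈ C) (hD' : !![μ⁻¹, 0; 0, μ] ∈ C)
    (hA : ∀ ε > 0, ∃ A ∈ C, (∀ i j, ‖A i j - (1 : Matrix (Fin 2) (Fin 2) ℚ_[p]) i j‖ < ε) ∧
      A 1 0 ≠ 0) (x : ℚ_[p]) : !![1, 0; x, 1] ∈ C := by
  have hpow : ∀ (a b : ℚ_[p]) (n : ℕ), !![a, 0; 0, b] ^ n = !![a ^ n, 0; 0, b ^ n] := by
    intro a b n
    induction n with
    | zero => simp [Matrix.one_fin_two]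
    | succ n ih => rw [pow_succ, ih]; simp [pow_succ]
  have hconj : ∀ A ∈ C, ∀ n : ℕ,
      !![A 0 0, μ ^ (2 * n) * A 0 1; (μ⁻¹) ^ (2 * n) * A 1 0, A 1 1] ∈ C := by
    intro A hAC n
    have := C.mul_mem (C.mul_mem (C.pow_mem hD n) hAC) (C.pow_mem hD' n)
    rw [hpow, hpow, Matrix.eta_fin_two A] at this
    convert this using 1
    have hn : μ ^ n * (μ⁻¹) ^ n = 1 := by rw [← mul_pow, mul_inv_cancel₀ h0, one_pow]
    ext i j
    fin_cases i <;> fin_cases j <;> simp <;> field_simp <;> ring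
  have hμ : 0 < ‖μ‖ := norm_pos_iff.2 h0
  have hΛ : ‖μ‖ ^ 2 < 1 := pow_lt_one₀ hμ.le h1 two_ne_zero
  have hcont : Continuous fun z : ℚ_[p] => !![1, 0; z, 1] := by
    refine continuous_matrix fun i j => ?_
    fin_cases i <;> fin_cases j <;> simp <;> fun_prop
  -- a non-trivial lower unipotent element in the closure
  obtain ⟨ζ, hζ0, hζ⟩ : ∃ ζ : ℚ_[p], ζ ≠ 0 ∧ !![1, 0; ζ, 1] ∈ C := by
    have hA' : ∀ k : ℕ, ∃ B ∈ C, (∀ i, ‖B i i - 1‖ < 1 / ((k : ℝ) + 1)) ∧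
        ‖B 0 1‖ < 1 / ((k : ℝ) + 1) ∧ ‖B 1 0‖ ≤ 1 ∧ ‖μ‖ ^ 2 ≤ ‖B 1 0‖ := by
      intro k
      have hk : (0 : ℝ) < 1 / ((k : ℝ) + 1) := by positivity
      obtain ⟨A, hAC, hAε, hA0⟩ := hA _ hk
      have hz0 : 0 < ‖A 1 0‖ := norm_pos_iff.2 hA0
      have hz1 : ‖A 1 0‖ < 1 := by
        have := hAε 1 0
        simp only [Matrix.one_apply_ne (by decide : (1 : Fin 2) ≠ 0), sub_zero] at this
        refine this.trans_le ?_
        rw [div_le_one (by positivity)]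
        have : (0 : ℝ) ≤ k := k.cast_nonneg
        linarith
      obtain ⟨n, hn1, hn2⟩ := exists_nat_pow_near (one_le_inv₀ hz0 |>.2 hz1.le)
        ((one_lt_inv₀ (by positivity)).2 hΛ)
      refine ⟨_, hconj A hAC n, ?_, ?_, ?_, ?_⟩
      · intro i
        have := hAε i i
        rw [Matrix.one_apply_eq] at this
        fin_cases i <;> simpa using this
      · have := hAε 0 1
        simp only [Matrix.one_apply_ne (by decide : (0 : Fin 2) ≠ 1), sub_zero] at this
        refine lt_of_le_of_lt ?_ this
        simp only [Matrix.of_apply, Matrix.cons_val', Matrix.cons_val_zero, Matrix.cons_val_one,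
          Matrix.cons_val_fin_one, norm_mul, norm_pow]
        exact mul_le_of_le_one_left (norm_nonneg _) (pow_le_one₀ hμ.le h1.le)
      · simp only [Matrix.of_apply, Matrix.cons_val', Matrix.cons_val_zero, Matrix.cons_val_one,
          Matrix.cons_val_fin_one, norm_mul, norm_pow, norm_inv]
        rw [pow_mul, inv_pow]
        rwa [le_inv_comm₀ (by positivity) hz0, ← one_div, le_div_iff₀ (by positivity),
          mul_comm] at hn1
      · simp only [Matrix.of_apply, Matrix.cons_val', Matrix.cons_val_zero, Matrix.cons_val_one,
          Matrix.cons_val_fin_one, norm_mul, norm_pow, norm_inv]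
        rw [pow_mul, inv_pow]
        rw [inv_lt_iff_one_lt_mul₀ hz0, pow_succ] at hn2
        have hpos : 0 < ‖μ‖ ^ 2 := by positivity
        rw [← div_eq_mul_inv, div_mul_eq_mul_div, one_lt_div hpos] at hn2
        exact hn2.le
    choose B hBC hBd hBu hBl hBL using hA'
    obtain ⟨ζ, -, φ, hφ, hlim⟩ := (isCompact_closedBall (0 : ℚ_[p]) 1).tendsto_subseq
      (x := fun k => B k 1 0) (fun k => by simpa using hBl k)
    have hεlim : Filter.Tendsto (fun k : ℕ => 1 / ((φ k : ℝ) + 1)) Filter.atTop (nhds 0) :=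
      tendsto_one_div_add_atTop_nhds_zero_nat.comp hφ.tendsto_atTop
    refine ⟨ζ, ?_, ?_⟩
    · have : ‖μ‖ ^ 2 ≤ ‖ζ‖ := ge_of_tendsto' hlim.norm fun k => hBL (φ k)
      rw [← norm_pos_iff]
      exact lt_of_lt_of_le (by positivity) this
    · refine hC.mem_of_tendsto (f := fun k => B (φ k)) (b := Filter.atTop) ?_
        (Filter.Eventually.of_forall fun k => hBC _)
      have hd : ∀ i, Filter.Tendsto (fun k => B (φ k) i i) Filter.atTop (nhds 1) := fun i => by
        rw [tendsto_iff_norm_sub_tendsto_zero]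
        exact squeeze_zero (fun _ => norm_nonneg _) (fun k => (hBd (φ k) i).le) hεlim
      have hu : Filter.Tendsto (fun k => B (φ k) 0 1) Filter.atTop (nhds 0) :=
        squeeze_zero_norm (fun k => (hBu (φ k)).le) hεlim
      refine tendsto_pi_nhds.2 fun i => tendsto_pi_nhds.2 fun j => ?_
      fin_cases i <;> fin_cases j
      · simpa using hd 0
      · simpa using hu
      · simpa [Function.comp_def] using hlim
      · simpa using hd 1
  have hnat : ∀ n : ℕ, !![1, 0; (n : ℚ_[p]) * ζ, 1] ∈ C := by
    intro n
    induction n with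
    | zero => simp [← Matrix.one_fin_two, C.one_mem]
    | succ n ih =>
      have := C.mul_mem ih hζ
      convert this using 1
      ext i j; fin_cases i <;> fin_cases j <;> simp; ring
  have hint : ∀ a : ℤ_[p], !![1, 0; (a : ℚ_[p]) * ζ, 1] ∈ C := by
    intro a
    have hcl : IsClosed {a : ℤ_[p] | !![1, 0; (a : ℚ_[p]) * ζ, 1] ∈ C} := by
      refine hC.preimage (hcont.comp ?_)
      exact continuous_subtype_val.mul continuous_const
    have : (Set.univ : Set ℤ_[p]) ⊆ {a : ℤ_[p] | !![1, 0; (a : ℚ_[p]) * ζ, 1] ∈ C} := by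
      rw [← (PadicInt.denseRange_natCast (p := p)).closure_range]
      refine closure_minimal ?_ hcl
      rintro _ ⟨n, rfl⟩
      simpa using hnat n
    exact this (Set.mem_univ a)
  -- conjugation by the diagonal element rescales the integral multiples of `ζ` to everything
  have hlim : Filter.Tendsto (fun n : ℕ => ‖μ‖ ^ (2 * n) * ‖x / ζ‖) Filter.atTop
      (nhds (0 * ‖x / ζ‖)) := by
    refine Filter.Tendsto.mul_const _ ?_
    simp only [pow_mul]
    exact tendsto_pow_atTop_nhds_zero_of_lt_one (by positivity) hΛ
  rw [zero_mul] at hlim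
  obtain ⟨n, hn⟩ := (hlim.eventually_lt_const one_pos).exists
  have hle : ‖μ ^ (2 * n) * (x / ζ)‖ ≤ 1 := by rw [norm_mul, norm_pow]; exact hn.le
  have := hconj _ (hint ⟨_, hle⟩) n
  convert this using 1
  have hμn : μ ^ (2 * n) ≠ 0 := pow_ne_zero _ h0
  ext i j; fin_cases i <;> fin_cases j <;> simp; field_simp

/-- `SL₂` of a field is generated by the unipotent matrices. -/
theorem mem_of_unipotent_mem {F : Type*} [Field F] {C : Submonoid (Matrix (Fin 2) (Fin 2) F)}
    (hl : ∀ x, !![1, 0; x, 1] ∈ C) (hu : ∀ x, !![1, x; 0, 1] ∈ C)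
    {t : Matrix (Fin 2) (Fin 2) F} (ht : t.det = 1) : t ∈ C := by
  have key : ∀ t : Matrix (Fin 2) (Fin 2) F, t.det = 1 → t 1 0 ≠ 0 → t ∈ C := by
    intro t ht hc
    have := C.mul_mem (C.mul_mem (hu ((t 0 0 - 1) / t 1 0)) (hl (t 1 0))) (hu ((t 1 1 - 1) / t 1 0))
    convert this using 1
    rw [Matrix.det_fin_two] at ht
    ext i j
    fin_cases i <;> fin_cases j <;> simp <;> field_simp <;>
      first | linear_combination -ht | linear_combination ht | ring
  by_cases hc : t 1 0 = 0
  · have ha : t 0 0 ≠ 0 := by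
      intro h; rw [Matrix.det_fin_two, h, hc] at ht; simp at ht
    have h1 : !![1, 0; 1, 1] * t ∈ C := by
      apply key
      · rw [Matrix.det_mul, ht]; simp
      · rw [Matrix.eta_fin_two t]; simpa [hc] using ha
    have := C.mul_mem (hl (-1)) h1
    rw [← mul_assoc] at this
    convert this
    have : (!![1, 0; -1, 1] : Matrix (Fin 2) (Fin 2) F) * !![1, 0; 1, 1] = 1 := by
      simp [Matrix.one_fin_two]
    rw [this, one_mul]
  · exact key t ht hc

/-- A closed submonoid of `M₂(ℚ_p)` containing a hyperbolic diagonal element with its inverse, and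
elements arbitrarily close to `1` with non-zero off-diagonal entries, contains `SL₂(ℚ_p)`. -/
theorem specialLinear_le_of_hyperbolic {C : Submonoid (Matrix (Fin 2) (Fin 2) ℚ_[p])}
    (hC : IsClosed (C : Set (Matrix (Fin 2) (Fin 2) ℚ_[p]))) {μ : ℚ_[p]} (h0 : μ ≠ 0)
    (h1 : ‖μ‖ < 1) (hD : !![μ, 0; 0, μ⁻¹] ∈ C) (hD' : !![μ⁻¹, 0; 0, μ] ∈ C)
    (hA : ∀ ε > 0, ∃ A ∈ C, (∀ i j, ‖A i j - (1 : Matrix (Fin 2) (Fin 2) ℚ_[p]) i j‖ < ε) ∧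
      A 1 0 ≠ 0 ∧ A 0 1 ≠ 0)
    {t : Matrix (Fin 2) (Fin 2) ℚ_[p]} (ht : t.det = 1) : t ∈ C := by
  refine mem_of_unipotent_mem (lower_unipotent_mem hC h0 h1 hD hD' fun ε hε => ?_) ?_ ht
  · obtain ⟨A, h, h', h'', -⟩ := hA ε hε
    exact ⟨A, h, h', h''⟩
  -- the upper triangular case follows by exchanging the two basis vectors
  let W : Matrix (Fin 2) (Fin 2) ℚ_[p] := !![0, 1; 1, 0]
  have hW : W * W = 1 := by simp [W, Matrix.one_fin_two]
  have hconj : ∀ A, W * A * W = !![A 1 1, A 1 0; A 0 1, A 0 0] := by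
    intro A
    conv_lhs => rw [Matrix.eta_fin_two A]
    simp [W]
  let C' : Submonoid (Matrix (Fin 2) (Fin 2) ℚ_[p]) :=
    { carrier := {A | W * A * W ∈ C}
      one_mem' := by simp [hW, C.one_mem]
      mul_mem' := fun {A B} ha hb => by
        have := C.mul_mem ha hb
        rwa [show W * A * W * (W * B * W) = W * A * (W * W) * B * W by simp only [mul_assoc],
          hW, mul_one, mul_assoc W] at this }
  have hmem : ∀ A, A ∈ C' ↔ W * A * W ∈ C := fun A => Iff.rfl
  intro x
  have := lower_unipotent_mem (C := C') (hC.preimage (by fun_prop)) h0 h1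
    (by rw [hmem, hconj]; simpa using hD') (by rw [hmem, hconj]; simpa using hD) ?_ x
  · rw [hmem, hconj] at this; simpa using this
  · intro ε hε
    obtain ⟨A, h, h', -, h''⟩ := hA ε hε
    refine ⟨W * A * W, ?_, ?_, ?_⟩
    · rw [hmem]
      rwa [show W * (W * A * W) * W = (W * W) * A * (W * W) by simp only [mul_assoc], hW, one_mul,
        mul_one]
    · rw [hconj]
      intro i j
      fin_cases i <;> fin_cases j
      · simpa using h' 1 1
      · simpa using h' 1 0
      · simpa using h' 0 1
      · simpa using h' 0 0
    · rw [hconj]; simpa using h''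

theorem exists_diagonalization {M : Matrix (Fin 2) (Fin 2) ℚ_[p]} (hdet : M.det = 1)
    (htr : 1 < ‖M.trace‖) : ∃ (μ : ℚ_[p]) (P Q : Matrix (Fin 2) (Fin 2) ℚ_[p]),
      μ ≠ 0 ∧ ‖μ‖ < 1 ∧ P * Q = 1 ∧ Q * P = 1 ∧ M = P * !![μ, 0; 0, μ⁻¹] * Q := by
  obtain ⟨μ, h0, h1, hμ⟩ : ∃ μ : ℚ_[p], μ ≠ 0 ∧ ‖μ‖ < 1 ∧ μ + μ⁻¹ = M.trace := by
    obtain ⟨r, hr⟩ := exists_quadratic_root (t := M.trace) (n := 1) (by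
      rw [norm_one]; exact one_lt_pow₀ htr two_ne_zero)
    have hr0 : r ≠ 0 := by rintro rfl; simp at hr
    have hsum : r + r⁻¹ = M.trace := by field_simp; linear_combination hr
    rcases lt_or_ge ‖r‖ 1 with h | h
    · exact ⟨r, hr0, h, hsum⟩
    · refine ⟨r⁻¹, inv_ne_zero hr0, ?_, by rw [inv_inv, add_comm]; exact hsum⟩
      rcases h.lt_or_eq with h | h
      · rw [norm_inv]; exact inv_lt_one_of_one_lt₀ h
      · exfalso
        have := Padic.nonarchimedean r r⁻¹
        rw [hsum, norm_inv, ← h, inv_one, max_self] at this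
        linarith
  have hne : μ⁻¹ - μ ≠ 0 := by
    intro h
    have := congrArg norm (sub_eq_zero.1 h)
    rw [norm_inv] at this
    have h2 : 1 < ‖μ‖⁻¹ := (one_lt_inv₀ (norm_pos_iff.2 h0)).2 h1
    linarith
  have hinv : μ * μ⁻¹ = 1 := mul_inv_cancel₀ h0
  suffices h : ∃ P : Matrix (Fin 2) (Fin 2) ℚ_[p], P.det ≠ 0 ∧ M * P = P * !![μ, 0; 0, μ⁻¹] by
    obtain ⟨P, hP, h⟩ := h
    have hu : IsUnit P.det := isUnit_iff_ne_zero.2 hP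
    refine ⟨μ, P, P⁻¹, h0, h1, Matrix.mul_nonsing_inv P hu, Matrix.nonsing_inv_mul P hu, ?_⟩
    rw [← h, Matrix.mul_nonsing_inv_cancel_right _ _ hu]
  obtain ⟨a, b, c, d, rfl⟩ : ∃ a b c d, M = !![a, b; c, d] := ⟨_, _, _, _, Matrix.eta_fin_two M⟩
  rw [Matrix.det_fin_two_of] at hdet
  rw [Matrix.trace_fin_two_of] at hμ
  by_cases hc : c = 0
  · subst hc
    have had : a = μ ∨ a = μ⁻¹ := by
      have : (a - μ) * (a - μ⁻¹) = 0 := by linear_combination -a * hμ - hdet + hinv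
      rcases mul_eq_zero.1 this with h | h
      · exact Or.inl (sub_eq_zero.1 h)
      · exact Or.inr (sub_eq_zero.1 h)
    rcases had with rfl | rfl
    · have hd : d = a⁻¹ := by linear_combination -hμ
      subst hd
      refine ⟨!![1, b; 0, a⁻¹ - a], by simpa using hne, ?_⟩
      ext i j; fin_cases i <;> fin_cases j <;> simp <;> ring
    · have hd : d = μ := by linear_combination -hμ
      subst hd
      refine ⟨!![b, 1; d - d⁻¹, 0], ?_, ?_⟩
      · rw [Matrix.det_fin_two_of]; intro h; apply hne; linear_combination h
      · ext i j; fin_cases i <;> fin_cases j <;> simp <;> ring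
  · refine ⟨!![μ - d, μ⁻¹ - d; c, c], ?_, ?_⟩
    · rw [Matrix.det_fin_two_of]
      have : (μ - d) * c - (μ⁻¹ - d) * c = -(c * (μ⁻¹ - μ)) := by ring
      rw [this]
      exact neg_ne_zero.2 (mul_ne_zero hc hne)
    · ext i j; fin_cases i <;> fin_cases j <;> simp
      · linear_combination -hdet + hinv - μ * hμ
      · linear_combination -hdet + hinv - μ⁻¹ * hμ
      · ring
      · ring

end ClosedSubmonoids

section Density

variable {α β : ℚ} {p l : ℕ} [Fact p.Prime] [Fact l.Prime]

/-- A trace of absolute value greater than `1` persists under powers: the eigenvalues are then of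
different absolute values. In particular no positive power of `u` is central. -/
theorem trace_pow_succ_norm {u : ℍ[ℚ,α,β]} (hu : reducedNorm u = 1)
    (htr : 1 < ‖((2 * u.re : ℚ) : ℚ_[p])‖) (m : ℕ) :
    1 < ‖((2 * (u ^ (m + 1)).re : ℚ) : ℚ_[p])‖ := by
  set T : ℚ_[p] := ((2 * u.re : ℚ) : ℚ_[p]) with hT
  have hrec : ∀ m : ℕ, ((2 * (u ^ (m + 2)).re : ℚ) : ℚ_[p]) =
      T * ((2 * (u ^ (m + 1)).re : ℚ) : ℚ_[p]) - ((2 * (u ^ m).re : ℚ) : ℚ_[p]) := by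
    intro m
    have : u ^ (m + 2) = (2 * u.re) • u ^ (m + 1) - u ^ m := by
      rw [pow_add, sq, mul_self_eq, hu, one_smul, mul_sub, mul_one, mul_smul_comm, ← pow_succ]
    rw [this, hT]
    push_cast
    simp
    ring
  have key : ∀ m : ℕ, ‖((2 * (u ^ m).re : ℚ) : ℚ_[p])‖ < ‖((2 * (u ^ (m + 1)).re : ℚ) : ℚ_[p])‖ ∧
      1 < ‖((2 * (u ^ (m + 1)).re : ℚ) : ℚ_[p])‖ := by
    intro m
    induction m with
    | zero =>
      rw [zero_add, pow_one]
      refine ⟨lt_of_le_of_lt ?_ htr, htr⟩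
      have := Padic.norm_int_le_one (p := p) 2
      simpa using this
    | succ m ih =>
      have h1 : ‖((2 * (u ^ (m + 1)).re : ℚ) : ℚ_[p])‖ <
          ‖T * ((2 * (u ^ (m + 1)).re : ℚ) : ℚ_[p])‖ := by
        rw [norm_mul]
        exact lt_mul_of_one_lt_left (by linarith [ih.2]) htr
      have h2 : ‖((2 * (u ^ (m + 2)).re : ℚ) : ℚ_[p])‖ =
          ‖T * ((2 * (u ^ (m + 1)).re : ℚ) : ℚ_[p])‖ := by
        rw [hrec, sub_eq_add_neg, Padic.add_eq_max_of_ne, norm_neg, max_eq_left]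
        · exact (ih.1.trans h1).le
        · rw [norm_neg]; exact (ih.1.trans h1).ne'
      rw [h2]
      exact ⟨h1, ih.2.trans h1⟩
  exact (key m).2

theorem ne_smul_one_of_trace {u : ℍ[ℚ,α,β]} (hu : reducedNorm u = 1)
    (htr : 1 < ‖((2 * u.re : ℚ) : ℚ_[p])‖) (r : ℚ) : u ≠ r • 1 := by
  rintro rfl
  rw [reducedNorm_smul_one] at hu
  have h2 := Padic.norm_int_le_one (p := p) 2
  rcases mul_self_eq_one_iff.1 ((sq r).symm.trans hu) with rfl | rfl
  · simp at htr
    push_cast at h2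
    linarith
  · simp at htr
    push_cast at h2
    linarith

/-- The image of `O[1/p]` in `M₂(ℚ_l)` is bounded for `l ≠ p`, since `p` is a unit at `l`. -/
theorem IsOrder.exists_splitRep_bound {O : Subring ℍ[ℚ,α,β]} (hO : IsOrder O) (hpl : p ≠ l)
    {r s : ℚ_[l]} (h : (β : ℚ_[l]) = r ^ 2 - α * s ^ 2) :
    ∃ B : ℝ, ∀ x ∈ invertPrime p O, ∀ i j, ‖splitRep h x i j‖ ≤ B := by
  obtain ⟨n, hn, hint⟩ := hO.exists_intCoord
  have hn0 : (n : ℚ_[l]) ≠ 0 := by exact_mod_cast hn.ne'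
  set B₀ : ℝ := 1 + ‖r‖ + ‖s‖ + ‖(α : ℚ_[l])‖ * (1 + ‖r‖ + ‖s‖) with hB
  have hZ : ∀ z : ℤ, ‖(z : ℚ_[l])‖ ≤ 1 := fun z => Padic.norm_int_le_one z
  have hmul : ∀ (a : ℚ_[l]) (z : ℤ), ‖a * z‖ ≤ ‖a‖ := fun a z => by
    rw [norm_mul]; exact mul_le_of_le_one_right (norm_nonneg _) (hZ z)
  have hcoord : ∀ x : ℍ[ℚ,α,β], IntCoord x → ∀ i j, ‖splitRep h x i j‖ ≤ B₀ := by
    rintro _ ⟨a, b, e, f, rfl⟩ i j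
    have h0 := norm_nonneg r
    have h1 := norm_nonneg s
    have h2 := norm_nonneg (α : ℚ_[l])
    have h3 := mul_nonneg h2 h0
    have h4 := mul_nonneg h2 h1
    have hα1 := hmul α b
    have hr := hmul r
    have hs := hmul s
    have hαr := hmul (α * r)
    have hαs := hmul (α * s)
    simp only [norm_mul (α : ℚ_[l])] at hαr hαs
    have ha := hZ a
    have hb := hZ b
    rw [splitRep_apply]
    fin_cases i <;> fin_cases j <;> simp
    · refine (norm_add₃_le).trans ?_
      have := hr e; have := hαs f; linarith
    · rw [mul_comm s]
      refine (norm_sub_le _ _).trans ((add_le_add_left (norm_sub_le _ _) _).trans ?_)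
      have := hαs e; have := hαr f; linarith
    · refine (norm_add₃_le).trans ?_
      have := hs e; have := hr f; linarith
    · rw [mul_comm s]
      refine (norm_sub_le _ _).trans ((add_le_add_left (norm_sub_le _ _) _).trans ?_)
      have := hr e; have := hαs f; linarith
  refine ⟨B₀ / ‖(n : ℚ_[l])‖, fun x hx i j => ?_⟩
  rw [mem_invertPrime] at hx
  obtain ⟨k, hk⟩ := hx
  have := hcoord _ (hint _ hk) i j
  rw [smul_smul, splitRep_smul, Matrix.smul_apply, smul_eq_mul, norm_mul] at this
  have hpn : ‖(p : ℚ_[l])‖ = 1 := by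
    rw [← Int.cast_natCast, Padic.norm_intCast_eq_one_iff, Int.isCoprime_iff_gcd_eq_one]
    have := (Nat.coprime_primes (Fact.out : p.Prime) (Fact.out : l.Prime)).2 hpl
    simpa using this
  push_cast at this
  rw [norm_mul, norm_pow, hpn, one_pow, mul_one] at this
  rw [le_div_iff₀ (norm_pos_iff.2 hn0), mul_comm]
  exact this

/-- The powers of an element of norm one of `O[1/p]` accumulate at `1` in the `l`-adic topology. -/
theorem IsOrder.exists_pow_near_one {O : Subring ℍ[ℚ,α,β]} (hO : IsOrder O) (hpl : p ≠ l)
    {r s : ℚ_[l]} (h : (β : ℚ_[l]) = r ^ 2 - α * s ^ 2) {u : ℍ[ℚ,α,β]}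
    (hu : u ∈ invertPrime p O) (hnu : reducedNorm u = 1)
    {V : Set (Matrix (Fin 2) (Fin 2) ℚ_[l])} (hV : V ∈ nhds 1) :
    ∃ m : ℕ, splitRep h (u ^ (m + 1)) ∈ V := by
  obtain ⟨B, hB⟩ := hO.exists_splitRep_bound hpl h
  have hK : IsCompact (Set.univ.pi fun _ : Fin 2 => Set.univ.pi fun _ : Fin 2 =>
      Metric.closedBall (0 : ℚ_[l]) B) :=
    isCompact_univ_pi fun _ => isCompact_univ_pi fun _ => isCompact_closedBall _ _
  obtain ⟨A, φ, hφ, hlim⟩ : ∃ (A : Matrix (Fin 2) (Fin 2) ℚ_[l]) (φ : ℕ → ℕ), StrictMono φ ∧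
      Filter.Tendsto (fun n => splitRep h (u ^ φ n)) Filter.atTop (nhds A) := by
    obtain ⟨A, -, φ, hφ, hlim⟩ := hK.tendsto_subseq (X := Fin 2 → Fin 2 → ℚ_[l])
      (x := fun n i j => splitRep h (u ^ n) i j) (fun n i _ j _ => by
        simpa using hB _ (Subring.pow_mem _ hu n) i j)
    exact ⟨A, φ, hφ, hlim⟩
  have hdet : ∀ n, (splitRep h (u ^ n)).det = 1 := fun n => by
    rw [det_splitRep, reducedNorm_pow, hnu, one_pow, Rat.cast_one]
  have hA : A.det = 1 := by
    have h1 : Filter.Tendsto (fun n => (splitRep h (u ^ φ n)).det) Filter.atTop (nhds A.det) :=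
      ((continuous_id.matrix_det).tendsto A).comp hlim
    simp only [hdet] at h1
    exact tendsto_nhds_unique h1 tendsto_const_nhds
  have hlim2 : Filter.Tendsto (fun n => (splitRep h (u ^ φ n)).adjugate *
      splitRep h (u ^ φ (n + 1))) Filter.atTop (nhds (A.adjugate * A)) := by
    refine Filter.Tendsto.mul ?_ ?_
    · exact ((continuous_id.matrix_adjugate).tendsto A).comp hlim
    · exact hlim.comp (Filter.tendsto_add_atTop_nat 1)
  rw [Matrix.adjugate_mul, hA, one_smul] at hlim2
  obtain ⟨n, hn⟩ := (hlim2.eventually hV).exists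
  refine ⟨φ (n + 1) - φ n - 1, ?_⟩
  have hlt : φ n < φ (n + 1) := hφ (Nat.lt_succ_self n)
  have e : u ^ φ (n + 1) = u ^ φ n * u ^ (φ (n + 1) - φ n - 1 + 1) := by
    rw [← pow_add]; congr 1; omega
  rw [e, map_mul, ← mul_assoc, Matrix.adjugate_mul, hdet, one_smul, one_mul] at hn
  exact hn

/-- Strong approximation at one prime `l`: if the quaternion algebra splits at `p` and at `l`, the
elements of norm one of `O[1/p][1/l]` are dense in `SL₂(ℚ_l)`. -/
theorem IsOrder.exists_approximation (hα : α < 0) (hβ : β < 0) {O : Subring ℍ[ℚ,α,β]}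
    (hO : IsOrder O) (hpl : p ≠ l) (hs : IsSplitOver ℚ_[p] α β)
    {r s : ℚ_[l]} (h : (β : ℚ_[l]) = r ^ 2 - α * s ^ 2)
    {t : Matrix (Fin 2) (Fin 2) ℚ_[l]} (ht : t.det = 1)
    {V : Set (Matrix (Fin 2) (Fin 2) ℚ_[l])} (hV : V ∈ nhds t) :
    ∃ x ∈ invertPrime l (invertPrime p O), reducedNorm x = 1 ∧ splitRep h x ∈ V := by
  obtain ⟨u, huO, hnu, htru, -⟩ := exists_hyperbolic (p := p) hα hβ hO hs (w := ⟨0, 1, 0, 0⟩)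
    (fun r hr => by simpa using congrArg QuaternionAlgebra.imI hr)
  obtain ⟨g, hgO, hng, htrg, hgu⟩ := exists_hyperbolic (p := l) hα hβ hO ⟨r, s, h⟩
    (ne_smul_one_of_trace hnu htru)
  have hnc : ∀ m : ℕ, u ^ (m + 1) * g ≠ g * u ^ (m + 1) := by
    intro m hm
    refine hgu (commute_of_commute hα.ne hβ.ne (w := u ^ (m + 1)) ?_ hm.symm ?_)
    · exact ne_smul_one_of_trace (by rw [reducedNorm_pow, hnu, one_pow])
        (trace_pow_succ_norm hnu htru m)
    · rw [← pow_succ, ← pow_succ']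
  let R : Subring ℍ[ℚ,α,β] := invertPrime l (invertPrime p O)
  have huR : u ∈ R := le_invertPrime l _ huO
  have hmono : invertPrime l O ≤ R := fun x ⟨k, hk⟩ => ⟨k, le_invertPrime p O hk⟩
  let G : Submonoid ℍ[ℚ,α,β] :=
    { carrier := {x | x ∈ R ∧ reducedNorm x = 1}
      one_mem' := ⟨R.one_mem, reducedNorm_one⟩
      mul_mem' := fun {x y} hx hy => ⟨R.mul_mem hx.1 hy.1, by
        rw [reducedNorm_mul, hx.2, hy.2, one_mul]⟩ }
  let C : Submonoid (Matrix (Fin 2) (Fin 2) ℚ_[l]) :=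
    (G.map (splitRep h : ℍ[ℚ,α,β] →* _)).topologicalClosure
  have hGC : ∀ x ∈ G, splitRep h x ∈ C := fun x hx =>
    Submonoid.le_topologicalClosure _ ⟨x, hx, rfl⟩
  suffices hmem : t ∈ C by
    have hcl : t ∈ closure (G.map (splitRep h : ℍ[ℚ,α,β] →* Matrix (Fin 2) (Fin 2) ℚ_[l]) :
        Set (Matrix (Fin 2) (Fin 2) ℚ_[l])) := hmem
    obtain ⟨_, hy, ⟨x, hx, rfl⟩⟩ := mem_closure_iff_nhds.1 hcl V hV
    exact ⟨x, hx.1, hx.2, hy⟩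
  have hC : IsClosed (C : Set (Matrix (Fin 2) (Fin 2) ℚ_[l])) :=
    Submonoid.isClosed_topologicalClosure _
  obtain ⟨μ, P, Q, h0, h1, hPQ, hQP, hM⟩ := exists_diagonalization (M := splitRep h g)
    (by rw [det_splitRep, hng, Rat.cast_one]) (by rw [trace_splitRep]; exact htrg)
  let C' : Submonoid (Matrix (Fin 2) (Fin 2) ℚ_[l]) :=
    { carrier := {A | P * A * Q ∈ C}
      one_mem' := by simp [hPQ, C.one_mem]
      mul_mem' := fun {A B} ha hb => by
        have := C.mul_mem ha hb
        rwa [show P * A * Q * (P * B * Q) = P * A * (Q * P) * B * Q by simp only [mul_assoc],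
          hQP, mul_one, mul_assoc P] at this }
  have hmem : ∀ A, A ∈ C' ↔ P * A * Q ∈ C := fun A => Iff.rfl
  have hC' : IsClosed (C' : Set (Matrix (Fin 2) (Fin 2) ℚ_[l])) := hC.preimage (by fun_prop)
  have hback : ∀ A, P * (Q * A * P) * Q = A := fun A => by
    rw [show P * (Q * A * P) * Q = (P * Q) * A * (P * Q) by simp only [mul_assoc], hPQ, one_mul,
      mul_one]
  have hQMP : Q * splitRep h g * P = !![μ, 0; 0, μ⁻¹] := by
    rw [hM, show Q * (P * !![μ, 0; 0, μ⁻¹] * Q) * P = (Q * P) * !![μ, 0; 0, μ⁻¹] * (Q * P) by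
      simp only [mul_assoc], hQP, one_mul, mul_one]
  have hstar : star g ∈ G := ⟨hmono (hO.star_mem_invertPrime l hgO), by
    rw [reducedNorm_star, hng]⟩
  have key := specialLinear_le_of_hyperbolic hC' h0 h1 (t := Q * t * P) ?_ ?_ ?_ ?_
  · rwa [hmem, hback] at key
  · rw [hmem, ← hM]; exact hGC _ ⟨hmono hgO, hng⟩
  · rw [hmem]
    convert hGC _ hstar using 1
    have e1 : splitRep h (star g) * splitRep h g = 1 := by
      rw [← map_mul, star_mul_eq_smul, hng, one_smul, map_one]
    have e2 : splitRep h g * (P * !![μ⁻¹, 0; 0, μ] * Q) = 1 := by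
      rw [hM, show P * !![μ, 0; 0, μ⁻¹] * Q * (P * !![μ⁻¹, 0; 0, μ] * Q) =
        P * (!![μ, 0; 0, μ⁻¹] * (Q * P) * !![μ⁻¹, 0; 0, μ]) * Q by simp only [mul_assoc], hQP]
      have : !![μ, 0; 0, μ⁻¹] * 1 * !![μ⁻¹, 0; 0, μ] = 1 := by
        rw [mul_one]; simp [h0, Matrix.one_fin_two]
      rw [this, mul_one, hPQ]
    calc _ = (splitRep h (star g) * splitRep h g) * (P * !![μ⁻¹, 0; 0, μ] * Q) := by
          rw [e1, one_mul]
      _ = _ := by rw [mul_assoc, e2, mul_one]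
  · intro ε hε
    have hVε : {A : Matrix (Fin 2) (Fin 2) ℚ_[l] | ∀ i j, ‖(Q * A * P) i j -
        (1 : Matrix (Fin 2) (Fin 2) ℚ_[l]) i j‖ < ε} ∈ nhds 1 := by
      have hcont : ∀ i j, Continuous fun A : Matrix (Fin 2) (Fin 2) ℚ_[l] => ‖(Q * A * P) i j -
        (1 : Matrix (Fin 2) (Fin 2) ℚ_[l]) i j‖ := fun i j =>
          (((by fun_prop : Continuous fun A : Matrix (Fin 2) (Fin 2) ℚ_[l] =>
            Q * A * P).matrix_elem i j).sub continuous_const).norm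
      refine Filter.eventually_all.2 fun i => Filter.eventually_all.2 fun j => ?_
      refine (hcont i j).continuousAt.eventually_lt continuousAt_const ?_
      rw [mul_one, hQP, sub_self, norm_zero]
      exact hε
    obtain ⟨m, hm⟩ := hO.exists_pow_near_one hpl h huO hnu hVε
    have hcomm : ∀ A : Matrix (Fin 2) (Fin 2) ℚ_[l],
        A = Q * splitRep h (u ^ (m + 1)) * P →
        (A * !![μ, 0; 0, μ⁻¹] - !![μ, 0; 0, μ⁻¹] * A).det ≠ 0 := by
      rintro A rfl h0
      rw [← hQMP] at h0
      have e : Q * splitRep h (u ^ (m + 1)) * P * (Q * splitRep h g * P) -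
          Q * splitRep h g * P * (Q * splitRep h (u ^ (m + 1)) * P) =
          Q * splitRep h (u ^ (m + 1) * g - g * u ^ (m + 1)) * P := by
        rw [show Q * splitRep h (u ^ (m + 1)) * P * (Q * splitRep h g * P) =
          Q * splitRep h (u ^ (m + 1)) * (P * Q) * splitRep h g * P by simp only [mul_assoc],
          show Q * splitRep h g * P * (Q * splitRep h (u ^ (m + 1)) * P) =
          Q * splitRep h g * (P * Q) * splitRep h (u ^ (m + 1)) * P by simp only [mul_assoc],
          hPQ, mul_one, mul_one, map_sub, map_mul, map_mul, mul_sub, sub_mul]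
        simp only [mul_assoc]
      rw [e, Matrix.det_mul, Matrix.det_mul, mul_comm, ← mul_assoc, ← Matrix.det_mul, hPQ,
        Matrix.det_one, one_mul, det_splitRep, Rat.cast_eq_zero] at h0
      exact hnc m (sub_eq_zero.1 (reducedNorm_eq_zero hα hβ h0))
    refine ⟨Q * splitRep h (u ^ (m + 1)) * P, ?_, hm, ?_, ?_⟩
    · rw [hmem, hback]
      exact hGC _ (G.pow_mem ⟨huR, hnu⟩ _)
    · intro hz
      refine hcomm _ rfl ?_
      generalize Q * splitRep h (u ^ (m + 1)) * P = A at hz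
      rw [Matrix.eta_fin_two A, hz, Matrix.det_fin_two]
      simp only [Matrix.mul_fin_two, Matrix.sub_apply, Matrix.of_apply, Matrix.cons_val',
        Matrix.cons_val_zero, Matrix.cons_val_one, Matrix.cons_val_fin_one]
      ring
    · intro hz
      refine hcomm _ rfl ?_
      generalize Q * splitRep h (u ^ (m + 1)) * P = A at hz
      rw [Matrix.eta_fin_two A, hz, Matrix.det_fin_two]
      simp only [Matrix.mul_fin_two, Matrix.sub_apply, Matrix.of_apply, Matrix.cons_val',
        Matrix.cons_val_zero, Matrix.cons_val_one, Matrix.cons_val_fin_one]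
      ring
  · rw [Matrix.det_mul, Matrix.det_mul, ht, mul_one, ← Matrix.det_mul, hQP, Matrix.det_one]

end Density

/-! ### Maximal orders at a prime, and strong approximation -/

section LocalOrders

variable {α β : ℚ} {p l : ℕ} [Fact p.Prime] [Fact l.Prime]

/-- A maximal order `O` is not enlarged, within `O[1/l]`, by any subring with `l`-integral traces. -/
theorem mem_of_maximal_of_trace (hα : α ≠ 0) (hβ : β ≠ 0) {O R : Subring ℍ[ℚ,α,β]}
    (hO : Maximal IsOrder O) (hOR : O ≤ R) (htr : ∀ x ∈ R, ‖((2 * x.re : ℚ) : ℚ_[l])‖ ≤ 1)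
    {x : ℍ[ℚ,α,β]} (hx : x ∈ R) (hx' : x ∈ invertPrime l O) : x ∈ O := by
  have hl0 : (l : ℚ) ≠ 0 := by exact_mod_cast (Fact.out : l.Prime).ne_zero
  have hint : ∀ y ∈ R ⊓ invertPrime l O, ∃ z : ℤ, 2 * y.re = z := by
    rintro y ⟨hyR, hy⟩
    obtain ⟨k, hk⟩ := mem_invertPrime.1 hy
    obtain ⟨z, hz⟩ := hO.prop.exists_trace_eq hk
    have hz' : (l : ℚ) ^ k * (2 * y.re) = z := by rw [← hz]; simp; ring
    have hdvd : (l ^ k : ℤ) ∣ z := by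
      rw [← Padic.norm_int_le_pow_iff_dvd, ← Rat.cast_intCast, ← hz', Rat.cast_mul, norm_mul]
      have := htr y hyR
      push_cast at this ⊢
      rw [Padic.norm_p_pow]
      exact mul_le_of_le_one_right (by positivity) this
    obtain ⟨w, rfl⟩ := hdvd
    refine ⟨w, mul_left_cancel₀ (pow_ne_zero k hl0) ?_⟩
    rw [hz']; push_cast; rfl
  have hle : O ≤ R ⊓ invertPrime l O := le_inf hOR (le_invertPrime l O)
  suffices h : IsOrder (R ⊓ invertPrime l O) from hO.2 h hle ⟨hx, hx'⟩
  refine ⟨?_, ?_⟩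
  · obtain ⟨c, hc, hcO⟩ := hO.prop.exists_smul_intCoord_mem
    have hmem : ∀ y ∈ R ⊓ invertPrime l O, ∀ w : ℍ[ℚ,α,β], IntCoord w →
        ∃ z : ℤ, 2 * (y * ((c : ℚ) • w)).re = z := fun y hy w hw =>
      hint _ (Subring.mul_mem _ hy (hle (hcO w hw)))
    have hαn : α.num ≠ 0 := Rat.num_ne_zero.2 hα
    have hβn : β.num ≠ 0 := Rat.num_ne_zero.2 hβ
    set N : ℤ := 2 * c * α.num * β.num with hN
    have hN0 : N ≠ 0 := by positivity
    refine AddSubgroup.fg_of_intCoord _ (n := N.natAbs) (Int.natAbs_pos.2 hN0) fun y hy => ?_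
    have key : IntCoord ((N : ℚ) • y) := by
      obtain ⟨z1, h1⟩ := hmem y hy ⟨1, 0, 0, 0⟩ ⟨1, 0, 0, 0, by simp⟩
      obtain ⟨z2, h2⟩ := hmem y hy ⟨0, 1, 0, 0⟩ ⟨0, 1, 0, 0, by simp⟩
      obtain ⟨z3, h3⟩ := hmem y hy ⟨0, 0, 1, 0⟩ ⟨0, 0, 1, 0, by simp⟩
      obtain ⟨z4, h4⟩ := hmem y hy ⟨0, 0, 0, 1⟩ ⟨0, 0, 0, 1, by simp⟩
      simp at h1 h2 h3 h4
      refine ⟨α.num * β.num * z1, α.den * β.num * z2, α.num * β.den * z3,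
        -(α.den * β.den * z4), ?_⟩
      have ea := Rat.den_mul_eq_num α
      have eb := Rat.den_mul_eq_num β
      have hαd : (α.den : ℚ) ≠ 0 := by exact_mod_cast α.den_ne_zero
      rw [hN]
      push_cast
      ext <;> simp
      · linear_combination (α.num * β.num : ℚ) * h1
      · linear_combination (α.den * β.num : ℚ) * h2 - (2 * c * β.num * y.imI : ℚ) * ea
      · linear_combination (α.num * β.den : ℚ) * h3 - (2 * c * α.num * y.imJ : ℚ) * eb
      · linear_combination (-(α.den * β.den) : ℚ) * h4 - (2 * c * α.num * y.imK : ℚ) * eb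
          - (2 * c * β * β.den * y.imK : ℚ) * ea
    rcases Int.natAbs_eq N with h | h
    · rw [h] at key; exact_mod_cast key
    · rw [h] at key
      have := key.neg
      rw [Int.cast_neg, neg_smul, neg_neg] at this
      exact_mod_cast this
  · rw [eq_top_iff, ← hO.prop.2]
    exact Submodule.span_mono hle

/-- Where the quaternion algebra is ramified, an element of integral norm has integral trace. -/
theorem IsRamifiedOver.norm_trace_le (h : IsRamifiedOver ℚ_[l] ℍ[ℚ,α,β]) {x : ℍ[ℚ,α,β]}
    (hx : ‖(reducedNorm x : ℚ_[l])‖ ≤ 1) : ‖((2 * x.re : ℚ) : ℚ_[l])‖ ≤ 1 := by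
  by_cases hc : ∃ r : ℚ, x = r • 1
  · obtain ⟨r, rfl⟩ := hc
    rw [reducedNorm_smul_one, Rat.cast_pow, norm_pow,
      pow_le_one_iff_of_nonneg (norm_nonneg _) two_ne_zero] at hx
    have h2 := Padic.norm_int_le_one (p := l) 2
    have e : ((2 * (r • (1 : ℍ[ℚ,α,β])).re : ℚ) : ℚ_[l]) = ((2 : ℤ) : ℚ_[l]) * (r : ℚ_[l]) := by
      simp
    rw [e, norm_mul]
    exact mul_le_one₀ h2 (norm_nonneg _) hx
  · push Not at hc
    by_contra! ht
    obtain ⟨r, hr⟩ := exists_quadratic_root (t := ((2 * x.re : ℚ) : ℚ_[l]))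
      (n := (reducedNorm x : ℚ_[l])) (hx.trans_lt (one_lt_pow₀ ht two_ne_zero))
    exact h.false_of_root hc (r := r) (by simpa using hr)

/-- Where the quaternion algebra is ramified, a maximal order contains all elements of integral
norm. -/
theorem mem_of_maximal_of_ramified (hα : α < 0) (hβ : β < 0) {O : Subring ℍ[ℚ,α,β]}
    (hO : Maximal IsOrder O) (h : IsRamifiedOver ℚ_[l] ℍ[ℚ,α,β]) {x : ℍ[ℚ,α,β]}
    (hx : ‖(reducedNorm x : ℚ_[l])‖ ≤ 1) (hx' : x ∈ invertPrime l O) : x ∈ O := by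
  have hadd : ∀ x y : ℍ[ℚ,α,β], ‖(reducedNorm x : ℚ_[l])‖ ≤ ‖(reducedNorm y : ℚ_[l])‖ →
      ‖(reducedNorm y : ℚ_[l])‖ ≤ 1 → ‖(reducedNorm (x + y) : ℚ_[l])‖ ≤ 1 := by
    intro x y hxy hy
    by_cases hy0 : reducedNorm y = 0
    · rw [hy0, Rat.cast_zero, norm_zero] at hxy
      have hx0 : reducedNorm x = 0 := by
        have := norm_le_zero_iff.1 hxy
        exact_mod_cast this
      rw [reducedNorm_eq_zero hα hβ hx0, zero_add]; exact hy
    · have hy0' : (reducedNorm y : ℚ_[l]) ≠ 0 := by exact_mod_cast hy0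
      set z := (reducedNorm y)⁻¹ • (x * star y) with hz
      have hzy : z * y = x := by
        rw [hz, smul_mul_assoc, mul_assoc, star_mul_eq_smul, mul_smul_comm, mul_one, smul_smul,
          inv_mul_cancel₀ hy0, one_smul]
      have hnz : ‖(reducedNorm z : ℚ_[l])‖ ≤ 1 := by
        have := congrArg (fun w => ‖(reducedNorm w : ℚ_[l])‖) hzy
        simp only [reducedNorm_mul, Rat.cast_mul, norm_mul] at this
        rw [← this] at hxy
        exact le_of_mul_le_mul_right (by rwa [one_mul]) (norm_pos_iff.2 hy0')
      have h1 : ‖(reducedNorm (1 + z) : ℚ_[l])‖ ≤ 1 := by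
        rw [reducedNorm_one_add, Rat.cast_add, Rat.cast_add]
        refine (Padic.nonarchimedean _ _).trans (max_le ?_ hnz)
        refine (Padic.nonarchimedean _ _).trans (max_le (by simp) (h.norm_trace_le hnz))
      have e : x + y = (1 + z) * y := by rw [add_mul, one_mul, hzy, add_comm]
      rw [e, reducedNorm_mul, Rat.cast_mul, norm_mul]
      exact mul_le_one₀ h1 (norm_nonneg _) hy
  let R : Subring ℍ[ℚ,α,β] :=
    { carrier := {x | ‖(reducedNorm x : ℚ_[l])‖ ≤ 1}
      zero_mem' := by simp [reducedNorm]
      one_mem' := by simp [reducedNorm_one]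
      add_mem' := fun {x y} hx hy => by
        rcases le_total ‖(reducedNorm x : ℚ_[l])‖ ‖(reducedNorm y : ℚ_[l])‖ with h | h
        · exact hadd x y h hy
        · have := hadd y x h hx
          rwa [add_comm] at this
      neg_mem' := fun {x} hx => by
        have : reducedNorm (-x) = reducedNorm x := by simp [reducedNorm]
        simpa [this] using hx
      mul_mem' := fun {x y} hx hy => by
        simp only [Set.mem_ofPred_eq, reducedNorm_mul, Rat.cast_mul, norm_mul]
        exact mul_le_one₀ hx (norm_nonneg _) hy }
  refine mem_of_maximal_of_trace (l := l) (R := R) hα.ne hβ.ne hO (fun y hy => ?_)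
    (fun y hy => h.norm_trace_le hy) hx hx'
  obtain ⟨z, hz⟩ := hO.prop.exists_reducedNorm_eq hy
  change ‖(reducedNorm y : ℚ_[l])‖ ≤ 1
  rw [hz, Rat.cast_intCast]
  exact Padic.norm_int_le_one z

/-- Where the quaternion algebra splits, an order stabilises a lattice of `ℚ_l²`; here `P` is the
matrix of a basis of this lattice and `Q` its inverse. -/
theorem IsOrder.exists_integral_conj {O : Subring ℍ[ℚ,α,β]} (hO : IsOrder O) {r s : ℚ_[l]}
    (h : (β : ℚ_[l]) = r ^ 2 - α * s ^ 2) :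
    ∃ P Q : Matrix (Fin 2) (Fin 2) ℚ_[l], P * Q = 1 ∧ Q * P = 1 ∧
      ∀ x ∈ O, ∀ i j, ‖(Q * splitRep h x * P) i j‖ ≤ 1 := by
  obtain ⟨S, hS⟩ := hO.1
  let v : Fin 2 → ℚ_[l] := ![1, 0]
  let Λ : Submodule ℤ_[l] (Fin 2 → ℚ_[l]) :=
    Submodule.span ℤ_[l] ((fun x => (splitRep h x).mulVec v) '' S)
  have hmem : ∀ x ∈ O, (splitRep h x).mulVec v ∈ Λ := by
    intro x hx
    replace hx : x ∈ AddSubgroup.closure (S : Set ℍ[ℚ,α,β]) := by rw [hS]; exact hx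
    induction hx using AddSubgroup.closure_induction with
    | mem x hx => exact Submodule.subset_span ⟨x, hx, rfl⟩
    | zero => rw [map_zero, Matrix.zero_mulVec]; exact Λ.zero_mem
    | add x y _ _ ihx ihy => rw [map_add, Matrix.add_mulVec]; exact Λ.add_mem ihx ihy
    | neg x _ ihx => rw [map_neg, Matrix.neg_mulVec]; exact Λ.neg_mem ihx
  have hsmul : ∀ (A : Matrix (Fin 2) (Fin 2) ℚ_[l]) (a : ℤ_[l]) (w : Fin 2 → ℚ_[l]),
      A.mulVec (a • w) = a • A.mulVec w := fun A a w => by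
    rw [← algebraMap_smul ℚ_[l] a w, ← algebraMap_smul ℚ_[l] a (A.mulVec w), Matrix.mulVec_smul]
  have hstab : ∀ x ∈ O, ∀ w ∈ Λ, (splitRep h x).mulVec w ∈ Λ := by
    intro x hx w hw
    induction hw using Submodule.span_induction with
    | mem w hw =>
      obtain ⟨y, hy, rfl⟩ := hw
      have hyO : y ∈ O := by
        change y ∈ O.toAddSubgroup
        rw [← hS]; exact AddSubgroup.subset_closure hy
      dsimp only
      rw [Matrix.mulVec_mulVec, ← map_mul]
      exact hmem _ (O.mul_mem hx hyO)
    | zero => rw [Matrix.mulVec_zero]; exact Λ.zero_mem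
    | add w w' _ _ ih ih' => rw [Matrix.mulVec_add]; exact Λ.add_mem ih ih'
    | smul a w _ ih => rw [hsmul]; exact Λ.smul_mem _ ih
  have hlat : Submodule.IsLattice ℚ_[l] Λ :=
    { fg := Submodule.fg_span ((S.finite_toSet).image _)
      span_eq_top := by
        obtain ⟨c, hc, hcO⟩ := hO.exists_smul_mem ⟨0, 1, 0, 0⟩
        have hc0 : (c : ℚ_[l]) ≠ 0 := by exact_mod_cast hc.ne'
        have h1 := hmem 1 O.one_mem
        have h2 := hmem _ hcO
        rw [map_one, Matrix.one_mulVec] at h1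
        have e2 : (splitRep h ((c : ℚ) • ⟨0, 1, 0, 0⟩)).mulVec v = ![0, (c : ℚ_[l])] := by
          rw [splitRep_apply]
          ext i; fin_cases i <;> simp [v, Matrix.mulVec, dotProduct]
        rw [e2] at h2
        rw [eq_top_iff]
        rintro w -
        have : w = w 0 • v + (w 1 / c) • ![0, (c : ℚ_[l])] := by
          ext i; fin_cases i <;> simp [v, hc0]
        rw [this]
        exact add_mem (Submodule.smul_mem _ _ (Submodule.subset_span h1))
          (Submodule.smul_mem _ _ (Submodule.subset_span h2)) }
  have hfree : Module.Free ℤ_[l] Λ := Submodule.IsLattice.free ℚ_[l] Λ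
  have hfin : Module.Finite ℤ_[l] Λ := Submodule.IsLattice.finite ℚ_[l] Λ
  have hrank : Module.finrank ℤ_[l] Λ = 2 := by
    have := Submodule.IsLattice.finrank_of_pi ℚ_[l] Λ
    simpa using this
  let b : Module.Basis (Fin 2) ℤ_[l] Λ := Module.finBasisOfFinrankEq ℤ_[l] Λ hrank
  let B : Module.Basis (Fin 2) ℚ_[l] (Fin 2 → ℚ_[l]) := b.extendOfIsLattice ℚ_[l]
  have hB : ∀ j, B j = (b j : Fin 2 → ℚ_[l]) := fun j => by
    simp [B]
  let E := Pi.basisFun ℚ_[l] (Fin 2)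
  refine ⟨E.toMatrix B, B.toMatrix E, Module.Basis.toMatrix_mul_toMatrix_flip _ _,
    Module.Basis.toMatrix_mul_toMatrix_flip _ _, fun x hx i j => ?_⟩
  set w := (splitRep h x).mulVec (B j) with hw
  have hwΛ : w ∈ Λ := by
    rw [hw, hB]; exact hstab x hx _ (b j).2
  have hcoef : B.repr w i = (b.repr ⟨w, hwΛ⟩ i : ℚ_[l]) := by
    have h1 : w = ∑ i, (b.repr ⟨w, hwΛ⟩ i : ℚ_[l]) • B i := by
      have := congrArg Subtype.val (b.sum_repr ⟨w, hwΛ⟩)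
      refine this.symm.trans ?_
      rw [AddSubmonoidClass.coe_finsetSum]
      refine Finset.sum_congr rfl fun i _ => ?_
      rw [hB]
      rfl
    conv_lhs => rw [h1]
    exact congrFun (B.repr_sum_self _) i
  have key : (B.toMatrix E * splitRep h x * E.toMatrix B) i j = B.repr w i := by
    have h1 : (splitRep h x * E.toMatrix B) =
        Matrix.of fun a c => (splitRep h x).mulVec (B c) a := by
      ext a c
      simp [Matrix.mul_apply, Matrix.mulVec, dotProduct, E, Module.Basis.toMatrix_apply]
    have h2 : w = ∑ a, w a • E a := by
      conv_lhs => rw [← E.sum_repr w]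
      simp only [E, Pi.basisFun_repr]
    rw [mul_assoc, h1]
    conv_rhs => rw [h2]
    rw [Matrix.mul_apply, map_sum, Finsupp.finsetSum_apply]
    refine Finset.sum_congr rfl fun a _ => ?_
    rw [Matrix.of_apply, ← hw, Module.Basis.toMatrix_apply, map_smul, Finsupp.smul_apply,
      smul_eq_mul, mul_comm]
  rw [key, hcoef]
  exact PadicInt.norm_le_one _

/-- Where the quaternion algebra splits, a maximal order is the stabiliser of a lattice. -/
theorem mem_of_maximal_of_integral_conj (hα : α ≠ 0) (hβ : β ≠ 0) {O : Subring ℍ[ℚ,α,β]}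
    (hO : Maximal IsOrder O) {r s : ℚ_[l]} (h : (β : ℚ_[l]) = r ^ 2 - α * s ^ 2)
    {P Q : Matrix (Fin 2) (Fin 2) ℚ_[l]} (hPQ : P * Q = 1) (hQP : Q * P = 1)
    (hint : ∀ x ∈ O, ∀ i j, ‖(Q * splitRep h x * P) i j‖ ≤ 1) {x : ℍ[ℚ,α,β]}
    (hx : ∀ i j, ‖(Q * splitRep h x * P) i j‖ ≤ 1) (hx' : x ∈ invertPrime l O) : x ∈ O := by
  let R : Subring ℍ[ℚ,α,β] :=
    { carrier := {x | ∀ i j, ‖(Q * splitRep h x * P) i j‖ ≤ 1}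
      zero_mem' := by simp
      one_mem' := by
        intro i j
        rw [map_one, mul_one, hQP, Matrix.one_apply]
        split_ifs <;> simp
      add_mem' := fun {x y} hx hy i j => by
        rw [map_add, mul_add, add_mul, Matrix.add_apply]
        exact (Padic.nonarchimedean _ _).trans (max_le (hx i j) (hy i j))
      neg_mem' := fun {x} hx i j => by
        rw [map_neg, mul_neg, neg_mul, Matrix.neg_apply, norm_neg]; exact hx i j
      mul_mem' := fun {x y} hx hy i j => by
        have e : Q * splitRep h (x * y) * P =
            (Q * splitRep h x * P) * (Q * splitRep h y * P) := by
          rw [show (Q * splitRep h x * P) * (Q * splitRep h y * P) =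
            Q * splitRep h x * (P * Q) * splitRep h y * P by simp only [mul_assoc], hPQ, mul_one,
            map_mul]
          simp only [mul_assoc]
        rw [e, Matrix.mul_apply, Fin.sum_univ_two]
        refine (Padic.nonarchimedean _ _).trans (max_le ?_ ?_) <;> rw [norm_mul] <;>
          exact mul_le_one₀ (hx _ _) (norm_nonneg _) (hy _ _) }
  refine mem_of_maximal_of_trace (l := l) (R := R) hα hβ hO hint (fun y hy => ?_) hx hx'
  have e : ((2 * y.re : ℚ) : ℚ_[l]) = (Q * splitRep h y * P).trace := by
    rw [Matrix.trace_mul_cycle, hPQ, one_mul, trace_splitRep]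
  rw [e, Matrix.trace_fin_two]
  exact (Padic.nonarchimedean _ _).trans (max_le (hy 0 0) (hy 1 1))

/-- Two lattices of `ℚ_l²` are simultaneously diagonalisable, so they are both stable under an
endomorphism of any given integral determinant. -/
theorem exists_det_eq_integral_conj {P₁ Q₁ P₂ Q₂ : Matrix (Fin 2) (Fin 2) ℚ_[l]}
    (h₁ : P₁ * Q₁ = 1) (h₁' : Q₁ * P₁ = 1) (h₂ : Q₂ * P₂ = 1)
    {c : ℚ_[l]} (hc : ‖c‖ ≤ 1) :
    ∃ t : Matrix (Fin 2) (Fin 2) ℚ_[l], t.det = c ∧ (∀ i j, ‖(Q₁ * t * P₁) i j‖ ≤ 1) ∧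
      ∀ i j, ‖(Q₂ * t * P₂) i j‖ ≤ 1 := by
  set S := Q₁ * P₂ with hS
  set S' := Q₂ * P₁ with hS'
  have hSS : S' * S = 1 := by
    rw [hS, hS', show Q₂ * P₁ * (Q₁ * P₂) = Q₂ * (P₁ * Q₁) * P₂ by simp only [mul_assoc], h₁,
      mul_one, h₂]
  -- an entry of maximal absolute value
  obtain ⟨⟨i, j⟩, -, hmax⟩ := Finset.exists_max_image (Finset.univ : Finset (Fin 2 × Fin 2))
    (fun v => ‖S v.1 v.2‖) Finset.univ_nonempty
  have hmax' : ∀ a b, ‖S a b‖ ≤ ‖S i j‖ := fun a b => hmax (a, b) (Finset.mem_univ _)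
  have hSij : S i j ≠ 0 := by
    intro h0
    have : S = 0 := by
      ext a b
      have := hmax' a b
      rw [h0, norm_zero] at this
      simpa using norm_le_zero_iff.1 this
    rw [this, mul_zero] at hSS
    exact zero_ne_one hSS
  have hc1 : ‖c - 1‖ ≤ 1 := by
    rw [sub_eq_add_neg]
    exact (Padic.nonarchimedean _ _).trans (max_le hc (by simp))
  have hbound : ∀ (d : ℚ_[l]) (a b a' b' : Fin 2), ‖d‖ ≤ 1 →
      ‖c * (1 : Matrix (Fin 2) (Fin 2) ℚ_[l]) a b - (c - 1) * (S a' b' / S i j) * d‖ ≤ 1 := by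
    intro d a b a' b' hd
    rw [sub_eq_add_neg]
    refine (Padic.nonarchimedean _ _).trans (max_le ?_ ?_)
    · rw [norm_mul]
      refine mul_le_one₀ hc (norm_nonneg _) ?_
      rw [Matrix.one_apply]; split_ifs <;> simp
    · rw [norm_neg, norm_mul, norm_mul, norm_div]
      refine mul_le_one₀ (mul_le_one₀ hc1 (by positivity) ?_) (norm_nonneg _) hd
      exact div_le_one_of_le₀ (hmax' _ _) (norm_nonneg _)
  let E : Matrix (Fin 2) (Fin 2) ℚ_[l] := (S i j)⁻¹ • (S * Matrix.single j i 1)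
  have hE : ∀ a b, E a b = S a j / S i j * (if b = i then 1 else 0) := by
    intro a b
    simp only [E, Matrix.smul_apply, smul_eq_mul]
    by_cases hb : b = i
    · subst hb; simp [div_eq_inv_mul]
    · simp [hb, Matrix.mul_single_apply_of_ne]
  set t' := c • (1 : Matrix (Fin 2) (Fin 2) ℚ_[l]) - (c - 1) • E with ht'
  have hdet : t'.det = c := by
    rw [Matrix.det_fin_two]
    simp only [ht', Matrix.sub_apply, Matrix.smul_apply, hE, smul_eq_mul]
    fin_cases i <;> fin_cases j <;> simp_all
  have hite : ∀ a b : Fin 2, ‖(if a = b then (1 : ℚ_[l]) else 0)‖ ≤ 1 := fun a b => by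
    split_ifs <;> simp
  refine ⟨P₁ * t' * Q₁, ?_, ?_, ?_⟩
  · rw [Matrix.det_mul, Matrix.det_mul, mul_right_comm, ← Matrix.det_mul, h₁, Matrix.det_one,
      one_mul, hdet]
  · intro a b
    rw [show Q₁ * (P₁ * t' * Q₁) * P₁ = (Q₁ * P₁) * t' * (Q₁ * P₁) by simp only [mul_assoc], h₁',
      one_mul, mul_one, ht', Matrix.sub_apply, Matrix.smul_apply, Matrix.smul_apply, hE,
      smul_eq_mul, smul_eq_mul, ← mul_assoc]
    exact hbound _ _ _ _ _ (hite _ _)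
  · intro a b
    have e1 : S' * E * S = (S i j)⁻¹ • (Matrix.single j i 1 * S) := by
      simp only [E, mul_smul_comm, smul_mul_assoc]
      rw [← mul_assoc S', hSS, one_mul]
    have e2 : (S' * E * S) a b = S i b / S i j * (if a = j then 1 else 0) := by
      rw [e1, Matrix.smul_apply, smul_eq_mul]
      by_cases ha : a = j
      · subst ha; simp [div_eq_inv_mul]
      · simp [ha, Matrix.single_mul_apply_of_ne]
    rw [show Q₂ * (P₁ * t' * Q₁) * P₂ = S' * t' * S by simp only [hS, hS', mul_assoc], ht',
      mul_sub, sub_mul, mul_smul_comm, smul_mul_assoc, mul_one, hSS, mul_smul_comm,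
      smul_mul_assoc, Matrix.sub_apply, Matrix.smul_apply, Matrix.smul_apply, e2,
      smul_eq_mul, smul_eq_mul, ← mul_assoc]
    exact hbound _ _ _ _ _ (hite _ _)

theorem eventually_integral_conj {t M P Q : Matrix (Fin 2) (Fin 2) ℚ_[l]} (hM : IsUnit M.det)
    (h : ∀ i j, ‖(Q * t * P) i j‖ ≤ 1) :
    ∀ᶠ A in nhds (t * M⁻¹), ∀ i j, ‖(Q * (A * M) * P) i j‖ ≤ 1 := by
  have e : t * M⁻¹ * M = t := Matrix.nonsing_inv_mul_cancel_right _ _ hM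
  refine Filter.eventually_all.2 fun i => Filter.eventually_all.2 fun j => ?_
  have hc : Continuous fun A : Matrix (Fin 2) (Fin 2) ℚ_[l] => Q * (A * M) * P :=
    (continuous_const.matrix_mul (continuous_id.matrix_mul continuous_const)).matrix_mul
      continuous_const
  have hc' : Continuous fun A : Matrix (Fin 2) (Fin 2) ℚ_[l] =>
      ‖(Q * (A * M) * P) i j - (Q * t * P) i j‖ :=
    ((hc.matrix_elem i j).sub continuous_const).norm
  have h0 : ∀ᶠ A in nhds (t * M⁻¹), ‖(Q * (A * M) * P) i j - (Q * t * P) i j‖ < 1 := by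
    refine hc'.continuousAt.eventually_lt continuousAt_const ?_
    rw [e, sub_self, norm_zero]
    exact one_pos
  filter_upwards [h0] with A hA
  have := Padic.nonarchimedean ((Q * (A * M) * P) i j - (Q * t * P) i j) ((Q * t * P) i j)
  rw [sub_add_cancel] at this
  exact this.trans (max_le hA.le (h i j))

end LocalOrders

section StrongApproximation

variable {α β : ℚ} {p : ℕ} [Fact p.Prime]

theorem invertPrime_mono {A : Type*} [Ring A] [Algebra ℚ A] (l : ℕ) {O O' : Subring A}
    (h : O ≤ O') : invertPrime l O ≤ invertPrime l O' := fun _ ⟨k, hk⟩ => ⟨k, h hk⟩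

/-- An element of norm `p` can be multiplied by an element of norm one in such a way that a given
prime `l ≠ p` disappears from its denominator. -/
theorem IsEichlerOrder.exists_remove_prime (hα : α < 0) (hβ : β < 0)
    {O : Subring ℍ[ℚ,α,β]} {N : ℕ} (hO : IsEichlerOrder O N) (hs : IsSplitOver ℚ_[p] α β)
    {l : ℕ} [Fact l.Prime] (hpl : p ≠ l) {e f M : ℕ} {δ : ℍ[ℚ,α,β]} (hδ : reducedNorm δ = p)
    (hM : ((p ^ f * l ^ e * M : ℕ) : ℚ) • δ ∈ O) :
    ∃ (δ' : ℍ[ℚ,α,β]) (f' : ℕ), reducedNorm δ' = p ∧ ((p ^ f' * M : ℕ) : ℚ) • δ' ∈ O := by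
  have hord : IsOrder O := hO.isOrder
  obtain ⟨O₁, O₂, h₁, h₂, rfl, -⟩ := hO
  have hnat : ∀ n : ℕ, ‖(n : ℚ_[l])‖ ≤ 1 := fun n => by
    exact_mod_cast Padic.norm_int_le_one (p := l) n
  by_cases hsl : IsSplitOver ℚ_[l] α β
  · obtain ⟨r, s, h⟩ := hsl
    obtain ⟨P₁, Q₁, hP₁, hQ₁, hi₁⟩ := h₁.prop.exists_integral_conj h
    obtain ⟨P₂, Q₂, hP₂, hQ₂, hi₂⟩ := h₂.prop.exists_integral_conj h
    obtain ⟨t, hdet, ht₁, ht₂⟩ := exists_det_eq_integral_conj hP₁ hQ₁ hQ₂ (hnat p)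
    have hp0 : (p : ℚ_[l]) ≠ 0 := by exact_mod_cast (Fact.out : p.Prime).ne_zero
    have hdδ : (splitRep h δ).det = p := by rw [det_splitRep, hδ]; simp
    have hdu : IsUnit (splitRep h δ).det := by
      rw [hdδ]; exact isUnit_iff_ne_zero.2 hp0
    obtain ⟨γ, hγ, hnγ, hγ₁, hγ₂⟩ := hord.exists_approximation hα hβ hpl hs h
      (t := t * (splitRep h δ)⁻¹)
      (by rw [Matrix.det_mul, Matrix.det_nonsing_inv, hdet, hdδ, Ring.mul_inverse_cancel _
            (isUnit_iff_ne_zero.2 hp0)])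
      ((eventually_integral_conj hdu ht₁).and (eventually_integral_conj hdu ht₂))
    obtain ⟨i, hγ⟩ := mem_invertPrime.1 hγ
    obtain ⟨j, hγ⟩ := mem_invertPrime.1 hγ
    refine ⟨γ * δ, j + f, by rw [reducedNorm_mul, hnγ, hδ, one_mul], ?_⟩
    set x := ((p ^ (j + f) * M : ℕ) : ℚ) • (γ * δ) with hx
    have hxl : x ∈ invertPrime l (O₁ ⊓ O₂) := by
      refine mem_invertPrime.2 ⟨i + e, ?_⟩
      have := Subring.mul_mem _ hγ hM
      rw [smul_mul_smul_comm, smul_mul_assoc, smul_smul] at this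
      rw [hx, smul_smul]
      convert this using 2
      push_cast; ring
    have hxint : ∀ P Q : Matrix (Fin 2) (Fin 2) ℚ_[l],
        (∀ i j, ‖(Q * (splitRep h γ * splitRep h δ) * P) i j‖ ≤ 1) →
        ∀ i j, ‖(Q * splitRep h x * P) i j‖ ≤ 1 := by
      intro P Q hPQ a b
      rw [hx, splitRep_smul, map_mul, mul_smul_comm, smul_mul_assoc, Matrix.smul_apply,
        smul_eq_mul, norm_mul]
      refine mul_le_one₀ ?_ (norm_nonneg _) (hPQ a b)
      rw [Rat.cast_natCast]; exact hnat _
    exact ⟨mem_of_maximal_of_integral_conj hα.ne hβ.ne h₁ h hP₁ hQ₁ hi₁ (hxint _ _ hγ₁)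
        (invertPrime_mono l inf_le_left hxl),
      mem_of_maximal_of_integral_conj hα.ne hβ.ne h₂ h hP₂ hQ₂ hi₂ (hxint _ _ hγ₂)
        (invertPrime_mono l inf_le_right hxl)⟩
  · have hram := isRamifiedOver_of_not_isSplitOver (F := ℚ_[l]) hα.ne hsl
    refine ⟨δ, f, hδ, ?_⟩
    have hxl : ((p ^ f * M : ℕ) : ℚ) • δ ∈ invertPrime l (O₁ ⊓ O₂) := by
      refine mem_invertPrime.2 ⟨e, ?_⟩
      rw [smul_smul]
      convert hM using 2
      push_cast; ring
    have hn : ‖(reducedNorm (((p ^ f * M : ℕ) : ℚ) • δ) : ℚ_[l])‖ ≤ 1 := by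
      rw [reducedNorm_smul, hδ]
      have := hnat ((p ^ f * M) ^ 2 * p)
      push_cast at this ⊢
      exact this
    exact ⟨mem_of_maximal_of_ramified hα hβ h₁ hram hn (invertPrime_mono l inf_le_left hxl),
      mem_of_maximal_of_ramified hα hβ h₂ hram hn (invertPrime_mono l inf_le_right hxl)⟩

/-- Strong approximation: if `p` is the norm of an element of `H`, it is the norm of an element of
`O[1/p]`. -/
theorem IsEichlerOrder.exists_mem_reducedNorm_eq (hα : α < 0) (hβ : β < 0)
    {O : Subring ℍ[ℚ,α,β]} {N : ℕ} (hO : IsEichlerOrder O N) (hs : IsSplitOver ℚ_[p] α β)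
    {δ : ℍ[ℚ,α,β]} (hδ : reducedNorm δ = p) :
    ∃ x ∈ invertPrime p O, reducedNorm x = p := by
  suffices key : ∀ M : ℕ, 0 < M → ∀ (δ : ℍ[ℚ,α,β]) (f : ℕ), reducedNorm δ = p →
      ((p ^ f * M : ℕ) : ℚ) • δ ∈ O → ∃ x ∈ invertPrime p O, reducedNorm x = p by
    obtain ⟨M, hM, h⟩ := hO.isOrder.exists_smul_mem δ
    exact key M hM δ 0 hδ (by simpa using h)
  intro M
  induction M using Nat.strong_induction_on with
  | _ M ih =>
    intro hM δ f hδ hmem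
    rcases (Nat.succ_le_of_lt hM).eq_or_lt with h1 | h1
    · refine ⟨δ, mem_invertPrime.2 ⟨f, ?_⟩, hδ⟩
      rw [← h1] at hmem
      simpa using hmem
    · obtain ⟨l, hl, M', rfl⟩ := Nat.exists_prime_and_dvd (show M ≠ 1 by omega)
      have hM' : 0 < M' := Nat.pos_of_mul_pos_left hM
      have hlt : M' < l * M' := lt_mul_of_one_lt_left hM' hl.one_lt
      by_cases hpl : p = l
      · subst hpl
        refine ih M' hlt hM' δ (f + 1) hδ ?_
        rwa [pow_succ, mul_assoc]
      · have : Fact l.Prime := ⟨hl⟩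
        obtain ⟨δ', f', h, h'⟩ := hO.exists_remove_prime hα hβ hs hpl (e := 1) (f := f) (M := M')
          hδ (by rwa [pow_one, mul_assoc])
        exact ih M' hlt hM' δ' f' h h'

end StrongApproximation

/-! ### Rational quaternions of norm `p` -/

section Legendre

open scoped NumberTheorySymbols

/-- A special case of Legendre's theorem on the conic `x² + a y² = B z²`. -/
theorem exists_sq_add_mul_sq_eq {a B : ℕ} (ha : 0 < a) (hB : ¬ IsSquare B) (hab : a.Coprime B)
    {u v : ℤ} (hu : (B : ℤ) ∣ u ^ 2 + a) (hv : (a : ℤ) ∣ v ^ 2 - B) :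
    ∃ x y z : ℤ, z ≠ 0 ∧ x ^ 2 + a * y ^ 2 = B * z ^ 2 := by
  have hB0 : 0 < B := Nat.pos_of_ne_zero fun h => hB (h ▸ ⟨0, rfl⟩)
  have : NeZero a := ⟨ha.ne'⟩
  have : NeZero B := ⟨hB0.ne'⟩
  -- a small vector of the lattice `x ≡ v z (mod a)`, `x ≡ u y (mod B)`
  obtain ⟨x, y, z, hne, hx, hy, hz, hxz, hxy⟩ : ∃ x y z : ℤ, (x ≠ 0 ∨ y ≠ 0 ∨ z ≠ 0) ∧
      x ^ 2 ≤ a * B ∧ y ^ 2 ≤ B ∧ z ^ 2 < a ∧ (a : ℤ) ∣ x - v * z ∧ (B : ℤ) ∣ x - u * y := by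
    let S := Finset.range ((a * B).sqrt + 1) ×ˢ
      (Finset.range (B.sqrt + 1) ×ˢ Finset.range ((a - 1).sqrt + 1))
    let f : ℕ × ℕ × ℕ → ZMod a × ZMod B := fun w =>
      ((w.1 : ZMod a) - v * w.2.2, (w.1 : ZMod B) - u * w.2.1)
    have hcard : (Finset.univ : Finset (ZMod a × ZMod B)).card < S.card := by
      rw [Finset.card_univ, Fintype.card_prod, ZMod.card, ZMod.card, Finset.card_product,
        Finset.card_product, Finset.card_range, Finset.card_range, Finset.card_range]
      have h1 := Nat.succ_le_succ_sqrt' (a * B)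
      have h2 := Nat.succ_le_succ_sqrt' B
      have h3 := Nat.succ_le_succ_sqrt' (a - 1)
      rw [Nat.sub_add_cancel ha] at h3
      refine lt_of_pow_lt_pow_left₀ 2 (by positivity) ?_
      calc (a * B) ^ 2 < (a * B + 1) * ((B + 1) * a) := by
            nlinarith [Nat.mul_pos ha hB0, mul_pos (Nat.mul_pos ha hB0) ha]
        _ ≤ ((a * B).sqrt + 1) ^ 2 * ((B.sqrt + 1) ^ 2 * ((a - 1).sqrt + 1) ^ 2) := by gcongr
        _ = _ := by ring
    obtain ⟨w, hw, w', hw', hne, hf⟩ := Finset.exists_ne_map_eq_of_card_lt_of_maps_to hcard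
      (f := f) (fun _ _ => Finset.mem_univ _)
    obtain ⟨x, y, z⟩ := w
    obtain ⟨x', y', z'⟩ := w'
    simp only [S, Finset.mem_product, Finset.mem_range, Nat.lt_succ_iff] at hw hw'
    have hsq : ∀ s t n : ℕ, s ≤ n.sqrt → t ≤ n.sqrt → ((s : ℤ) - t) ^ 2 ≤ n := by
      intro s t n hs ht
      have h1 : ((n.sqrt : ℕ) : ℤ) ^ 2 ≤ n := by exact_mod_cast Nat.sqrt_le' n
      refine le_trans (sq_le_sq' ?_ ?_) h1 <;> omega
    simp only [f, Prod.mk.injEq] at hf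
    refine ⟨x - x', y - y', z - z', ?_, ?_, ?_, ?_, ?_, ?_⟩
    · by_contra! h
      exact hne (by rw [Prod.mk.injEq, Prod.mk.injEq]; omega)
    · exact_mod_cast hsq _ _ _ hw.1 hw'.1
    · exact hsq _ _ _ hw.2.1 hw'.2.1
    · have := hsq _ _ _ hw.2.2 hw'.2.2
      push_cast [Nat.cast_sub ha] at this
      omega
    · rw [← ZMod.intCast_zmod_eq_zero_iff_dvd]
      push_cast
      linear_combination hf.1
    · rw [← ZMod.intCast_zmod_eq_zero_iff_dvd]
      push_cast
      linear_combination hf.2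
  have hdvd : ((a : ℤ) * B) ∣ x ^ 2 + a * y ^ 2 - B * z ^ 2 := by
    refine IsCoprime.mul_dvd (Nat.isCoprime_iff_coprime.2 hab) ?_ ?_
    · have e : x ^ 2 + a * y ^ 2 - B * z ^ 2 =
          (x - v * z) * (x + v * z) + a * y ^ 2 + (v ^ 2 - B) * z ^ 2 := by ring
      rw [e]
      exact dvd_add (dvd_add (hxz.mul_right _) (dvd_mul_right _ _)) (hv.mul_right _)
    · have e : x ^ 2 + a * y ^ 2 - B * z ^ 2 =
          (x - u * y) * (x + u * y) + (u ^ 2 + a) * y ^ 2 - B * z ^ 2 := by ring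
      rw [e]
      exact dvd_sub (dvd_add (hxy.mul_right _) (hu.mul_right _)) (dvd_mul_right _ _)
  obtain ⟨k, hk⟩ := hdvd
  have haz : (0 : ℤ) < a := by exact_mod_cast ha
  have hBz : (0 : ℤ) < B := by exact_mod_cast hB0
  have hy' : y ^ 2 < B := by
    refine lt_of_le_of_ne hy fun h => hB ⟨y.natAbs, ?_⟩
    zify
    rw [← h, sq, ← abs_mul_abs_self]
  have hpos : 0 < (a : ℤ) * B := by positivity
  have hk1 : -1 < k := by
    by_contra! h
    nlinarith [sq_nonneg x, sq_nonneg y]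
  have hk2 : k < 2 := by
    by_contra! h
    nlinarith [sq_nonneg z]
  obtain rfl | rfl : k = 0 ∨ k = 1 := by omega
  · refine ⟨x, y, z, ?_, by linarith⟩
    rintro rfl
    have hx0 : x = 0 := by
      by_contra h
      have : 0 < x ^ 2 := by positivity
      nlinarith [sq_nonneg y]
    have hy0 : y = 0 := by
      by_contra h
      have : 0 < y ^ 2 := by positivity
      nlinarith [sq_nonneg x]
    simp_all
  · refine ⟨x * z - a * y, x + y * z, z ^ 2 + a, by positivity, ?_⟩
    linear_combination (z ^ 2 + a) * hk

theorem exists_dvd_sq_sub {n : ℕ} {b : ℤ} (h : IsSquare (b : ZMod n)) :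
    ∃ u : ℤ, (n : ℤ) ∣ u ^ 2 - b := by
  obtain ⟨s, hs⟩ := h
  obtain ⟨u, rfl⟩ := ZMod.intCast_surjective s
  refine ⟨u, ?_⟩
  rw [← ZMod.intCast_zmod_eq_zero_iff_dvd]
  push_cast
  rw [hs]; ring

theorem jacobiSym_neg_of_three_mod_four {a q : ℕ} (ha : a % 4 = 3) (hq : Odd q) :
    J(-(a : ℤ) | q) = J((q : ℤ) | a) := by
  have hao : Odd a := Nat.odd_iff.2 (by omega)
  rw [jacobiSym.neg _ hq]
  rcases Nat.odd_mod_four_iff.1 (Nat.odd_iff.1 hq) with h | h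
  · rw [ZMod.χ₄_nat_one_mod_four h, one_mul, jacobiSym.quadratic_reciprocity_one_mod_four' hao h]
  · rw [ZMod.χ₄_nat_three_mod_four h, jacobiSym.quadratic_reciprocity_three_mod_four ha h]
    ring

/-- Dirichlet's theorem for two simultaneous congruences. -/
theorem exists_prime_gt_congruences {a M p : ℕ} (ha : a ≠ 0) (hM : M ≠ 0) (haM : a.Coprime M)
    (hpM : p.Coprime M) (n : ℕ) :
    ∃ q : ℕ, q.Prime ∧ n < q ∧ ((q : ℤ) : ZMod a) = 1 ∧ (M : ℤ) ∣ p * q - 1 := by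
  have : NeZero (a * M) := ⟨mul_ne_zero ha hM⟩
  let e := ZMod.chineseRemainder haM
  let w : ZMod a × ZMod M := (1, ((ZMod.unitOfCoprime p hpM)⁻¹ : (ZMod M)ˣ))
  have hu : IsUnit (e.symm w) :=
    (Prod.isUnit_iff.2 ⟨isUnit_one, ((ZMod.unitOfCoprime p hpM)⁻¹).isUnit⟩ : IsUnit w).map e.symm
  obtain ⟨q, hqn, hq, hqe⟩ := Nat.forall_exists_prime_gt_and_eq_mod hu n
  have h := congrArg e hqe
  rw [e.apply_symm_apply, map_natCast] at h
  refine ⟨q, hq, hqn, ?_, ?_⟩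
  · have := congrArg Prod.fst h
    push_cast
    simpa [w] using this
  · have h2 := congrArg Prod.snd h
    have h3 : (q : ZMod M) = ((ZMod.unitOfCoprime p hpM)⁻¹ : (ZMod M)ˣ) := by
      simpa [w] using h2
    rw [← ZMod.intCast_zmod_eq_zero_iff_dvd]
    push_cast
    rw [h3, ← ZMod.coe_unitOfCoprime p hpM, Units.mul_inv, sub_self]

/-- An auxiliary prime `q`, found by Dirichlet's theorem, is represented up to squares by
`x² + a y²` while `p q` is represented by `x² + a' y²`. -/
theorem exists_auxiliary_prime {p : ℕ} (hp : p.Prime) {a a' : ℕ} (ha : a % 4 = 3)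
    (ha' : 0 < a') (hcop : a.Coprime a') (hpa' : ¬ p ∣ a') (hsq : IsSquare ((-a' : ℤ) : ZMod p))
    (h2 : p = 2 → a' % 8 = 7) :
    ∃ q : ℕ, q.Prime ∧ (∃ x y z : ℤ, z ≠ 0 ∧ x ^ 2 + a * y ^ 2 = q * z ^ 2) ∧
      ∃ x y z : ℤ, z ≠ 0 ∧ x ^ 2 + a' * y ^ 2 = ((p * q : ℕ) : ℤ) * z ^ 2 := by
  have hapos : 0 < a := by omega
  -- it suffices that `q` satisfies the following congruence conditions
  obtain ⟨q, hq, hpq, hq2, hqa, hpqa', hJ⟩ : ∃ q : ℕ, q.Prime ∧ p < q ∧ 2 < q ∧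
      ((q : ℤ) : ZMod a) = 1 ∧ ((p * q : ℤ) : ZMod a') = 1 ∧ J(-(a' : ℤ) | q) = 1 := by
    by_cases hp2 : p = 2
    · subst hp2
      have h7 := h2 rfl
      obtain ⟨q, hq, hq2, hqa, hqa'⟩ := exists_prime_gt_congruences hapos.ne' ha'.ne' hcop
        ((Nat.Prime.coprime_iff_not_dvd hp).2 hpa') 2
      have h1 : ((2 * q : ℤ) : ZMod a') = 1 := by
        have := (ZMod.intCast_zmod_eq_zero_iff_dvd _ _).2 hqa'
        push_cast at this ⊢
        exact sub_eq_zero.1 this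
      refine ⟨q, hq, hq2, hq2, hqa, by exact_mod_cast h1, ?_⟩
      have hodd : Odd a' := Nat.odd_iff.2 (by omega)
      have hJ2 : J((2 : ℤ) | a') = 1 := by
        rw [jacobiSym.at_two hodd, ZMod.χ₈_nat_eq_if_mod_eight, h7]
        simp [Nat.odd_iff.1 hodd]
      have h3 : J((2 * q : ℤ) | a') = 1 := by
        rw [jacobiSym.mod_left, (ZMod.intCast_eq_intCast_iff' _ 1 a').1 (by rw [h1, Int.cast_one]),
          ← jacobiSym.mod_left, jacobiSym.one_left]
      rw [jacobiSym_neg_of_three_mod_four (by omega) (hq.odd_of_ne_two hq2.ne'), ← h3,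
        jacobiSym.mul_left, hJ2, one_mul]
    · have hpodd : Odd p := hp.odd_of_ne_two hp2
      have hao : Odd a := Nat.odd_iff.2 (by omega)
      have hc4 : ∀ n : ℕ, Odd n → n.Coprime 4 := fun n hn =>
        Nat.Coprime.pow_right 2 (Nat.coprime_two_right.2 hn)
      obtain ⟨q, hq, hqp, hqa, hqa'⟩ := exists_prime_gt_congruences (M := 4 * a') hapos.ne'
        (by positivity) ((hc4 a hao).mul_right hcop)
        ((hc4 p hpodd).mul_right ((Nat.Prime.coprime_iff_not_dvd hp).2 hpa')) p
      have hq2 : 2 < q := hp.two_le.trans_lt hqp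
      have hqodd : Odd q := hq.odd_of_ne_two hq2.ne'
      have h1 : ((p * q : ℤ) : ZMod a') = 1 := by
        have := (ZMod.intCast_zmod_eq_zero_iff_dvd _ _).2
          ((Int.natCast_dvd_natCast.2 (Dvd.intro_left 4 rfl)).trans hqa')
        push_cast at this ⊢
        exact sub_eq_zero.1 this
      refine ⟨q, hq, hqp, hq2, hqa, h1, ?_⟩
      have : Fact p.Prime := ⟨hp⟩
      have hJp : J(-(a' : ℤ) | p) = 1 := by
        rw [← jacobiSym.legendreSym.to_jacobiSym, legendreSym.eq_one_iff]
        · exact hsq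
        · rw [Ne, ZMod.intCast_zmod_eq_zero_iff_dvd, dvd_neg, Int.natCast_dvd_natCast]
          exact hpa'
      have hJpq : J(-(a' : ℤ) | p * q) = 1 := by
        have hmod : (p * q) % (4 * a') = 1 % (4 * a') := by
          have : (4 * a' : ℕ) ∣ p * q - 1 := by
            rw [← Int.natCast_dvd_natCast, Nat.cast_sub (Nat.mul_pos hp.pos hq.pos)]
            exact_mod_cast hqa'
          exact ((Nat.modEq_iff_dvd' (Nat.mul_pos hp.pos hq.pos)).2 this).symm
        rw [jacobiSym.mod_right _ (hpodd.mul hqodd), Int.natAbs_neg, Int.natAbs_natCast, hmod]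
        have := jacobiSym.mod_right (-(a' : ℤ)) odd_one
        rw [Int.natAbs_neg, Int.natAbs_natCast] at this
        rw [← this, jacobiSym.one_right]
      rwa [jacobiSym.mul_right' _ hp.ne_zero hq.ne_zero, hJp, one_mul] at hJpq
  have : Fact q.Prime := ⟨hq⟩
  have hqodd : Odd q := hq.odd_of_ne_two hq2.ne'
  have hnsq : ∀ n : ℕ, n.Prime → ¬ IsSquare n := fun n hn => hn.prime.not_isSquare
  refine ⟨q, hq, ?_, ?_⟩
  · have hJ1 : J(-(a : ℤ) | q) = 1 := by
      rw [jacobiSym_neg_of_three_mod_four ha hqodd, jacobiSym.mod_left]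
      have : (q : ℤ) % a = 1 % a := by
        rw [← ZMod.intCast_eq_intCast_iff', hqa, Int.cast_one]
      rw [this, ← jacobiSym.mod_left, jacobiSym.one_left]
    obtain ⟨u, hu⟩ := exists_dvd_sq_sub (ZMod.isSquare_of_jacobiSym_eq_one hJ1)
    rw [sub_neg_eq_add] at hu
    have hv : (a : ℤ) ∣ 1 ^ 2 - q := by
      rw [← ZMod.intCast_zmod_eq_zero_iff_dvd]
      push_cast at hqa ⊢
      rw [hqa]; ring
    refine exists_sq_add_mul_sq_eq hapos (hnsq q hq) ?_ hu hv
    rw [← Nat.isCoprime_iff_coprime]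
    obtain ⟨w, hw⟩ := hv
    exact ⟨w, 1, by linear_combination -hw⟩
  · obtain ⟨u₁, hu₁⟩ := exists_dvd_sq_sub hsq
    obtain ⟨u₂, hu₂⟩ := exists_dvd_sq_sub (ZMod.isSquare_of_jacobiSym_eq_one hJ)
    have hcpq : IsCoprime (p : ℤ) (q : ℤ) :=
      Nat.isCoprime_iff_coprime.2 ((Nat.coprime_primes hp hq).2 hpq.ne)
    obtain ⟨r, s, hrs⟩ := id hcpq
    have hv : (a' : ℤ) ∣ 1 ^ 2 - (p * q : ℕ) := by
      rw [← ZMod.intCast_zmod_eq_zero_iff_dvd]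
      push_cast at hpqa' ⊢
      rw [hpqa']; ring
    refine exists_sq_add_mul_sq_eq (u := u₁ * (s * q) + u₂ * (r * p)) ha' ?_ ?_ ?_ hv
    · rintro ⟨c, hc⟩
      have h1 : p ∣ c := by
        have := Dvd.intro _ hc
        rcases hp.dvd_mul.1 (hc ▸ dvd_mul_right p q : p ∣ c * c) with h | h <;> exact h
      obtain ⟨e, rfl⟩ := h1
      have : q = p * (e * e) := by
        refine Nat.eq_of_mul_eq_mul_left hp.pos ?_
        rw [hc]; ring
      rcases hq.eq_one_or_self_of_dvd p ⟨_, this⟩ with h | h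
      · exact hp.one_lt.ne' h
      · exact hpq.ne h
    · rw [← Nat.isCoprime_iff_coprime]
      obtain ⟨w, hw⟩ := hv
      exact ⟨w, 1, by linear_combination -hw⟩
    · push_cast
      refine hcpq.mul_dvd ?_ ?_
      · obtain ⟨k, hk⟩ := hu₁
        refine ⟨k + (-r * u₁ + r * u₂) * (u₁ + u₁ * (s * q) + u₂ * (r * p)), ?_⟩
        linear_combination hk + (u₁ + u₁ * (s * q) + u₂ * (r * p)) * u₁ * hrs
      · obtain ⟨k, hk⟩ := hu₂
        refine ⟨k + (s * u₁ - s * u₂) * (u₂ + u₁ * (s * q) + u₂ * (r * p)), ?_⟩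
        linear_combination hk + (u₂ + u₁ * (s * q) + u₂ * (r * p)) * u₂ * hrs

end Legendre
section NormPrime

variable {α β : ℚ} {p : ℕ} [Fact p.Prime]

theorem reducedNorm_add (x y : ℍ[ℚ,α,β]) :
    reducedNorm (x + y) = reducedNorm x + reducedNorm y + 2 * (x * star y).re := by
  simp [reducedNorm]; ring

theorem reducedNorm_smul_one_add_smul (x y : ℚ) {ξ : ℍ[ℚ,α,β]} (hξ : ξ.re = 0) :
    reducedNorm (x • 1 + y • ξ) = x ^ 2 + reducedNorm ξ * y ^ 2 := by
  simp [reducedNorm, hξ]; ring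

theorem re_mul_comm (x y : ℍ[ℚ,α,β]) : (x * y).re = (y * x).re := by
  simp; ring

theorem star_eq_neg {x : ℍ[ℚ,α,β]} (hx : x.re = 0) : star x = -x := by
  rw [star_eq_trace_sub, hx, mul_zero, zero_smul, zero_sub]

/-- The norm form of a quaternion algebra on the pure quaternions, in an orthogonal basis. -/
theorem reducedNorm_pure_combination {u v : ℍ[ℚ,α,β]} (hu : u.re = 0) (hv : v.re = 0)
    (huv : u * v = -(v * u)) (Y Z T : ℚ) :
    (Y • u + Z • v + T • (u * v)).re = 0 ∧ reducedNorm (Y • u + Z • v + T • (u * v)) =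
      reducedNorm u * Y ^ 2 + reducedNorm v * Z ^ 2 + reducedNorm u * reducedNorm v * T ^ 2 := by
  have h0 : (u * v).re = 0 := by
    have h := congrArg QuaternionAlgebra.re huv
    rw [QuaternionAlgebra.re_neg, re_mul_comm v u] at h
    linarith
  have h1 : (u * (u * v)).re = 0 := by
    rw [← mul_assoc, mul_self_eq, hu, mul_zero, zero_smul, zero_sub, neg_mul, smul_mul_assoc,
      one_mul, QuaternionAlgebra.re_neg, QuaternionAlgebra.re_smul, hv, smul_zero, neg_zero]
  have h2 : (v * (u * v)).re = 0 := by
    rw [huv, mul_neg, ← mul_assoc, mul_self_eq, hv, mul_zero, zero_smul, zero_sub, neg_mul,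
      smul_mul_assoc, one_mul, neg_neg, QuaternionAlgebra.re_smul, hu, smul_zero]
  refine ⟨by simp only [QuaternionAlgebra.re_add, QuaternionAlgebra.re_smul, hu, hv, h0,
    smul_zero, add_zero], ?_⟩
  have hsv : star (Z • v) = -(Z • v) := star_eq_neg (by simp [hv])
  have hsw : star (T • (u * v)) = -(T • (u * v)) :=
    star_eq_neg (by rw [QuaternionAlgebra.re_smul, h0, smul_zero])
  rw [reducedNorm_add, reducedNorm_add, hsv, hsw, reducedNorm_smul, reducedNorm_smul,
    reducedNorm_smul, reducedNorm_mul, add_mul]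
  simp only [mul_neg, smul_mul_smul_comm, QuaternionAlgebra.re_neg, QuaternionAlgebra.re_add,
    QuaternionAlgebra.re_smul, h0, h1, h2, smul_zero, add_zero, neg_zero, mul_zero]
  ring

theorem exists_squarefree_mul_sq {r : ℚ} (hr : 0 < r) :
    ∃ n : ℕ, Squarefree n ∧ ∃ s : ℚ, s ≠ 0 ∧ r = n * s ^ 2 := by
  obtain ⟨n, b, hb, hn⟩ := Nat.sq_mul_squarefree (r.num.natAbs * r.den)
  have hd : (r.den : ℚ) ≠ 0 := by exact_mod_cast r.den_ne_zero
  have hnum : ((r.num.natAbs : ℕ) : ℚ) = r * r.den := by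
    rw [Rat.mul_den_eq_num]
    have : ((r.num.natAbs : ℕ) : ℤ) = r.num := Int.natAbs_of_nonneg (Rat.num_nonneg.2 hr.le)
    rw [← Int.cast_natCast, this]
  have h1 : (b : ℚ) ^ 2 * n = r * r.den * r.den := by
    rw [← hnum]; exact_mod_cast hb
  have hb0 : (b : ℚ) ≠ 0 := by
    intro h
    rw [h] at h1
    have : 0 < r * r.den * r.den := by positivity
    nlinarith
  refine ⟨n, hn, b / r.den, div_ne_zero hb0 hd, ?_⟩
  field_simp
  linear_combination -h1

/-- The ternary form `g a Y² + g b Z² + a b T²` takes a value that is congruent to `3` modulo `4` at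
a vector whose last two coordinates are prime to every odd number. -/
theorem exists_ternary_value {g a b : ℕ} (hg : Squarefree (g * a)) (hb : Squarefree (g * b))
    (hab : a.Coprime b) :
    ∃ Y Z T : ℕ, (Z = 1 ∨ Z = 2) ∧ (T = 1 ∨ T = 2) ∧
      (g * a * Y ^ 2 + g * b * Z ^ 2 + a * b * T ^ 2) % 4 = 3 := by
  have hcast : ∀ n : ℕ, ¬ 4 ∣ n → (n : ZMod 4) ≠ 0 := fun n hn h =>
    hn ((ZMod.natCast_eq_zero_iff n 4).1 h)
  have hcast2 : ∀ n : ℕ, (n : ZMod 4) = 2 → 2 ∣ n := fun n hn => by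
    have : n % 4 = 2 % 4 := (ZMod.natCast_eq_natCast_iff' n 2 4).1 (by rw [hn]; rfl)
    omega
  have hsq4 : ∀ n : ℕ, Squarefree n → ¬ 4 ∣ n := fun n hn h => by
    have := hn 2 h
    rw [Nat.isUnit_iff] at this
    omega
  have h2 : ∀ m n : ℕ, m.Coprime n → ¬ ((m : ZMod 4) = 2 ∧ (n : ZMod 4) = 2) := fun m n h h' => by
    have := Nat.dvd_gcd (hcast2 m h'.1) (hcast2 n h'.2)
    rw [h] at this
    omega
  have key : ∀ x y z : ZMod 4, x ≠ 0 → y ≠ 0 → z ≠ 0 → ¬ (x = 2 ∧ y = 2) → ¬ (x = 2 ∧ z = 2) →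
      ¬ (y = 2 ∧ z = 2) → ∃ Y Z T : Fin 3, (Z = 1 ∨ Z = 2) ∧ (T = 1 ∨ T = 2) ∧
        x * y * ((Y : ℕ) : ZMod 4) ^ 2 + x * z * ((Z : ℕ) : ZMod 4) ^ 2 +
          y * z * ((T : ℕ) : ZMod 4) ^ 2 = 3 := by decide
  obtain ⟨Y, Z, T, hZ, hT, h⟩ := key g a b
    (hcast _ fun h => hsq4 _ hg (h.mul_right _)) (hcast _ fun h => hsq4 _ hg (h.mul_left _))
    (hcast _ fun h => hsq4 _ hb (h.mul_left _)) (h2 _ _ (Nat.coprime_of_squarefree_mul hg))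
    (h2 _ _ (Nat.coprime_of_squarefree_mul hb)) (h2 _ _ hab)
  refine ⟨Y, Z, T, by omega, by omega, ?_⟩
  have := (ZMod.natCast_eq_natCast_iff' (g * a * (Y : ℕ) ^ 2 + g * b * (Z : ℕ) ^ 2 +
    a * b * (T : ℕ) ^ 2) 3 4).1 (by push_cast; exact h)
  exact this

/-- A prime dividing the value and `g * a` divides two of the three terms, hence the third; it is odd
by the congruence modulo `4`, so it does not divide `Z` or `T`, which are `1` or `2`. -/
theorem coprime_ternary_value {g a b Y Z T : ℕ} (hg : Squarefree (g * a))
    (hb : Squarefree (g * b)) (hab : a.Coprime b) (hZ : Z = 1 ∨ Z = 2) (hT : T = 1 ∨ T = 2)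
    (h : (g * a * Y ^ 2 + g * b * Z ^ 2 + a * b * T ^ 2) % 4 = 3) :
    (g * a * Y ^ 2 + g * b * Z ^ 2 + a * b * T ^ 2).Coprime (g * a) := by
  have hga := Nat.coprime_of_squarefree_mul hg
  have hgb := Nat.coprime_of_squarefree_mul hb
  refine Nat.Coprime.symm (Nat.coprime_of_dvd fun l hl h1 h2 => ?_)
  have hl2 : l ≠ 2 := by rintro rfl; omega
  have hlZ : ∀ W : ℕ, W = 1 ∨ W = 2 → ¬ l ∣ W ^ 2 := fun W hW hd => by
    have := hl.dvd_of_dvd_pow hd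
    rcases hW with rfl | rfl
    · exact hl.one_lt.ne' (Nat.dvd_one.1 this)
    · exact hl2 ((Nat.prime_dvd_prime_iff_eq hl Nat.prime_two).1 this)
  have hcop : ∀ m n : ℕ, m.Coprime n → l ∣ m → ¬ l ∣ n := fun m n hmn hm hn =>
    hl.one_lt.ne' (Nat.dvd_one.1 (hmn ▸ Nat.dvd_gcd hm hn))
  rcases hl.dvd_mul.1 h1 with h3 | h3
  · have h4 : l ∣ a * b * T ^ 2 := (Nat.dvd_add_right
      (dvd_add ((h3.mul_right _).mul_right _) ((h3.mul_right _).mul_right _))).1 h2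
    rcases hl.dvd_mul.1 h4 with h4 | h4
    · rcases hl.dvd_mul.1 h4 with h4 | h4
      · exact hcop _ _ hga h3 h4
      · exact hcop _ _ hgb h3 h4
    · exact hlZ T hT h4
  · have h4 : l ∣ g * b * Z ^ 2 := by
      rw [add_right_comm] at h2
      exact (Nat.dvd_add_right
        (dvd_add ((h3.mul_left _).mul_right _) ((h3.mul_right _).mul_right _))).1 h2
    rcases hl.dvd_mul.1 h4 with h4 | h4
    · rcases hl.dvd_mul.1 h4 with h4 | h4
      · exact hcop _ _ hga h4 h3
      · exact hcop _ _ hab h3 h4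
    · exact hlZ Z hZ h4

/-- Congruence conditions on a squarefree `n` for which `-n` is a square in `ℚ_p`. -/
theorem congruences_of_padic_sq {n : ℕ} (hn : Squarefree n) {c : ℚ_[p]}
    (hc : c ^ 2 = -(n : ℚ_[p])) :
    ¬ p ∣ n ∧ IsSquare ((-n : ℤ) : ZMod p) ∧ (p = 2 → n % 8 = 7) := by
  have hc1 : ‖c‖ ≤ 1 := by
    have h := congrArg norm hc
    rw [norm_pow, norm_neg] at h
    have h1 : ‖(n : ℚ_[p])‖ ≤ 1 := by exact_mod_cast Padic.norm_int_le_one (p := p) n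
    rw [← h] at h1
    exact (pow_le_one_iff_of_nonneg (norm_nonneg _) two_ne_zero).1 h1
  obtain ⟨z, rfl⟩ : ∃ z : ℤ_[p], (z : ℚ_[p]) = c := ⟨⟨c, hc1⟩, rfl⟩
  have hz : z ^ 2 = -(n : ℤ_[p]) := by
    apply Subtype.ext
    push_cast
    exact hc
  have hpn : ¬ p ∣ n := by
    intro h
    have hpz : (p : ℤ_[p]) ∣ z := by
      refine PadicInt.prime_p.dvd_of_dvd_pow (n := 2) ?_
      rw [hz, dvd_neg]
      exact_mod_cast Nat.cast_dvd_cast h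
    obtain ⟨w, rfl⟩ := hpz
    have h1 : ((p : ℤ_[p]) ^ 2) ∣ ((n : ℤ) : ℤ_[p]) := by
      refine ⟨-w ^ 2, ?_⟩
      push_cast
      linear_combination hz
    rw [PadicInt.pow_p_dvd_int_iff] at h1
    have h2 : p * p ∣ n := by
      rw [← sq]; exact_mod_cast h1
    exact (Fact.out : p.Prime).one_lt.ne' (Nat.isUnit_iff.1 (hn p h2))
  refine ⟨hpn, ⟨PadicInt.toZMod z, ?_⟩, ?_⟩
  · have := congrArg PadicInt.toZMod hz
    rw [map_pow, map_neg, map_natCast] at this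
    push_cast
    rw [← this, sq]
  · rintro rfl
    have h := congrArg (PadicInt.toZModPow 3) hz
    rw [map_pow, map_neg, map_natCast] at h
    have key : ∀ c a : ZMod (2 ^ 3), c ^ 2 = -a → a = 7 ∨ a = 0 ∨ a = 4 := by decide
    have hmod : ∀ k : ℕ, (n : ZMod (2 ^ 3)) = (k : ZMod (2 ^ 3)) → n % 8 = k % 8 := fun k hk =>
      (ZMod.natCast_eq_natCast_iff' n k (2 ^ 3)).1 hk
    rcases key _ _ h with h | h | h
    · exact hmod 7 (by rw [h]; rfl)
    · have := hmod 0 (by rw [h]; rfl)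
      omega
    · have := hmod 4 (by rw [h]; rfl)
      omega

/-- A definite quaternion algebra that splits at `p` has an element of reduced norm `p`. -/
theorem exists_reducedNorm_eq_prime (hα : α < 0) (hβ : β < 0) (hs : IsSplitOver ℚ_[p] α β) :
    ∃ δ : ℍ[ℚ,α,β], reducedNorm δ = p := by
  obtain ⟨y, hy, hyw, σ, hσ, hσy⟩ := exists_pure_splitting (p := p) hα.ne hβ.ne hs
    (w := ⟨0, 1, 0, 0⟩) (fun r h => by simpa using congrArg QuaternionAlgebra.imI h)
  have hys : ∀ r : ℚ, y ≠ r • 1 := by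
    rintro r rfl
    exact hyw (by rw [smul_mul_assoc, mul_smul_comm, one_mul, mul_one])
  obtain ⟨b₁, b₂, b₃, hb⟩ := exists_not_commute hα.ne hβ.ne hys
  set w : ℍ[ℚ,α,β] := ⟨0, b₁, b₂, b₃⟩
  -- a pure quaternion orthogonal to `y`
  set y' := w * y - y * w with hy'
  have hy'0 : y' ≠ 0 := sub_ne_zero.2 hb
  have hy're : y'.re = 0 := by
    rw [hy', QuaternionAlgebra.re_sub, re_mul_comm, sub_self]
  have hyy : y * y = -(reducedNorm y • 1) := by
    rw [mul_self_eq, hy, mul_zero, zero_smul, zero_sub]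
  have hanti : y * y' = -(y' * y) := by
    rw [hy', mul_sub, sub_mul, ← mul_assoc y y w, mul_assoc w y y, hyy, neg_mul, mul_neg,
      smul_mul_assoc, mul_smul_comm, one_mul, mul_one, mul_assoc]
    abel
  obtain ⟨m, hm, s, hs0, hms⟩ := exists_squarefree_mul_sq (reducedNorm_pos hα hβ
    (x := y) (by rintro rfl; exact hyw (by simp)))
  obtain ⟨n, hn, t, ht0, hnt⟩ := exists_squarefree_mul_sq (reducedNorm_pos hα hβ hy'0)
  have hcsq : (σ / s) ^ 2 = -(m : ℚ_[p]) := by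
    have : (s : ℚ_[p]) ≠ 0 := by exact_mod_cast hs0
    rw [div_pow, hσy, hms]
    push_cast
    field_simp
  obtain ⟨hpm, hsqm, h2m⟩ := congruences_of_padic_sq hm hcsq
  obtain ⟨g, a, b, hab, rfl, rfl⟩ : ∃ g a b : ℕ, a.Coprime b ∧ m = g * a ∧ n = g * b := by
    have hpos : 0 < m.gcd n := Nat.gcd_pos_of_pos_left _ (Nat.pos_of_ne_zero hm.ne_zero)
    obtain ⟨a, b, hab, ha, hb⟩ := Nat.exists_coprime m n
    exact ⟨m.gcd n, a, b, hab, by rw [mul_comm]; exact ha, by rw [mul_comm]; exact hb⟩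
  obtain ⟨Y, Z, T, hZ, hT, hV⟩ := exists_ternary_value hm hn hab
  have hcop := coprime_ternary_value hm hn hab hZ hT hV
  set V := g * a * Y ^ 2 + g * b * Z ^ 2 + a * b * T ^ 2 with hVdef
  have hg0 : (g : ℚ) ≠ 0 := by
    have := hm.ne_zero
    exact_mod_cast (left_ne_zero_of_mul this)
  set u := s⁻¹ • y with hu
  set v := t⁻¹ • y' with hv
  have hnu : reducedNorm u = (g * a : ℕ) := by
    rw [hu, reducedNorm_smul, hms]; field_simp
  have hnv : reducedNorm v = (g * b : ℕ) := by
    rw [hv, reducedNorm_smul, hnt]; field_simp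
  have hure : u.re = 0 := by rw [hu, QuaternionAlgebra.re_smul, hy, smul_zero]
  have hvre : v.re = 0 := by rw [hv, QuaternionAlgebra.re_smul, hy're, smul_zero]
  have huv : u * v = -(v * u) := by
    rw [hu, hv, smul_mul_smul_comm, smul_mul_smul_comm, hanti, smul_neg, mul_comm]
  obtain ⟨hξre, hξ⟩ := reducedNorm_pure_combination hure hvre huv Y Z (T / g)
  set ξ := (Y : ℚ) • u + (Z : ℚ) • v + ((T : ℚ) / g) • (u * v)
  have hξn : reducedNorm ξ = (V : ℚ) := by
    rw [hξ, hnu, hnv, hVdef]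
    push_cast
    field_simp
  obtain ⟨q, hq, ⟨x₁, y₁, z₁, hz₁, h₁⟩, x₂, y₂, z₂, hz₂, h₂⟩ :=
    exists_auxiliary_prime (Fact.out : p.Prime) hV (Nat.pos_of_ne_zero hm.ne_zero) hcop hpm hsqm h2m
  have e₁ : reducedNorm ((x₁ : ℚ) • 1 + (y₁ : ℚ) • ξ) = q * z₁ ^ 2 := by
    rw [reducedNorm_smul_one_add_smul _ _ hξre, hξn]
    exact_mod_cast h₁
  have e₂ : reducedNorm ((x₂ : ℚ) • 1 + (y₂ : ℚ) • u) = (p * q : ℕ) * z₂ ^ 2 := by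
    rw [reducedNorm_smul_one_add_smul _ _ hure, hnu]
    exact_mod_cast h₂
  refine ⟨((q : ℚ) * z₁ * z₂)⁻¹ •
    (((x₁ : ℚ) • 1 + (y₁ : ℚ) • ξ) * ((x₂ : ℚ) • 1 + (y₂ : ℚ) • u)), ?_⟩
  have hq0 : (q : ℚ) ≠ 0 := by exact_mod_cast hq.ne_zero
  have hz₁0 : (z₁ : ℚ) ≠ 0 := by exact_mod_cast hz₁
  have hz₂0 : (z₂ : ℚ) ≠ 0 := by exact_mod_cast hz₂
  rw [reducedNorm_smul, reducedNorm_mul, e₁, e₂]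
  push_cast
  field_simp

/-- `O[1/p]` contains an element of reduced norm `p`. -/
theorem IsEichlerOrder.exists_mem_reducedNorm_eq_prime (hα : α < 0) (hβ : β < 0)
    {O : Subring ℍ[ℚ,α,β]} {N : ℕ} (hO : IsEichlerOrder O N) (hs : IsSplitOver ℚ_[p] α β) :
    ∃ x ∈ invertPrime p O, reducedNorm x = p :=
  (exists_reducedNorm_eq_prime hα hβ hs).elim fun _ hδ =>
    hO.exists_mem_reducedNorm_eq hα hβ hs hδ

end NormPrime

/-! ### Finiteness of the number of classes of optimal embeddings -/

section Reduction

variable {α β : ℚ}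

/-- Simultaneous Diophantine approximation. -/
theorem exists_simultaneous_approx {ι : Type*} [Fintype ι] {M : ℕ} (hM : 0 < M) (x : ι → ℚ) :
    ∃ k : ℕ, 0 < k ∧ k ≤ M ^ Fintype.card ι ∧ ∃ z : ι → ℤ, ∀ i, |k * x i - z i| < 1 / M := by
  classical
  have hM' : (0 : ℚ) < M := by exact_mod_cast hM
  let f : ℕ → ι → Finset.Ico (0 : ℤ) M := fun k i => ⟨⌊(M : ℚ) * Int.fract (k * x i)⌋, by
    rw [Finset.mem_Ico]
    refine ⟨Int.floor_nonneg.2 (mul_nonneg hM'.le (Int.fract_nonneg _)), Int.floor_lt.2 ?_⟩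
    have := Int.fract_lt_one ((k : ℚ) * x i)
    push_cast
    nlinarith⟩
  have hcard : (Finset.univ : Finset (ι → Finset.Ico (0 : ℤ) M)).card <
      (Finset.range (M ^ Fintype.card ι + 1)).card := by
    simp
  obtain ⟨k, hk, k', hk', hne, hf⟩ := Finset.exists_ne_map_eq_of_card_lt_of_maps_to hcard
    (f := f) (fun _ _ => Finset.mem_univ _)
  wlog hlt : k < k' generalizing k k'
  · exact this k' hk' k hk hne.symm hf.symm (lt_of_le_of_ne (not_lt.1 hlt) hne.symm)
  rw [Finset.mem_range] at hk'
  refine ⟨k' - k, by omega, by omega, fun i => ⌊(k' : ℚ) * x i⌋ - ⌊(k : ℚ) * x i⌋, fun i => ?_⟩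
  have h1 := Int.abs_sub_lt_one_of_floor_eq_floor (congrArg Subtype.val (congrFun hf i)).symm
  rw [← mul_sub, abs_mul, abs_of_pos hM'] at h1
  rw [lt_div_iff₀' hM']
  have e : ((k' - k : ℕ) : ℚ) * x i - ((⌊(k' : ℚ) * x i⌋ - ⌊(k : ℚ) * x i⌋ : ℤ) : ℚ) =
      Int.fract (k' * x i) - Int.fract (k * x i) := by
    rw [← Int.self_sub_floor, ← Int.self_sub_floor]
    push_cast [Nat.cast_sub hlt.le]
    ring
  rw [e]
  exact h1

/-- An order in a definite quaternion algebra is euclidean up to a bounded denominator. -/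
theorem IsOrder.exists_bounded_euclidean (hα : α < 0) (hβ : β < 0) {O : Subring ℍ[ℚ,α,β]}
    (hO : IsOrder O) : ∃ n : ℕ, ∀ x : ℍ[ℚ,α,β], ∃ k : ℕ, 0 < k ∧ k ≤ n ∧
      ∃ o ∈ O, reducedNorm ((k : ℚ) • x - o) < 1 := by
  obtain ⟨c, hc, hcO⟩ := hO.exists_smul_intCoord_mem
  have hc' : (0 : ℚ) < c := by exact_mod_cast hc
  obtain ⟨M, hM⟩ := exists_nat_gt ((1 - α) * (1 - β) * c ^ 2)
  have hM0 : (0 : ℚ) < M := lt_trans (by have := sub_pos.2 (hα.trans one_pos)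
                                         have := sub_pos.2 (hβ.trans one_pos)
                                         positivity) hM
  have hM1 : (1 : ℚ) ≤ M := by
    have : 0 < M := by exact_mod_cast hM0
    exact_mod_cast this
  refine ⟨M ^ 4, fun x => ?_⟩
  obtain ⟨k, hk, hkM, z, hz⟩ := exists_simultaneous_approx (M := M) (by exact_mod_cast hM0)
    ![x.re / c, x.imI / c, x.imJ / c, x.imK / c]
  refine ⟨k, hk, by simpa using hkM, (c : ℚ) • ⟨z 0, z 1, z 2, z 3⟩,
    hcO _ ⟨z 0, z 1, z 2, z 3, rfl⟩, ?_⟩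
  have hsq : ∀ t : ℚ, ∀ j : ℤ, |k * (t / c) - j| < 1 / M → (k * t - c * j) ^ 2 ≤ c ^ 2 / M ^ 2 := by
    intro t j h
    have e : k * t - c * j = c * (k * (t / c) - j) := by field_simp
    have h' := pow_le_pow_left₀ (abs_nonneg _) h.le 2
    rw [e, mul_pow, ← sq_abs (k * (t / c) - j)]
    calc (c : ℚ) ^ 2 * |k * (t / c) - j| ^ 2 ≤ (c : ℚ) ^ 2 * (1 / M) ^ 2 := by gcongr
      _ = (c : ℚ) ^ 2 / (M : ℚ) ^ 2 := by rw [one_div_pow, mul_one_div]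
  have h0 := hsq _ _ (by simpa using hz 0)
  have h1 := hsq _ _ (by simpa using hz 1)
  have h2 := hsq _ _ (by simpa using hz 2)
  have h3 := hsq _ _ (by simpa using hz 3)
  have hlt : (1 - α) * (1 - β) * (c ^ 2 / M ^ 2) < 1 := by
    rw [← mul_div_assoc, div_lt_one (by positivity)]
    nlinarith
  have hab : 0 < α * β := mul_pos_of_neg_of_neg hα hβ
  refine lt_of_le_of_lt ?_ hlt
  simp only [reducedNorm, QuaternionAlgebra.re_sub, QuaternionAlgebra.imI_sub,
    QuaternionAlgebra.imJ_sub, QuaternionAlgebra.imK_sub, QuaternionAlgebra.re_smul,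
    QuaternionAlgebra.imI_smul, QuaternionAlgebra.imJ_smul, QuaternionAlgebra.imK_smul,
    smul_eq_mul]
  have e1 := mul_le_mul_of_nonneg_left h1 (neg_pos.2 hα).le
  have e2 := mul_le_mul_of_nonneg_left h2 (neg_pos.2 hβ).le
  have e3 := mul_le_mul_of_nonneg_left h3 hab.le
  linarith

theorem IsOrder.finite_reducedNorm_eq (hα : α < 0) (hβ : β < 0) {O : Subring ℍ[ℚ,α,β]}
    (hO : IsOrder O) (r : ℚ) : {x : ℍ[ℚ,α,β] | x ∈ O ∧ reducedNorm x = r}.Finite := by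
  obtain ⟨n, hn, hnO⟩ := hO.exists_intCoord
  have hn0 : (n : ℚ) ≠ 0 := by exact_mod_cast hn.ne'
  have hab : 0 < α * β := mul_pos_of_neg_of_neg hα hβ
  have hbd : ∀ A : ℚ, 0 < A → ∃ B : ℤ, ∀ t : ℤ, A * (t : ℚ) ^ 2 ≤ n ^ 2 * r → -B ≤ t ∧ t ≤ B := by
    intro A hA
    obtain ⟨B, hB⟩ := exists_nat_ge (n ^ 2 * r / A)
    refine ⟨B, fun t ht => ?_⟩
    have h1 : (t : ℚ) ^ 2 ≤ B := ((le_div_iff₀' hA).2 ht).trans hB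
    have h2 : t ^ 2 ≤ B := by exact_mod_cast h1
    have h3 := Int.le_self_sq t
    have h4 := Int.le_self_sq (-t)
    rw [neg_sq] at h4
    constructor <;> linarith
  obtain ⟨B₀, h₀⟩ := hbd 1 one_pos
  obtain ⟨B₁, h₁⟩ := hbd (-α) (neg_pos.2 hα)
  obtain ⟨B₂, h₂⟩ := hbd (-β) (neg_pos.2 hβ)
  obtain ⟨B₃, h₃⟩ := hbd (α * β) hab
  let f : ℤ × ℤ × ℤ × ℤ → ℍ[ℚ,α,β] := fun v => (n : ℚ)⁻¹ • ⟨v.1, v.2.1, v.2.2.1, v.2.2.2⟩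
  refine ((Set.finite_Icc (-B₀, -B₁, -B₂, -B₃) (B₀, B₁, B₂, B₃)).image f).subset ?_
  rintro x ⟨hx, hxr⟩
  obtain ⟨a, b, e, g, h⟩ := hnO x hx
  refine ⟨(a, b, e, g), ?_, ?_⟩
  · have hnorm : reducedNorm ((n : ℚ) • x) = n ^ 2 * r := by rw [reducedNorm_smul, hxr]
    rw [h] at hnorm
    simp only [reducedNorm] at hnorm
    have k0 := sq_nonneg (a : ℚ)
    have k1 := mul_nonneg (neg_pos.2 hα).le (sq_nonneg (b : ℚ))
    have k2 := mul_nonneg (neg_pos.2 hβ).le (sq_nonneg (e : ℚ))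
    have k3 := mul_nonneg hab.le (sq_nonneg (g : ℚ))
    have l0 := h₀ a (by linarith)
    have l1 := h₁ b (by linarith)
    have l2 := h₂ e (by linarith)
    have l3 := h₃ g (by linarith)
    exact ⟨⟨l0.1, l1.1, l2.1, l3.1⟩, ⟨l0.2, l1.2, l2.2, l3.2⟩⟩
  · simp only [f]
    rw [← h, smul_smul, inv_mul_cancel₀ hn0, one_smul]

/-- An order has finitely many residue classes modulo a positive integer. -/
theorem IsOrder.exists_finite_coloring {O : Subring ℍ[ℚ,α,β]} (hO : IsOrder O) {F : ℕ}
    (hF : 0 < F) : ∃ (T : Type) (_ : Finite T) (χ : ℍ[ℚ,α,β] → T), ∀ x ∈ O, ∀ y ∈ O,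
      χ x = χ y → ∃ o ∈ O, x - y = (F : ℚ) • o := by
  obtain ⟨n, hn, hnO⟩ := hO.exists_intCoord
  obtain ⟨c, hc, hcO⟩ := hO.exists_smul_intCoord_mem
  set D := n * F * c with hD
  have : NeZero D := ⟨by positivity⟩
  let r : ℚ → ZMod D := fun q => (⌊(n : ℚ) * q⌋ : ZMod D)
  refine ⟨ZMod D × ZMod D × ZMod D × ZMod D, inferInstance,
    fun x => (r x.re, r x.imI, r x.imJ, r x.imK), fun x hx y hy hxy => ?_⟩
  obtain ⟨a, b, e, g, h⟩ := hnO x hx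
  obtain ⟨a', b', e', g', h'⟩ := hnO y hy
  have hco : ∀ (s t : ℚ) (i j : ℤ), (n : ℚ) * s = i → (n : ℚ) * t = j → r s = r t →
      ∃ k : ℤ, s - t = F * (c * k) := by
    intro s t i j hi hj hr
    simp only [r, hi, hj, Int.floor_intCast] at hr
    obtain ⟨k, hk⟩ := (ZMod.intCast_eq_intCast_iff_dvd_sub _ _ _).1 hr.symm
    refine ⟨k, ?_⟩
    have hn0 : (n : ℚ) ≠ 0 := by exact_mod_cast hn.ne'
    refine mul_left_cancel₀ hn0 ?_
    have hk' : (i : ℚ) - j = D * k := by exact_mod_cast hk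
    rw [mul_sub, hi, hj, hk', hD]
    push_cast; ring
  simp only [Prod.mk.injEq] at hxy
  obtain ⟨k0, h0⟩ := hco x.re y.re a a' (by simpa using congrArg QuaternionAlgebra.re h)
    (by simpa using congrArg QuaternionAlgebra.re h') hxy.1
  obtain ⟨k1, h1⟩ := hco x.imI y.imI b b' (by simpa using congrArg QuaternionAlgebra.imI h)
    (by simpa using congrArg QuaternionAlgebra.imI h') hxy.2.1
  obtain ⟨k2, h2⟩ := hco x.imJ y.imJ e e' (by simpa using congrArg QuaternionAlgebra.imJ h)
    (by simpa using congrArg QuaternionAlgebra.imJ h') hxy.2.2.1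
  obtain ⟨k3, h3⟩ := hco x.imK y.imK g g' (by simpa using congrArg QuaternionAlgebra.imK h)
    (by simpa using congrArg QuaternionAlgebra.imK h') hxy.2.2.2
  refine ⟨(c : ℚ) • ⟨k0, k1, k2, k3⟩, hcO _ ⟨k0, k1, k2, k3, rfl⟩, ?_⟩
  ext <;> simp [h0, h1, h2, h3]

/-- Class-number finiteness: with a bounded denominator `F`, the right `O`-module `O + y O`
generated by `1` and `y` is principal, generated by an element `a` of minimal norm. -/
theorem IsOrder.exists_bounded_conjugate {p : ℕ} (hp : p ≠ 0) (hα : α < 0) (hβ : β < 0)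
    {O : Subring ℍ[ℚ,α,β]} (hO : IsOrder O) : ∃ F : ℕ, 0 < F ∧ ∀ y ∈ invertPrime p O, ∀ e : ℤ,
      y * y = (e : ℚ) • 1 → ∃ a : (ℍ[ℚ,α,β])ˣ, (a : ℍ[ℚ,α,β]) ∈ invertPrime p O ∧
        (F : ℚ) • (↑a⁻¹ : ℍ[ℚ,α,β]) ∈ O ∧ (F : ℚ) • (↑a⁻¹ * y * a : ℍ[ℚ,α,β]) ∈ O := by
  obtain ⟨n, hn⟩ := hO.exists_bounded_euclidean hα hβ
  refine ⟨n.factorial, n.factorial_pos, fun y hy e hye => ?_⟩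
  obtain ⟨k, hk⟩ := mem_invertPrime.1 hy
  have hpk : (p : ℚ) ^ k ≠ 0 := pow_ne_zero _ (by exact_mod_cast hp)
  let I : AddSubgroup ℍ[ℚ,α,β] :=
    { carrier := {x | ∃ o ∈ O, ∃ o' ∈ O, x = o + y * o'}
      zero_mem' := ⟨0, O.zero_mem, 0, O.zero_mem, by simp⟩
      add_mem' := by
        rintro _ _ ⟨o, ho, o', ho', rfl⟩ ⟨u, hu, u', hu', rfl⟩
        exact ⟨o + u, O.add_mem ho hu, o' + u', O.add_mem ho' hu', by rw [mul_add]; abel⟩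
      neg_mem' := by
        rintro _ ⟨o, ho, o', ho', rfl⟩
        exact ⟨-o, O.neg_mem ho, -o', O.neg_mem ho', by rw [mul_neg]; abel⟩ }
  have hI1 : (1 : ℍ[ℚ,α,β]) ∈ I := ⟨1, O.one_mem, 0, O.zero_mem, by simp⟩
  have hImul : ∀ x ∈ I, ∀ o ∈ O, x * o ∈ I := by
    rintro _ ⟨o, ho, o', ho', rfl⟩ u hu
    exact ⟨o * u, O.mul_mem ho hu, o' * u, O.mul_mem ho' hu, by rw [add_mul, mul_assoc]⟩
  have hyI : ∀ x ∈ I, y * x ∈ I := by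
    rintro _ ⟨o, ho, o', ho', rfl⟩
    refine ⟨(e : ℍ[ℚ,α,β]) * o', O.mul_mem (intCast_mem _ e) ho', o, ho, ?_⟩
    rw [mul_add, ← mul_assoc, hye, add_comm, smul_mul_assoc, one_mul, Int.cast_smul_eq_zsmul,
      zsmul_eq_mul]
  have hIR : ∀ x ∈ I, (p : ℚ) ^ k • x ∈ O := by
    rintro _ ⟨o, ho, o', ho', rfl⟩
    rw [smul_add, ← smul_mul_assoc]
    refine O.add_mem ?_ (O.mul_mem hk ho')
    have : (p : ℚ) ^ k • o = ((p ^ k : ℕ) : ℍ[ℚ,α,β]) * o := by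
      rw [← nsmul_eq_mul, ← Nat.cast_smul_eq_nsmul ℚ]; push_cast; rfl
    rw [this]
    exact O.mul_mem (natCast_mem _ _) ho
  -- an element of `I` of minimal norm
  obtain ⟨a, haI, ha0, hmin⟩ : ∃ a ∈ I, a ≠ 0 ∧ ∀ x ∈ I, x ≠ 0 → reducedNorm a ≤ reducedNorm x := by
    have hnat : ∀ x ∈ I, ∃ z : ℕ, reducedNorm ((p : ℚ) ^ k • x) = z := by
      intro x hx
      obtain ⟨z, hz⟩ := hO.exists_reducedNorm_eq (hIR x hx)
      have h0 : 0 ≤ z := by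
        have := reducedNorm_nonneg hα hβ ((p : ℚ) ^ k • x)
        rw [hz] at this
        exact_mod_cast this
      lift z to ℕ using h0
      exact ⟨z, by exact_mod_cast hz⟩
    let S : Set ℕ := {z | ∃ x ∈ I, x ≠ 0 ∧ reducedNorm ((p : ℚ) ^ k • x) = z}
    have hS : S.Nonempty := by
      obtain ⟨z, hz⟩ := hnat 1 hI1
      exact ⟨z, 1, hI1, one_ne_zero, hz⟩
    obtain ⟨a, ha, ha0, haz⟩ :
        ∃ x ∈ I, x ≠ 0 ∧ reducedNorm ((p : ℚ) ^ k • x) = (sInf S : ℕ) := Nat.sInf_mem hS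
    refine ⟨a, ha, ha0, fun x hx hx0 => ?_⟩
    obtain ⟨z, hz⟩ := hnat x hx
    have hle : ((sInf S : ℕ) : ℚ) ≤ z := by
      exact_mod_cast Nat.sInf_le (show z ∈ S from ⟨x, hx, hx0, hz⟩)
    rw [← haz, ← hz, reducedNorm_smul, reducedNorm_smul] at hle
    exact le_of_mul_le_mul_left hle (by positivity)
  have hna : 0 < reducedNorm a := reducedNorm_pos hα hβ ha0
  let u := unitOfNorm a hna.ne'
  have hu : (u : ℍ[ℚ,α,β]) = a := rfl
  -- the factor `n!` carries `a⁻¹ I` into `O`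
  have key : ∀ x ∈ I, (n.factorial : ℚ) • (↑u⁻¹ * x : ℍ[ℚ,α,β]) ∈ O := by
    intro x hx
    obtain ⟨j, hj, hjn, o, ho, hlt⟩ := hn (↑u⁻¹ * x)
    have hmem : (j : ℚ) • x - a * o ∈ I := by
      refine I.sub_mem ?_ (hImul a haI o ho)
      rw [Nat.cast_smul_eq_nsmul]
      exact I.nsmul_mem hx j
    have hfac : (j : ℚ) • x - a * o = a * ((j : ℚ) • (↑u⁻¹ * x) - o) := by
      rw [mul_sub, mul_smul_comm, ← mul_assoc, ← hu, Units.mul_inv, one_mul]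
    have hz : (j : ℚ) • x - a * o = 0 := by
      by_contra h0
      have := hmin _ hmem h0
      rw [hfac, reducedNorm_mul] at this
      nlinarith
    have hjx : (j : ℚ) • (↑u⁻¹ * x : ℍ[ℚ,α,β]) = o := by
      rw [hfac, ← hu, Units.mul_right_eq_zero] at hz
      exact sub_eq_zero.1 hz
    obtain ⟨i, hi⟩ := Nat.dvd_factorial hj hjn
    rw [hi, mul_comm, Nat.cast_mul, mul_smul, hjx, Nat.cast_smul_eq_nsmul]
    exact O.nsmul_mem ho i
  refine ⟨u, ?_, ?_, ?_⟩
  · exact mem_invertPrime.2 ⟨k, hIR a haI⟩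
  · simpa using key 1 hI1
  · rw [mul_assoc]; exact key _ (hyI a haI)

end Reduction

section Finiteness

variable {α β : ℚ} {p : ℕ} [Fact p.Prime] {K : Type*} [Field K] [Algebra ℚ K]

theorem exists_eq_add_mul {s : K} {d : ℤ} (hs : s ^ 2 = (d : K))
    (hgen : IntermediateField.adjoin ℚ {s} = ⊤) (x : K) :
    ∃ a b : ℚ, x = algebraMap ℚ K a + algebraMap ℚ K b * s := by
  have hint : IsIntegral ℚ s := by
    refine IsIntegral.of_pow two_pos ?_
    rw [hs, ← map_intCast (algebraMap ℚ K)]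
    exact isIntegral_algebraMap
  have hx : x ∈ Algebra.adjoin ℚ {s} := by
    rw [← IntermediateField.adjoin_simple_toSubalgebra_of_isAlgebraic hint.isAlgebraic, hgen]
    trivial
  induction hx using Algebra.adjoin_induction with
  | mem x hx => exact ⟨0, 1, by rw [Set.mem_singleton_iff.1 hx]; simp⟩
  | algebraMap r => exact ⟨r, 0, by simp⟩
  | add x y _ _ hx hy =>
    obtain ⟨a, b, rfl⟩ := hx
    obtain ⟨a', b', rfl⟩ := hy
    exact ⟨a + a', b + b', by rw [map_add, map_add]; ring⟩
  | mul x y _ _ hx hy =>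
    obtain ⟨a, b, rfl⟩ := hx
    obtain ⟨a', b', rfl⟩ := hy
    refine ⟨a * a' + b * b' * d, a * b' + b * a', ?_⟩
    simp only [map_add, map_mul, map_intCast]
    linear_combination (algebraMap ℚ K b * algebraMap ℚ K b') * hs

theorem mul_mem_conductorOrder {K : Type*} [Field K] {s : K} {d : ℤ} (hs : s ^ 2 = (d : K)) (m : ℕ) :
    (m : K) * s ∈ conductorOrder K m := by
  refine ⟨0, s, ?_, by simp⟩
  change IsIntegral ℤ s
  refine IsIntegral.of_pow two_pos ?_
  rw [hs, ← map_intCast (algebraMap ℤ K)]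
  exact isIntegral_algebraMap

theorem OptimalEmbedding.apply_mem {A : Type*} [Ring A] [Algebra ℚ A] {R : Subring K}
    {S : Subring A} (φ : OptimalEmbedding R S) {x : K} (hx : x ∈ R) : φ.1 x ∈ S :=
  ((φ.2 ▸ Set.mem_image_of_mem φ.1 hx : φ.1 x ∈ (S : Set A) ∩ Set.range φ.1)).1

/-- An embedding `φ` is recorded by the conjugate of `y = φ(m s)` by an element `a` of minimal norm in
`O + y O`, by the class of `a⁻¹` modulo `O`, and by the parity of the valuation of the norm of `a`; two
embeddings with the same record are conjugate under `O[1/p]^*_+`. -/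
theorem finite_quotient_embeddingSetoid (hα : α < 0) (hβ : β < 0) {O : Subring ℍ[ℚ,α,β]}
    (hO : IsOrder O) {s : K} {d : ℤ} (hs : s ^ 2 = (d : K))
    (hgen : IntermediateField.adjoin ℚ {s} = ⊤) {m : ℕ} (hm : 0 < m) :
    Finite (Quotient (embeddingSetoid (invertPrime p (conductorOrder K m)) (invertPrime p O)
      (unitsPlus p (invertPrime p O)))) := by
  obtain ⟨F, hF, hred⟩ := hO.exists_bounded_conjugate (Fact.out : p.Prime).ne_zero hα hβ
  obtain ⟨T, hT, χ, hχ⟩ := hO.exists_finite_coloring hF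
  have hF0 : (F : ℚ) ≠ 0 := by exact_mod_cast hF.ne'
  set X := OptimalEmbedding (invertPrime p (conductorOrder K m)) (invertPrime p O) with hX
  let y : X → ℍ[ℚ,α,β] := fun φ => φ.1 ((m : K) * s)
  have hy : ∀ φ : X, y φ ∈ invertPrime p O := fun φ =>
    φ.apply_mem (le_invertPrime p _ (mul_mem_conductorOrder hs m))
  have hyy : ∀ φ : X, y φ * y φ = ((m ^ 2 * d : ℤ) : ℚ) • 1 := by
    intro φ
    simp only [y]
    rw [← map_mul, show (m : K) * s * ((m : K) * s) = ((m ^ 2 * d : ℤ) : K) by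
      push_cast; linear_combination (m : K) ^ 2 * hs, map_intCast, Int.cast_smul_eq_zsmul,
      zsmul_one]
  choose a haR haF hyF using fun φ : X => hred (y φ) (hy φ) _ (hyy φ)
  have hnF : ∀ φ : X, reducedNorm ((F : ℚ) • (↑(a φ)⁻¹ * y φ * a φ : ℍ[ℚ,α,β])) ^ 2 =
      ((F : ℚ) ^ 4 * (m ^ 2 * d : ℤ) ^ 2) := by
    intro φ
    have h1 := congrArg reducedNorm (hyy φ)
    rw [reducedNorm_mul, reducedNorm_smul_one] at h1
    have h2 := reducedNorm_mul_inv (a φ)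
    rw [reducedNorm_smul, reducedNorm_mul, reducedNorm_mul]
    linear_combination (F : ℚ) ^ 4 * h1 + (F : ℚ) ^ 4 * reducedNorm (y φ) ^ 2 *
      (reducedNorm (a φ : ℍ[ℚ,α,β]) * reducedNorm (↑(a φ)⁻¹ : ℍ[ℚ,α,β]) + 1) * h2
  set c : ℚ := (F : ℚ) ^ 4 * (m ^ 2 * d : ℤ) ^ 2 with hc
  let Y : Set ℍ[ℚ,α,β] := {x | x ∈ O ∧ reducedNorm x ^ 2 = c}
  have hYfin : Finite Y := by
    by_cases hsq : ∃ r : ℚ, r ^ 2 = c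
    · obtain ⟨r, hr⟩ := hsq
      refine Set.Finite.subset ((hO.finite_reducedNorm_eq hα hβ r).union
        (hO.finite_reducedNorm_eq hα hβ (-r))) ?_
      rintro x ⟨hx, hxc⟩
      rw [← hr] at hxc
      rcases sq_eq_sq_iff_eq_or_eq_neg.1 hxc with h | h
      · exact Or.inl ⟨hx, h⟩
      · exact Or.inr ⟨hx, h⟩
    · exact Set.Finite.subset Set.finite_empty fun x hx => hsq ⟨_, hx.2⟩
  let inv : X → Y × T × ZMod 2 := fun φ =>
    (⟨(F : ℚ) • (↑(a φ)⁻¹ * y φ * a φ : ℍ[ℚ,α,β]), hyF φ, hnF φ⟩,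
      χ ((F : ℚ) • (↑(a φ)⁻¹ : ℍ[ℚ,α,β])), (padicValRat p (reducedNorm (a φ : ℍ[ℚ,α,β])) : ZMod 2))
  -- embeddings with the same invariants are conjugate
  have hinv : ∀ φ ψ : X, inv φ = inv ψ → (embeddingSetoid _ _ (unitsPlus p (invertPrime p O))) φ ψ := by
    intro φ ψ h
    simp only [inv, Prod.mk.injEq, Subtype.mk.injEq] at h
    obtain ⟨h1, h2, h3⟩ := h
    replace h1 : (↑(a φ)⁻¹ * y φ * a φ : ℍ[ℚ,α,β]) = ↑(a ψ)⁻¹ * y ψ * a ψ :=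
      smul_right_injective _ hF0 h1
    obtain ⟨o, ho, h2⟩ := hχ _ (haF φ) _ (haF ψ) h2
    rw [← smul_sub] at h2
    replace h2 : (↑(a φ)⁻¹ : ℍ[ℚ,α,β]) - ↑(a ψ)⁻¹ = o := smul_right_injective _ hF0 h2
    have hoR := le_invertPrime p O ho
    refine ⟨a φ * (a ψ)⁻¹, ⟨?_, ?_, ?_⟩, ?_⟩
    · have : ((a φ * (a ψ)⁻¹ : (ℍ[ℚ,α,β])ˣ) : ℍ[ℚ,α,β]) = 1 - a φ * o := by
        rw [← h2, mul_sub, Units.mul_inv, Units.val_mul]; abel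
      rw [this]
      exact Subring.sub_mem _ (Subring.one_mem _) (Subring.mul_mem _ (haR φ) hoR)
    · have : (((a φ * (a ψ)⁻¹)⁻¹ : (ℍ[ℚ,α,β])ˣ) : ℍ[ℚ,α,β]) = 1 + a ψ * o := by
        rw [← h2, mul_sub, Units.mul_inv, mul_inv_rev, inv_inv, Units.val_mul]; abel
      rw [this]
      exact Subring.add_mem _ (Subring.one_mem _) (Subring.mul_mem _ (haR ψ) hoR)
    · have h4 := reducedNorm_mul_inv (a ψ)
      rw [Units.val_mul, reducedNorm_mul, padicValRat.mul (reducedNorm_unit_ne_zero _)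
        (reducedNorm_unit_ne_zero _), eq_inv_of_mul_eq_one_right h4, padicValRat.inv,
        even_iff_two_dvd, ← Nat.cast_two, ← ZMod.intCast_zmod_eq_zero_iff_dvd]
      push_cast
      rw [h3, add_neg_cancel]
    · have hconj : y ψ = (↑(a φ * (a ψ)⁻¹)⁻¹ : ℍ[ℚ,α,β]) * y φ * ↑(a φ * (a ψ)⁻¹) := by
        have : (a ψ : ℍ[ℚ,α,β]) * (↑(a ψ)⁻¹ * y ψ * a ψ) * ↑(a ψ)⁻¹ = y ψ := by
          simp [mul_assoc]
        rw [← this, ← h1]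
        simp [mul_assoc]
      set g := a φ * (a ψ)⁻¹
      have hm0 : (m : ℚ) ≠ 0 := by exact_mod_cast hm.ne'
      have hsy : ∀ φ : X, φ.1 s = (m : ℚ)⁻¹ • y φ := by
        intro φ
        simp only [y]
        rw [← map_smul]
        congr 1
        rw [Algebra.smul_def, map_inv₀, map_natCast, inv_mul_cancel_left₀]
        have := (algebraMap ℚ K).injective.ne hm0
        simpa using this
      intro x
      obtain ⟨b, e, rfl⟩ := exists_eq_add_mul hs hgen x
      have hlin : ∀ φ : X, φ.1 (algebraMap ℚ K b + algebraMap ℚ K e * s) =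
          b • 1 + (e * (m : ℚ)⁻¹) • y φ := fun φ => by
        rw [map_add, map_mul, AlgHom.commutes, AlgHom.commutes, hsy,
          Algebra.algebraMap_eq_smul_one, Algebra.algebraMap_eq_smul_one, smul_mul_assoc, one_mul,
          smul_smul]
      rw [hlin, hlin, hconj, mul_add, add_mul, mul_smul_comm, mul_smul_comm, smul_mul_assoc,
        smul_mul_assoc, mul_one, Units.inv_mul]
  refine Finite.of_injective (fun q : Quotient _ => inv q.out) fun q q' h => ?_
  rw [← Quotient.out_eq q, ← Quotient.out_eq q']
  exact Quotient.sound (hinv _ _ h)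

end Finiteness

/-! ### Norms from the unramified quadratic extension -/

section Inert

variable {p : ℕ} [Fact p.Prime] {L : Type*} [Field L] [Algebra ℚ_[p] L] [Algebra ℤ_[p] L]
  [IsScalarTower ℤ_[p] ℚ_[p] L]

theorem isRadical_map_maximalIdeal_of_unramified [FiniteDimensional ℚ_[p] L]
    (hL : Algebra.FormallyUnramified ℤ_[p] (integralClosure ℤ_[p] L)) :
    (Ideal.span {(p : integralClosure ℤ_[p] L)}).IsRadical := by
  have : Module.Finite ℤ_[p] (integralClosure ℤ_[p] L) :=
    IsIntegralClosure.finite ℤ_[p] ℚ_[p] L (integralClosure ℤ_[p] L)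
  have h := Algebra.FormallyUnramified.isRadical_map_isMaximal ℤ_[p]
    (integralClosure ℤ_[p] L) (IsLocalRing.maximalIdeal ℤ_[p])
  rwa [PadicInt.maximalIdeal_eq_span_p, Ideal.map_span, Set.image_singleton, map_natCast] at h

/-- In an unramified extension, no element is a root of an Eisenstein polynomial of degree two. -/
theorem false_of_eisenstein [FiniteDimensional ℚ_[p] L]
    (hL : Algebra.FormallyUnramified ℤ_[p] (integralClosure ℤ_[p] L)) {t n : ℤ_[p]}
    (hn : ‖n‖ = 1) {x : L}
    (hx : x ^ 2 = (p : L) * (algebraMap ℤ_[p] L t * x - algebraMap ℤ_[p] L n)) : False := by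
  have hxint : IsIntegral ℤ_[p] x := by
    refine ⟨Polynomial.X ^ 2 + Polynomial.C (-(p * t)) * Polynomial.X + Polynomial.C (p * n),
      by monicity!, ?_⟩
    simp only [Polynomial.eval₂_add, Polynomial.eval₂_mul, Polynomial.eval₂_pow,
      Polynomial.eval₂_X, Polynomial.eval₂_C]
    simp only [map_neg, map_mul, map_natCast]
    linear_combination hx
  let x' : integralClosure ℤ_[p] L := ⟨x, hxint⟩
  have hx' : x' ^ 2 = (p : integralClosure ℤ_[p] L) *
      (algebraMap ℤ_[p] _ t * x' - algebraMap ℤ_[p] _ n) := by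
    apply Subtype.ext
    push_cast
    exact hx
  have hmem : x' ∈ Ideal.span {(p : integralClosure ℤ_[p] L)} :=
    isRadical_map_maximalIdeal_of_unramified hL
      ⟨2, Ideal.mem_span_singleton.2 ⟨_, hx'⟩⟩
  obtain ⟨y, hy⟩ := Ideal.mem_span_singleton.1 hmem
  have hp0 : (p : L) ≠ 0 := by
    have : ((p : ℚ_[p])) ≠ 0 := by exact_mod_cast (Fact.out : p.Prime).ne_zero
    have := (algebraMap ℚ_[p] L).injective.ne this
    simpa using this
  have hxy : x = p * y.1 := by
    have := congrArg Subtype.val hy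
    exact this
  have key : algebraMap ℤ_[p] L n = p * (algebraMap ℤ_[p] L t * y.1 - y.1 ^ 2) := by
    refine mul_left_cancel₀ hp0 ?_
    rw [hxy] at hx
    linear_combination hx
  have hint : IsIntegral ℤ_[p] ((n : ℚ_[p]) / p) := by
    refine (isIntegral_algebraMap_iff (algebraMap ℚ_[p] L).injective).1 ?_
    have e : algebraMap ℚ_[p] L ((n : ℚ_[p]) / p) = algebraMap ℤ_[p] L t * y.1 - y.1 ^ 2 := by
      rw [map_div₀, map_natCast, div_eq_iff hp0, mul_comm, ← key,
        IsScalarTower.algebraMap_apply ℤ_[p] ℚ_[p] L]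
      rfl
    rw [e]
    exact (isIntegral_algebraMap.mul y.2).sub (IsIntegral.pow y.2 2)
  obtain ⟨z, hz⟩ := IsIntegrallyClosed.isIntegral_iff.1 hint
  have hz' : ‖(n : ℚ_[p]) / p‖ ≤ 1 := by
    rw [← hz]; exact PadicInt.norm_le_one z
  rw [norm_div, PadicInt.padic_norm_e_of_padicInt, hn, Padic.norm_p, one_div, inv_inv] at hz'
  have : (1 : ℝ) < p := by exact_mod_cast (Fact.out : p.Prime).one_lt
  linarith

/-- The prime `p` is inert in a quadratic field whose completion at `p` is unramified: norms from
it have even valuation. -/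
theorem even_padicValRat_norm [FiniteDimensional ℚ_[p] L]
    (hL : Algebra.FormallyUnramified ℤ_[p] (integralClosure ℤ_[p] L)) {θ : L} {d : ℤ}
    (hθ : θ ^ 2 = (d : L)) (hθ' : θ ∉ Set.range (algebraMap ℚ_[p] L)) {a b : ℚ}
    (hab : a ^ 2 - d * b ^ 2 ≠ 0) : Even (padicValRat p (a ^ 2 - d * b ^ 2)) := by
  by_contra hodd
  rw [Int.not_even_iff_odd] at hodd
  obtain ⟨k, hk⟩ := hodd
  have hp := (Fact.out : p.Prime)
  have hp1 : (1 : ℝ) < p := by exact_mod_cast hp.one_lt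
  have hpq : (p : ℚ) ≠ 0 := by exact_mod_cast hp.ne_zero
  have hpp : (p : ℚ_[p]) ≠ 0 := by exact_mod_cast hp.ne_zero
  set c : ℚ := (p : ℚ) ^ (-k) with hc
  have hc0 : c ≠ 0 := zpow_ne_zero _ hpq
  -- after scaling, the norm has valuation one
  set n : ℚ_[p] := (((c * a) ^ 2 - d * (c * b) ^ 2 : ℚ) : ℚ_[p]) with hn
  set t : ℚ_[p] := ((2 * (c * a) : ℚ) : ℚ_[p]) with ht
  have hnorm : ‖n‖ = (p : ℝ)⁻¹ := by
    have e : (c * a) ^ 2 - d * (c * b) ^ 2 = c ^ 2 * (a ^ 2 - d * b ^ 2) := by ring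
    rw [hn, e, Padic.eq_padicNorm, padicNorm.eq_zpow_of_nonzero (mul_ne_zero (pow_ne_zero 2 hc0) hab),
      padicValRat.mul (pow_ne_zero 2 hc0) hab, padicValRat.pow, hk, hc, padicValRat.zpow,
      padicValRat.self hp.one_lt]
    push_cast
    rw [← zpow_neg_one]
    congr 1
    ring
  set x : L := algebraMap ℚ_[p] L ((c * a : ℚ) : ℚ_[p]) +
    algebraMap ℚ_[p] L ((c * b : ℚ) : ℚ_[p]) * θ with hx
  have hx2 : x ^ 2 = algebraMap ℚ_[p] L t * x - algebraMap ℚ_[p] L n := by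
    rw [hx, ht, hn]
    push_cast
    simp only [map_intCast, map_ofNat]
    linear_combination ((c : L) * b) ^ 2 * hθ
  rcases lt_or_ge ‖n‖ (‖t‖ ^ 2) with hlt | hge
  · obtain ⟨r, hr⟩ := exists_quadratic_root hlt
    have hfac : (x - algebraMap ℚ_[p] L r) * (x - algebraMap ℚ_[p] L (t - r)) = 0 := by
      have := congrArg (algebraMap ℚ_[p] L) hr
      simp only [map_add, map_sub, map_mul, map_pow, map_zero] at this
      rw [map_sub]
      linear_combination hx2 - this
    have hxr : ∃ r' : ℚ_[p], x = algebraMap ℚ_[p] L r' := by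
      rcases mul_eq_zero.1 hfac with h | h
      · exact ⟨r, sub_eq_zero.1 h⟩
      · exact ⟨t - r, sub_eq_zero.1 h⟩
    obtain ⟨r', hr'⟩ := hxr
    have hb : b = 0 := by
      by_contra hb
      have hcb : ((c * b : ℚ) : ℚ_[p]) ≠ 0 := by exact_mod_cast mul_ne_zero hc0 hb
      have hcb' : algebraMap ℚ_[p] L ((c * b : ℚ) : ℚ_[p]) ≠ 0 := by
        simpa using (algebraMap ℚ_[p] L).injective.ne hcb
      refine hθ' ⟨(r' - ((c * a : ℚ) : ℚ_[p])) / ((c * b : ℚ) : ℚ_[p]), ?_⟩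
      rw [map_div₀, map_sub, ← hr', div_eq_iff hcb', hx]
      ring
    subst hb
    have ha : a ≠ 0 := by rintro rfl; simp at hab
    rw [show a ^ 2 - d * (0 : ℚ) ^ 2 = a ^ 2 by ring, padicValRat.pow] at hk
    push_cast at hk
    omega
  · have ht1 : ‖t / p‖ ≤ 1 := by
      have hlt1 : ‖t‖ < (p : ℝ) ^ (0 : ℤ) := by
        rw [zpow_zero]
        by_contra! h
        have : 1 ≤ ‖t‖ ^ 2 := one_le_pow₀ h
        rw [hnorm] at hge
        have := inv_lt_one_of_one_lt₀ hp1
        linarith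
      have := (Padic.norm_le_pow_iff_norm_lt_pow_add_one t (-1)).2 (by simpa using hlt1)
      rw [norm_div, Padic.norm_p, div_inv_eq_mul]
      rw [zpow_neg_one] at this
      calc ‖t‖ * p ≤ (p : ℝ)⁻¹ * p := by gcongr
        _ = 1 := inv_mul_cancel₀ (by positivity)
    have hn1 : ‖n / p‖ = 1 := by
      rw [norm_div, Padic.norm_p, hnorm, div_self (by positivity)]
    obtain ⟨t', ht'⟩ : ∃ z : ℤ_[p], (z : ℚ_[p]) = t / p := ⟨⟨_, ht1⟩, rfl⟩
    obtain ⟨n', hn'⟩ : ∃ z : ℤ_[p], (z : ℚ_[p]) = n / p := ⟨⟨_, hn1.le⟩, rfl⟩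
    refine false_of_eisenstein (x := x) (t := t') (n := n') hL (by rw [← hn1, ← hn']; rfl) ?_
    have hmap : ∀ z : ℤ_[p], algebraMap ℤ_[p] L z = algebraMap ℚ_[p] L z := fun z => by
      rw [IsScalarTower.algebraMap_apply ℤ_[p] ℚ_[p] L]; rfl
    have hpL : (p : L) = algebraMap ℚ_[p] L p := by rw [map_natCast]
    rw [hmap, hmap, hx2, hpL, mul_sub, ← mul_assoc, ← map_mul, ← map_mul, ht', hn',
      mul_div_cancel₀ _ hpp, mul_div_cancel₀ _ hpp]

end Inert

/-! ### Fixed points of embeddings -/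

section FixedPoints

/-- The vector `(z, 1)` is an eigenvector of the matrix `M`, with eigenvalue `θ`. -/
def IsEigenpoint {F L : Type*} [Field F] [Field L] [Algebra F L] (M : Matrix (Fin 2) (Fin 2) F)
    (θ : L) (z : HalfPlane F L) : Prop :=
  algebraMap F L (M 0 0) * z.val + algebraMap F L (M 0 1) = θ * z.val ∧
    algebraMap F L (M 1 0) * z.val + algebraMap F L (M 1 1) = θ

variable {F L : Type*} [Field F] [Field L] [Algebra F L] {M : Matrix (Fin 2) (Fin 2) F} {θ : L}

/-- A matrix is determined by one eigenvector that is not rational. -/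
theorem IsEigenpoint.matrix_unique {M' : Matrix (Fin 2) (Fin 2) F} {z : HalfPlane F L}
    (h : IsEigenpoint M θ z) (h' : IsEigenpoint M' θ z) : M = M' := by
  obtain ⟨h0, h1⟩ := z.eq_zero_of_linear (x := M 0 0 - M' 0 0) (y := M 0 1 - M' 0 1) (by
    rw [map_sub, map_sub]; linear_combination h.1 - h'.1)
  obtain ⟨h2, h3⟩ := z.eq_zero_of_linear (x := M 1 0 - M' 1 0) (y := M 1 1 - M' 1 1) (by
    rw [map_sub, map_sub]; linear_combination h.2 - h'.2)
  ext i j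
  fin_cases i <;> fin_cases j
  exacts [sub_eq_zero.1 h0, sub_eq_zero.1 h1, sub_eq_zero.1 h2, sub_eq_zero.1 h3]

theorem IsEigenpoint.point_unique {z z' : HalfPlane F L} (h : IsEigenpoint M θ z)
    (h' : IsEigenpoint M θ z') (hθ : θ ∉ Set.range (algebraMap F L)) : z = z' := by
  have hM : algebraMap F L (M 1 0) ≠ 0 := by
    intro h0
    have := h.2
    rw [h0, zero_mul, zero_add] at this
    exact hθ ⟨_, this⟩
  ext
  refine mul_left_cancel₀ hM ?_
  linear_combination h.2 - h'.2

theorem exists_isEigenpoint {d : F} (hM : M * M = d • 1) (hθd : θ ^ 2 = algebraMap F L d)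
    (hθ : θ ∉ Set.range (algebraMap F L)) (hsc : M 1 1 = - M 0 0) : ∃ z, IsEigenpoint M θ z := by
  have h00 : M 0 0 * M 0 0 + M 0 1 * M 1 0 = d := by
    have := congrFun (congrFun hM 0) 0
    rw [Matrix.mul_apply, Fin.sum_univ_two] at this
    simpa using this
  have hC : M 1 0 ≠ 0 := by
    intro h0
    rw [h0, mul_zero, add_zero] at h00
    have : (θ - algebraMap F L (M 0 0)) * (θ + algebraMap F L (M 0 0)) = 0 := by
      rw [← h00, map_mul] at hθd
      linear_combination hθd
    rcases mul_eq_zero.1 this with h | h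
    · exact hθ ⟨M 0 0, (sub_eq_zero.1 h).symm⟩
    · exact hθ ⟨-M 0 0, by rw [map_neg]; exact (eq_neg_of_add_eq_zero_left h).symm⟩
  have hC' : algebraMap F L (M 1 0) ≠ 0 := by simpa using hC
  refine ⟨⟨(θ + algebraMap F L (M 0 0)) / algebraMap F L (M 1 0), ?_⟩, ?_, ?_⟩
  · rintro ⟨t, ht⟩
    rw [eq_div_iff hC'] at ht
    exact hθ ⟨t * M 1 0 - M 0 0, by rw [map_sub, map_mul]; linear_combination ht⟩
  · have := congrArg (algebraMap F L) h00
    rw [map_add, map_mul, map_mul] at this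
    dsimp only
    field_simp
    linear_combination this - hθd
  · dsimp only
    rw [hsc, map_neg, mul_div_cancel₀ _ hC']
    ring

theorem IsEigenpoint.smul {z : HalfPlane F L} (h : IsEigenpoint M θ z) (g : GL (Fin 2) F)
    {M' : Matrix (Fin 2) (Fin 2) F} (hM' : M' * (g : Matrix (Fin 2) (Fin 2) F) = g * M) :
    IsEigenpoint M' θ (g • z) := by
  have hd := mobDenom_ne_zero g z
  have hent : ∀ i j, M' i 0 * g 0 j + M' i 1 * g 1 j = g i 0 * M 0 j + g i 1 * M 1 j := by
    intro i j
    have := congrFun (congrFun hM' i) j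
    rwa [Matrix.mul_apply, Matrix.mul_apply, Fin.sum_univ_two, Fin.sum_univ_two] at this
  have hent' : ∀ i j, algebraMap F L (M' i 0) * algebraMap F L (g 0 j) +
      algebraMap F L (M' i 1) * algebraMap F L (g 1 j) = algebraMap F L (g i 0) *
      algebraMap F L (M 0 j) + algebraMap F L (g i 1) * algebraMap F L (M 1 j) := by
    intro i j
    simpa using congrArg (algebraMap F L) (hent i j)
  obtain ⟨h0, h1⟩ := h
  have key : ∀ i, algebraMap F L (M' i 0) * mobNum g z.val +
      algebraMap F L (M' i 1) * mobDenom g z.val =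
      θ * (algebraMap F L (g i 0) * z.val + algebraMap F L (g i 1)) := by
    intro i
    simp only [mobNum, mobDenom]
    linear_combination z.val * hent' i 0 + hent' i 1 + algebraMap F L (g i 0) * h0 +
      algebraMap F L (g i 1) * h1
  constructor
  · rw [HalfPlane.smul_val]
    have := key 0
    change _ = θ * mobNum g z.val at this
    field_simp
    linear_combination this
  · rw [HalfPlane.smul_val]
    have := key 1
    change _ = θ * mobDenom g z.val at this
    field_simp
    linear_combination this

end FixedPoints

/-! ### Optimal embeddings and their fixed points -/

section EmbeddingPoints

variable {p : ℕ} [Fact p.Prime] {α β : ℚ} {K : Type*} [Field K] [Algebra ℚ K]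
  {L : Type*} [Field L] [Algebra ℚ_[p] L]

/-- The homomorphism `H → M₂(ℚ_p)` given by an isomorphism `H ⊗ ℚ_p ≃ M₂(ℚ_p)`. -/
noncomputable def matrixRep (Φ : (ℚ_[p] ⊗[ℚ] ℍ[ℚ,α,β]) ≃ₐ[ℚ_[p]] Matrix (Fin 2) (Fin 2) ℚ_[p]) :
    ℍ[ℚ,α,β] →+* Matrix (Fin 2) (Fin 2) ℚ_[p] :=
  Φ.toRingEquiv.toRingHom.comp (Algebra.TensorProduct.includeRight :
    ℍ[ℚ,α,β] →ₐ[ℚ] (ℚ_[p] ⊗[ℚ] ℍ[ℚ,α,β])).toRingHom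

variable (Φ : (ℚ_[p] ⊗[ℚ] ℍ[ℚ,α,β]) ≃ₐ[ℚ_[p]] Matrix (Fin 2) (Fin 2) ℚ_[p])

theorem coe_toGL (u : (ℍ[ℚ,α,β])ˣ) :
    (toGL Φ u : Matrix (Fin 2) (Fin 2) ℚ_[p]) = matrixRep Φ u := rfl

theorem matrixRep_smul_one (q : ℚ) : matrixRep Φ (q • 1) = (q : ℚ_[p]) • 1 := by
  have h : matrixRep Φ (q • 1) = Φ ((1 : ℚ_[p]) ⊗ₜ[ℚ] (q • (1 : ℍ[ℚ,α,β]))) := rfl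
  rw [h, ← TensorProduct.smul_tmul, Rat.smul_one_eq_cast,
    show ((q : ℚ_[p]) ⊗ₜ[ℚ] (1 : ℍ[ℚ,α,β])) =
      algebraMap ℚ_[p] (ℚ_[p] ⊗[ℚ] ℍ[ℚ,α,β]) q from rfl, AlgEquiv.commutes,
    Algebra.algebraMap_eq_smul_one]

theorem matrixRep_injective (hα : α < 0) (hβ : β < 0) : Function.Injective (matrixRep Φ) := by
  rw [injective_iff_map_eq_zero]
  intro x hx
  by_contra h0
  have h1 := congrArg (matrixRep Φ)
    (unitOfNorm x (reducedNorm_pos hα hβ h0).ne').mul_inv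
  rw [unitOfNorm_val, map_mul, hx, zero_mul, map_one] at h1
  exact zero_ne_one h1

variable {s : K} {d : ℤ} {θ : L}

theorem embedding_ne_smul_one (hs : s ^ 2 = (d : K)) (hθd : θ ^ 2 = (d : L))
    (hθ : θ ∉ Set.range (algebraMap ℚ_[p] L)) (φ : K →ₐ[ℚ] ℍ[ℚ,α,β]) (r : ℚ) :
    φ s ≠ r • 1 := by
  intro h
  have h1 : s = algebraMap ℚ K r := by
    apply φ.toRingHom.injective
    change φ s = φ (algebraMap ℚ K r)
    rw [h, AlgHom.commutes, Algebra.algebraMap_eq_smul_one]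
  have h2 : r ^ 2 = d := by
    apply (algebraMap ℚ K).injective
    rw [map_pow, ← h1, hs, map_intCast]
  have h3 : (θ - algebraMap ℚ_[p] L r) * (θ + algebraMap ℚ_[p] L r) = 0 := by
    have h4 : ((r : ℚ_[p])) ^ 2 = d := by exact_mod_cast congrArg (Rat.cast : ℚ → ℚ_[p]) h2
    have h5 := congrArg (algebraMap ℚ_[p] L) h4
    rw [map_pow, map_intCast] at h5
    linear_combination hθd - h5
  rcases mul_eq_zero.1 h3 with h | h
  · exact hθ ⟨r, (sub_eq_zero.1 h).symm⟩
  · exact hθ ⟨-r, by rw [map_neg]; exact (eq_neg_of_add_eq_zero_left h).symm⟩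

theorem embedding_sq (hs : s ^ 2 = (d : K)) (φ : K →ₐ[ℚ] ℍ[ℚ,α,β]) :
    φ s * φ s = (d : ℚ) • 1 := by
  rw [← map_mul, ← sq, hs, map_intCast, Int.cast_smul_eq_zsmul, zsmul_one]

theorem exists_isEigenpoint_embedding (hα : α < 0) (hβ : β < 0) (hs : s ^ 2 = (d : K))
    (hθd : θ ^ 2 = (d : L)) (hθ : θ ∉ Set.range (algebraMap ℚ_[p] L))
    (φ : K →ₐ[ℚ] ℍ[ℚ,α,β]) : ∃ z, IsEigenpoint (matrixRep Φ (φ s)) θ z := by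
  have hM : matrixRep Φ (φ s) * matrixRep Φ (φ s) = (d : ℚ_[p]) • 1 := by
    rw [← map_mul, embedding_sq hs, matrixRep_smul_one, Rat.cast_intCast]
  refine exists_isEigenpoint hM (by rw [hθd, map_intCast]) hθ ?_
  set M := matrixRep Φ (φ s) with hMdef
  -- otherwise `M` is scalar, by the Cayley–Hamilton theorem
  by_contra hne
  have htr : M 0 0 + M 1 1 ≠ 0 := fun h => hne (by linear_combination h)
  have hent : ∀ i j, M i 0 * M 0 j + M i 1 * M 1 j = (d : ℚ_[p]) * if i = j then 1 else 0 := by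
    intro i j
    have := congrFun (congrFun hM i) j
    rw [Matrix.mul_apply, Fin.sum_univ_two, Matrix.smul_apply, Matrix.one_apply] at this
    exact this
  have h01 : M 0 1 = 0 := (mul_eq_zero.1 (by
    have := hent 0 1; simp at this; linear_combination this :
      (M 0 0 + M 1 1) * M 0 1 = 0)).resolve_left htr
  have h10 : M 1 0 = 0 := (mul_eq_zero.1 (by
    have := hent 1 0; simp at this; linear_combination this :
      (M 0 0 + M 1 1) * M 1 0 = 0)).resolve_left htr
  have h11 : M 0 0 - M 1 1 = 0 := (mul_eq_zero.1 (by
    have h := hent 0 0; have h' := hent 1 1; simp at h h'; linear_combination h - h' :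
      (M 0 0 + M 1 1) * (M 0 0 - M 1 1) = 0)).resolve_left htr
  have hsc : M = M 0 0 • 1 := by
    ext i j
    fin_cases i <;> fin_cases j <;> simp [h01, h10, (sub_eq_zero.1 h11).symm]
  obtain ⟨b, e, f, hw⟩ := exists_not_commute hα.ne hβ.ne (embedding_ne_smul_one hs hθd hθ φ)
  apply hw
  apply matrixRep_injective Φ hα hβ
  rw [map_mul, map_mul, ← hMdef, hsc, mul_smul_comm, smul_mul_assoc, one_mul, mul_one]

theorem IsEigenpoint.embedding_unique (hα : α < 0) (hβ : β < 0) (hs : s ^ 2 = (d : K))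
    (hgen : IntermediateField.adjoin ℚ {s} = ⊤) {φ ψ : K →ₐ[ℚ] ℍ[ℚ,α,β]}
    {z : HalfPlane ℚ_[p] L} (h : IsEigenpoint (matrixRep Φ (φ s)) θ z)
    (h' : IsEigenpoint (matrixRep Φ (ψ s)) θ z) : φ = ψ := by
  have hsφ : φ s = ψ s := matrixRep_injective Φ hα hβ (h.matrix_unique h')
  ext1 x
  obtain ⟨a, b, rfl⟩ := exists_eq_add_mul hs hgen x
  simp only [map_add, map_mul, AlgHom.commutes, hsφ]

/-- The fixed points of an embedding are the points given by eigenvectors. -/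
theorem isFixedPoint_iff (hs : s ^ 2 = (d : K)) (hs0 : s ≠ 0)
    (hgen : IntermediateField.adjoin ℚ {s} = ⊤) (φ : K →ₐ[ℚ] ℍ[ℚ,α,β])
    (z : HalfPlane ℚ_[p] L) :
    IsFixedPoint Φ φ z ↔ ∃ μ, IsEigenpoint (matrixRep Φ (φ s)) μ z := by
  constructor
  · intro h
    have h1 := congrArg HalfPlane.val (h (Units.mk0 s hs0))
    rw [HalfPlane.smul_val, div_eq_iff (mobDenom_ne_zero _ z)] at h1
    refine ⟨mobDenom (toGL Φ (Units.map (φ : K →* ℍ[ℚ,α,β]) (Units.mk0 s hs0))) z.val, ?_, rfl⟩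
    exact h1.trans (mul_comm _ _)
  · rintro ⟨μ, hμ0, hμ1⟩ a
    ext
    rw [HalfPlane.smul_val, div_eq_iff (mobDenom_ne_zero _ z)]
    obtain ⟨x, y, hxy⟩ := exists_eq_add_mul hs hgen (a : K)
    have hmat : (toGL Φ (Units.map (φ : K →* ℍ[ℚ,α,β]) a) : Matrix (Fin 2) (Fin 2) ℚ_[p]) =
        (x : ℚ_[p]) • 1 + (y : ℚ_[p]) • matrixRep Φ (φ s) := by
      rw [coe_toGL, Units.coe_map]
      change matrixRep Φ (φ a) = _
      rw [hxy, map_add, map_mul, AlgHom.commutes, AlgHom.commutes, map_add, map_mul,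
        Algebra.algebraMap_eq_smul_one, Algebra.algebraMap_eq_smul_one, matrixRep_smul_one,
        matrixRep_smul_one, smul_mul_assoc, one_mul]
    simp only [mobNum, mobDenom, hmat, Matrix.add_apply, Matrix.smul_apply, Matrix.one_apply,
      smul_eq_mul, map_add, map_mul]
    simp
    linear_combination (y : L) * hμ0 - (y : L) * z.val * hμ1

theorem IsEigenpoint.sq_eq {M : Matrix (Fin 2) (Fin 2) ℚ_[p]} {e : ℚ_[p]} (hM : M * M = e • 1)
    {μ : L} {z : HalfPlane ℚ_[p] L} (h : IsEigenpoint M μ z) : μ ^ 2 = algebraMap ℚ_[p] L e := by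
  have hent : ∀ j, M 1 0 * M 0 j + M 1 1 * M 1 j = e * if 1 = j then 1 else 0 := by
    intro j
    have := congrFun (congrFun hM 1) j
    rw [Matrix.mul_apply, Fin.sum_univ_two, Matrix.smul_apply, Matrix.one_apply] at this
    exact this
  have h0 := congrArg (algebraMap ℚ_[p] L) (hent 0)
  have h1 := congrArg (algebraMap ℚ_[p] L) (hent 1)
  simp at h0 h1
  linear_combination z.val * h0 + h1 - algebraMap ℚ_[p] L (M 1 0) * h.1 -
    (μ + algebraMap ℚ_[p] L (M 1 1)) * h.2

end EmbeddingPoints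

section Conjugation

variable {p : ℕ} {K : Type*} [Field K] [Algebra ℚ K]

theorem conductorOrder_map_mem (σ : K →ₐ[ℚ] K) {m : ℕ} {x : K} (hx : x ∈ conductorOrder K m) :
    σ x ∈ conductorOrder K m := by
  obtain ⟨a, y, hy, rfl⟩ := hx
  refine ⟨a, σ y, ?_, by simp⟩
  exact IsIntegral.map (σ.toRingHom.toIntAlgHom) hy

theorem invertPrime_map_mem (σ : K →ₐ[ℚ] K) {m : ℕ} {x : K}
    (hx : x ∈ invertPrime p (conductorOrder K m)) : σ x ∈ invertPrime p (conductorOrder K m) := by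
  obtain ⟨k, hk⟩ := hx
  refine ⟨k, ?_⟩
  have := conductorOrder_map_mem σ hk
  rwa [map_mul, map_pow, map_natCast] at this

/-- The conjugation of a quadratic field. -/
theorem exists_conjugation {s : K} {d : ℤ} (hs : s ^ 2 = (d : K))
    (hgen : IntermediateField.adjoin ℚ {s} = ⊤) (h2 : Module.finrank ℚ K = 2) :
    ∃ σ : K ≃ₐ[ℚ] K, σ s = -s ∧ ∀ x, σ (σ x) = x := by
  have : Algebra.IsQuadraticExtension ℚ K := ⟨h2⟩
  have hcard := IsGalois.card_aut_eq_finrank ℚ K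
  rw [h2] at hcard
  obtain ⟨σ, hσ⟩ : ∃ σ : K ≃ₐ[ℚ] K, σ ≠ 1 := by
    by_contra! h
    have : Subsingleton (K ≃ₐ[ℚ] K) := ⟨fun a b => (h a).trans (h b).symm⟩
    have := Finite.card_le_one_iff_subsingleton.2 this
    omega
  have hsq : (σ s - s) * (σ s + s) = 0 := by
    have := congrArg σ hs
    rw [map_pow, map_intCast] at this
    linear_combination this - hs
  have hσs : σ s = -s := by
    rcases mul_eq_zero.1 hsq with h | h
    · refine absurd ?_ hσ
      ext x
      obtain ⟨a, b, rfl⟩ := exists_eq_add_mul hs hgen x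
      simp only [map_add, map_mul, AlgEquiv.commutes, sub_eq_zero.1 h, AlgEquiv.one_apply]
    · exact eq_neg_of_add_eq_zero_left h
  refine ⟨σ, hσs, fun x => ?_⟩
  obtain ⟨a, b, rfl⟩ := exists_eq_add_mul hs hgen x
  simp only [map_add, map_mul, AlgEquiv.commutes, hσs, map_neg, neg_neg]

/-- The composite of an optimal embedding with an involution of the field. -/
def OptimalEmbedding.compConj {A : Type*} [Ring A] [Algebra ℚ A] {S : Subring A} {m : ℕ}
    (φ : OptimalEmbedding (invertPrime p (conductorOrder K m)) S) (σ : K ≃ₐ[ℚ] K)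
    (hσ : ∀ x, σ (σ x) = x) :
    OptimalEmbedding (invertPrime p (conductorOrder K m)) S :=
  ⟨φ.1.comp σ.toAlgHom, by
    have hr : Set.range (φ.1.comp σ.toAlgHom) = Set.range φ.1 := by
      change Set.range (φ.1 ∘ σ) = _
      exact σ.surjective.range_comp φ.1
    rw [hr, ← φ.2]
    ext y
    constructor
    · rintro ⟨x, hx, rfl⟩
      exact ⟨σ x, invertPrime_map_mem σ.toAlgHom hx, rfl⟩
    · rintro ⟨x, hx, rfl⟩
      exact ⟨σ x, invertPrime_map_mem σ.toAlgHom hx, congrArg φ.1 (hσ x)⟩⟩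

/-- The conjugate `x ↦ u⁻¹ φ(x) u` of an optimal embedding by a unit of the order. -/
def OptimalEmbedding.conjUnit {A : Type*} [Ring A] [Nontrivial A] [Algebra ℚ A] {R : Subring K} {S : Subring A}
    (φ : OptimalEmbedding R S) (u : Aˣ) (hu : (u : A) ∈ S) (hu' : (↑u⁻¹ : A) ∈ S) :
    OptimalEmbedding R S :=
  ⟨{ toFun := fun x => ↑u⁻¹ * φ.1 x * u
     map_one' := by simp
     map_mul' := fun x y => by simp [mul_assoc]
     map_zero' := by simp
     map_add' := fun x y => by simp [mul_add, add_mul]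
     commutes' := fun r => by
      rw [AlgHom.commutes, mul_assoc, Algebra.commutes, Units.inv_mul_cancel_left] }, by
    ext y
    constructor
    · rintro ⟨x, hx, rfl⟩
      exact ⟨S.mul_mem (S.mul_mem hu' (φ.apply_mem hx)) hu, x, rfl⟩
    · rintro ⟨hy, x, rfl⟩
      have hx : φ.1 x ∈ (S : Set A) ∩ Set.range φ.1 := by
        refine ⟨?_, x, rfl⟩
        have := S.mul_mem (S.mul_mem hu hy) hu'
        change (u : A) * (↑u⁻¹ * φ.1 x * u) * ↑u⁻¹ ∈ S at this
        simpa [mul_assoc] using this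
      rw [← φ.2] at hx
      obtain ⟨x', hx', h⟩ := hx
      rw [φ.1.toRingHom.injective h] at hx'
      exact ⟨x, hx', rfl⟩⟩

end Conjugation

/-! ### Counting the classes -/

theorem even_natCard_of_involutive {X : Type*} [Finite X] {f : X → X}
    (hf : Function.Involutive f) (hfix : ∀ x, f x ≠ x) : Even (Nat.card X) := by
  classical
  have := Fintype.ofFinite X
  have h := Equiv.Perm.card_fixedPoints_modEq (p := 2) (n := 1) (f := (f : Function.End X))
    (by funext x; exact hf x)
  have h0 : Fintype.card (Function.fixedPoints (f : Function.End X)) = 0 :=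
    Fintype.card_eq_zero_iff.2 ⟨fun x => hfix x.1 x.2⟩
  rw [h0] at h
  rw [Nat.card_eq_fintype_card, even_iff_two_dvd]
  exact (Nat.modEq_zero_iff_dvd).1 h

section Classes

variable {p : ℕ} [Fact p.Prime] {α β : ℚ} {K : Type*} [Field K] [Algebra ℚ K]
  {L : Type*} [Field L] [Algebra ℚ_[p] L] {s : K} {d : ℤ} {θ : L} {O : Subring ℍ[ℚ,α,β]} {m : ℕ}

/-- Sending an optimal embedding to its fixed point identifies the conjugacy classes of optimal
embeddings with the classes of fixed points. -/
theorem exists_injective_range_eq_CMp (hα : α < 0) (hβ : β < 0)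
    (Φ : (ℚ_[p] ⊗[ℚ] ℍ[ℚ,α,β]) ≃ₐ[ℚ_[p]] Matrix (Fin 2) (Fin 2) ℚ_[p])
    (hs : s ^ 2 = (d : K)) (hgen : IntermediateField.adjoin ℚ {s} = ⊤)
    (h2 : Module.finrank ℚ K = 2) (hθd : θ ^ 2 = (d : L))
    (hθ : θ ∉ Set.range (algebraMap ℚ_[p] L)) :
    ∃ f : Quotient (embeddingSetoid (invertPrime p (conductorOrder K m)) (invertPrime p O)
        (unitsPlus p (invertPrime p O))) →
      MulAction.orbitRel.Quotient (GammaPlus Φ (invertPrime p O)) (HalfPlane ℚ_[p] L),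
      Function.Injective f ∧ Set.range f = CMp Φ O K m L := by
  set X := OptimalEmbedding (invertPrime p (conductorOrder K m)) (invertPrime p O) with hX
  set S := embeddingSetoid (invertPrime p (conductorOrder K m)) (invertPrime p O)
        (unitsPlus p (invertPrime p O)) with hS
  choose τ hτ using fun φ : X =>
    exists_isEigenpoint_embedding Φ hα hβ hs hθd hθ φ.1
  -- the action of a unit
  have hact : ∀ (φ ψ : X) (g : (ℍ[ℚ,α,β])ˣ), (∀ x, ψ.1 x = ↑g⁻¹ * φ.1 x * ↑g) →
      τ ψ = toGL Φ g⁻¹ • τ φ := by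
    intro φ ψ g h
    refine (hτ ψ).point_unique ((hτ φ).smul (toGL Φ g⁻¹) ?_) hθ
    rw [coe_toGL, ← map_mul, ← map_mul, h, mul_assoc, Units.mul_inv, mul_one]
  refine ⟨Quotient.lift (fun φ => Quotient.mk _ (τ φ)) ?_, ?_, ?_⟩
  · rintro φ ψ ⟨g, hg, h⟩
    refine (Quotient.sound ?_).symm
    refine ⟨⟨Matrix.ProjGenLinGroup.mk (toGL Φ g⁻¹), ?_⟩, ?_⟩
    · exact ⟨g⁻¹, Subgroup.inv_mem _ hg, rfl⟩
    · exact (hact φ ψ g h).symm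
  · intro q q'
    induction q using Quotient.inductionOn with | _ φ
    induction q' using Quotient.inductionOn with | _ ψ
    intro h
    obtain ⟨⟨γ, g, hg, rfl⟩, hγ⟩ := Quotient.exact h.symm
    replace hγ : toGL Φ g • τ φ = τ ψ := hγ
    refine Quotient.sound ⟨g⁻¹, Subgroup.inv_mem _ hg, fun x => ?_⟩
    have hgR : (g : ℍ[ℚ,α,β]) ∈ invertPrime p O ∧ (↑g⁻¹ : ℍ[ℚ,α,β]) ∈ invertPrime p O :=
      ⟨hg.1, hg.2.1⟩
    have h1 : τ (φ.conjUnit g⁻¹ hgR.2 (by rw [inv_inv]; exact hgR.1)) = τ ψ := by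
      rw [hact φ _ g⁻¹ (fun x => rfl), inv_inv, hγ]
    have h2 := IsEigenpoint.embedding_unique Φ hα hβ hs hgen (h1 ▸ hτ ψ)
      (hτ (φ.conjUnit g⁻¹ hgR.2 (by rw [inv_inv]; exact hgR.1)))
    rw [h2]
    rfl
  · ext c
    constructor
    · rintro ⟨q, rfl⟩
      induction q using Quotient.inductionOn with | _ φ
      have hs0 : s ≠ 0 := by
        rintro rfl
        exact embedding_ne_smul_one hs hθd hθ φ.1 0 (by rw [map_zero, zero_smul])
      exact ⟨φ, τ φ, (isFixedPoint_iff Φ hs hs0 hgen φ.1 _).2 ⟨θ, hτ φ⟩, rfl⟩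
    · rintro ⟨φ, z, hz, rfl⟩
      have hs0 : s ≠ 0 := by
        rintro rfl
        exact embedding_ne_smul_one hs hθd hθ φ.1 0 (by rw [map_zero, zero_smul])
      obtain ⟨μ, hμ⟩ := (isFixedPoint_iff Φ hs hs0 hgen φ.1 z).1 hz
      have hM : matrixRep Φ (φ.1 s) * matrixRep Φ (φ.1 s) = (d : ℚ_[p]) • 1 := by
        rw [← map_mul, embedding_sq hs, matrixRep_smul_one, Rat.cast_intCast]
      have hμ2 := hμ.sq_eq hM
      rw [map_intCast, ← hθd] at hμ2
      rcases sq_eq_sq_iff_eq_or_eq_neg.1 hμ2 with rfl | rfl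
      · exact ⟨Quotient.mk _ φ, congrArg (Quotient.mk _) ((hτ φ).point_unique hμ hθ)⟩
      · -- the other fixed point of `φ` belongs to its composite with the conjugation of `K`
        obtain ⟨σ, hσs, hσ⟩ := exists_conjugation hs hgen h2
        refine ⟨Quotient.mk _ (φ.compConj σ hσ), congrArg (Quotient.mk _)
          ((hτ (φ.compConj σ hσ)).point_unique ?_ hθ)⟩
        have e : (φ.compConj σ hσ).1 s = -φ.1 s := by
          change φ.1 (σ s) = _
          rw [hσs, map_neg]
        rw [e, map_neg]
        refine ⟨?_, ?_⟩
        · rw [Matrix.neg_apply, Matrix.neg_apply, map_neg, map_neg]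
          linear_combination -hμ.1
        · rw [Matrix.neg_apply, Matrix.neg_apply, map_neg, map_neg]
          linear_combination -hμ.2

/-- Conjugation by a unit of `O[1/p]` whose norm has odd valuation is an involution without fixed
points on the classes of optimal embeddings. -/
theorem even_card_quotient_embeddingSetoid [Algebra ℤ_[p] L] [IsScalarTower ℤ_[p] ℚ_[p] L]
    [FiniteDimensional ℚ_[p] L]
    (hL : Algebra.FormallyUnramified ℤ_[p] (integralClosure ℤ_[p] L))
    (hα : α < 0) (hβ : β < 0) (hO : IsOrder O) (hs : s ^ 2 = (d : K))
    (hgen : IntermediateField.adjoin ℚ {s} = ⊤) (hm : 0 < m) (hθd : θ ^ 2 = (d : L))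
    (hθ : θ ∉ Set.range (algebraMap ℚ_[p] L)) {x : ℍ[ℚ,α,β]} (hx : x ∈ invertPrime p O)
    (hxp : reducedNorm x = p) :
    Even (Nat.card (Quotient (embeddingSetoid (invertPrime p (conductorOrder K m))
      (invertPrime p O) (unitsPlus p (invertPrime p O))))) := by
  have hp := (Fact.out : p.Prime)
  have hp0 : (p : ℚ) ≠ 0 := by exact_mod_cast hp.ne_zero
  have := finite_quotient_embeddingSetoid (p := p) hα hβ hO hs hgen hm
  set X := OptimalEmbedding (invertPrime p (conductorOrder K m)) (invertPrime p O) with hX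
  let u := unitOfNorm x (by rw [hxp]; exact hp0)
  have huR : (u : ℍ[ℚ,α,β]) ∈ invertPrime p O := hx
  have huR' : (↑u⁻¹ : ℍ[ℚ,α,β]) ∈ invertPrime p O := by
    rw [unitOfNorm_inv_val, hxp]
    have := smul_mem_invertPrime hp.ne_zero (hO.star_mem_invertPrime p hx) (-1)
    rwa [zpow_neg_one] at this
  have huv : padicValRat p (reducedNorm (u : ℍ[ℚ,α,β])) = 1 := by
    change padicValRat p (reducedNorm x) = 1
    rw [hxp, padicValRat.self hp.one_lt]
  have huv' : padicValRat p (reducedNorm (↑u⁻¹ : ℍ[ℚ,α,β])) = -1 := by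
    rw [eq_inv_of_mul_eq_one_right (reducedNorm_mul_inv u), padicValRat.inv, huv]
  have hval : ∀ g h : (ℍ[ℚ,α,β])ˣ, padicValRat p (reducedNorm ((g * h : (ℍ[ℚ,α,β])ˣ) : ℍ[ℚ,α,β])) =
      padicValRat p (reducedNorm (g : ℍ[ℚ,α,β])) + padicValRat p (reducedNorm (h : ℍ[ℚ,α,β])) :=
    fun g h => by rw [Units.val_mul, reducedNorm_mul, padicValRat.mul (reducedNorm_unit_ne_zero g)
      (reducedNorm_unit_ne_zero h)]
  let c : X → X := fun φ => φ.conjUnit u huR huR'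
  have hc : ∀ φ y, (c φ).1 y = ↑u⁻¹ * φ.1 y * u := fun φ y => rfl
  refine even_natCard_of_involutive (f := Quotient.map c ?_) ?_ ?_
  · rintro φ ψ ⟨g, ⟨hg, hg', hgv⟩, h⟩
    refine ⟨u⁻¹ * g * u, ⟨?_, ?_, ?_⟩, fun y => ?_⟩
    · exact Subring.mul_mem _ (Subring.mul_mem _ huR' hg) huR
    · rw [mul_inv_rev, mul_inv_rev, inv_inv]
      exact Subring.mul_mem _ huR' (Subring.mul_mem _ hg' huR)
    · rw [hval, hval, huv, huv']
      simpa using hgv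
    · rw [hc, hc, h]
      simp [mul_assoc]
  · intro q
    induction q using Quotient.inductionOn with | _ φ
    refine (Quotient.sound ?_).symm
    refine ⟨u * u, ⟨?_, ?_, ?_⟩, fun y => ?_⟩
    · exact Subring.mul_mem _ huR huR
    · rw [mul_inv_rev]
      exact Subring.mul_mem _ huR' huR'
    · rw [hval, huv]; exact ⟨1, rfl⟩
    · rw [hc, hc]
      simp [mul_assoc]
  · intro q
    induction q using Quotient.inductionOn with | _ φ
    intro h
    obtain ⟨g, ⟨-, -, hgv⟩, hg⟩ := Quotient.exact h
    -- `u g` commutes with `φ(K)`, so its norm is a norm from `K`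
    have hcomm : ((u * g : (ℍ[ℚ,α,β])ˣ) : ℍ[ℚ,α,β]) * φ.1 s = φ.1 s * (u * g : (ℍ[ℚ,α,β])ˣ) := by
      have := hg s
      rw [hc] at this
      conv_lhs => rw [this]
      simp [mul_assoc]
    have hns := embedding_ne_smul_one hs hθd hθ φ.1
    obtain ⟨a, b, hab⟩ := exists_of_commute hα.ne hβ.ne hns hcomm
    have hre : (φ.1 s).re = 0 := by
      by_contra h0
      have h1 := mul_self_eq (φ.1 s)
      rw [embedding_sq hs] at h1
      apply hns ((2 * (φ.1 s).re)⁻¹ * (d + reducedNorm (φ.1 s)))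
      rw [mul_smul, add_smul, h1, sub_add_cancel, smul_smul, inv_mul_cancel₀ (by positivity),
        one_smul]
    have hnorm : reducedNorm (φ.1 s) = -d := by
      have h1 := mul_self_eq (φ.1 s)
      rw [embedding_sq hs, hre, mul_zero, zero_smul, zero_sub, ← neg_smul] at h1
      have := congrArg QuaternionAlgebra.re h1
      simp at this
      linarith
    have hn : reducedNorm ((u * g : (ℍ[ℚ,α,β])ˣ) : ℍ[ℚ,α,β]) = a ^ 2 - d * b ^ 2 := by
      rw [hab, reducedNorm_smul_one_add_smul _ _ hre, hnorm]
      ring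
    have heven := even_padicValRat_norm hL hθd hθ (a := a) (b := b)
      (by rw [← hn]; exact reducedNorm_unit_ne_zero _)
    rw [← hn, hval, huv] at heven
    obtain ⟨i, hi⟩ := heven
    obtain ⟨j, hj⟩ := hgv
    omega

/-- The image in `L` of a generator of the quadratic field `K`, which is imaginary at `p`. -/
theorem IsImaginaryAt.exists_sqrt (hL : Module.finrank ℚ_[p] L = 2)
    (hKp : IsImaginaryAt ℚ_[p] L K) (hs : s ^ 2 = (d : K))
    (hgen : IntermediateField.adjoin ℚ {s} = ⊤) :
    ∃ θ : L, θ ^ 2 = (d : L) ∧ θ ∉ Set.range (algebraMap ℚ_[p] L) := by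
  obtain ⟨e⟩ := hKp
  let ι : K →+* L := e.toRingEquiv.toRingHom.comp
    (Algebra.TensorProduct.includeRight : K →ₐ[ℚ] (ℚ_[p] ⊗[ℚ] K)).toRingHom
  refine ⟨ι s, by rw [← map_pow, hs, map_intCast], ?_⟩
  rintro ⟨r, hr⟩
  have hι : ∀ x, ι x ∈ (⊥ : Subalgebra ℚ_[p] L) := by
    intro x
    obtain ⟨a, b, rfl⟩ := exists_eq_add_mul hs hgen x
    rw [map_add, map_mul, ← hr, eq_ratCast, eq_ratCast, map_ratCast, map_ratCast,
      ← map_ratCast (algebraMap ℚ_[p] L), ← map_ratCast (algebraMap ℚ_[p] L), ← map_mul, ← map_add]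
    exact Subalgebra.algebraMap_mem _ _
  have hall : ∀ w : ℚ_[p] ⊗[ℚ] K, e w ∈ (⊥ : Subalgebra ℚ_[p] L) := by
    intro w
    induction w using TensorProduct.induction_on with
    | zero => rw [map_zero]; exact Subalgebra.zero_mem _
    | tmul a x =>
      have : a ⊗ₜ[ℚ] x = a • ((1 : ℚ_[p]) ⊗ₜ[ℚ] x) := by
        rw [TensorProduct.smul_tmul', smul_eq_mul, mul_one]
      rw [this, map_smul]
      exact Subalgebra.smul_mem _ (hι x) a
    | add w w' h h' => rw [map_add]; exact Subalgebra.add_mem _ h h'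
  have htop : (⊥ : Subalgebra ℚ_[p] L) = ⊤ := by
    rw [eq_top_iff]
    rintro y -
    rw [← e.apply_symm_apply y]
    exact hall _
  have := Subalgebra.bot_eq_top_iff_finrank_eq_one.1 htop
  omega

end Classes

end ShimuraCM

theorem mainTheorem1
    -- a prime `p`, and the unramified quadratic extension `L = ℚ_{p²}` of `ℚ_p`
    (p : ℕ) [Fact p.Prime]
    (L : Type*) [Field L] [Algebra ℚ_[p] L] [Algebra ℤ_[p] L] [IsScalarTower ℤ_[p] ℚ_[p] L]
    (hL : Module.finrank ℚ_[p] L = 2)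
    (hLunr : Algebra.FormallyUnramified ℤ_[p] (integralClosure ℤ_[p] L))
    -- a definite quaternion algebra `H = (α, β / ℚ)` of discriminant `D` prime to `p`
    (α β : ℚ) (hα : α ≠ 0) (hβ : β ≠ 0)
    (hdef : ShimuraCM.IsDefinite ℍ[ℚ,α,β])
    (D : ℕ) (hD : ShimuraCM.HasDiscriminant ℍ[ℚ,α,β] D) (hpD : ¬ p ∣ D)
    (Φ : (ℚ_[p] ⊗[ℚ] ℍ[ℚ,α,β]) ≃ₐ[ℚ_[p]] Matrix (Fin 2) (Fin 2) ℚ_[p])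
    -- an Eichler order `O` in `H` of level `N` prime to `p`
    (N : ℕ) (hpN : ¬ p ∣ N)
    (O : Subring ℍ[ℚ,α,β]) (hO : ShimuraCM.IsEichlerOrder O N)
    -- a quadratic field `K = ℚ(√d)`, imaginary at `p` and at `∞`, and a conductor `m`
    (d : ℤ) (K : Type*) [Field K] [Algebra ℚ K] (hK : ShimuraCM.IsQuadraticFieldOf K d)
    (hKp : ShimuraCM.IsImaginaryAt ℚ_[p] L K) (hKinf : ShimuraCM.IsImaginaryAt ℝ ℂ K)
    (m : ℕ) (hm : 0 < m) :
    (ShimuraCM.CMp Φ O K m L).Finite ∧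
    (ShimuraCM.CMp Φ O K m L).encard =
      ShimuraCM.numOptimalEmbeddings
        (ShimuraCM.invertPrime p (ShimuraCM.conductorOrder K m))
        (ShimuraCM.invertPrime p O)
        (ShimuraCM.unitsPlus p (ShimuraCM.invertPrime p O)) ∧
    Even (ShimuraCM.CMp Φ O K m L).ncard := by
  obtain ⟨hα', hβ'⟩ := hdef.neg
  obtain ⟨-, h2, s, hs, hgen⟩ := hK
  have hfin : FiniteDimensional ℚ_[p] L := FiniteDimensional.of_finrank_pos (by omega)
  have hsplit : ShimuraCM.IsSplitOver ℚ_[p] α β := by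
    by_contra h
    exact ShimuraCM.not_isRamifiedOver_of_matrix Φ
      (ShimuraCM.isRamifiedOver_of_not_isSplitOver hα h)
  obtain ⟨θ, hθd, hθ⟩ := hKp.exists_sqrt hL hs hgen
  obtain ⟨x, hx, hxp⟩ := hO.exists_mem_reducedNorm_eq_prime hα' hβ' hsplit
  have hQ := ShimuraCM.finite_quotient_embeddingSetoid (p := p) hα' hβ' hO.isOrder hs hgen hm
  obtain ⟨f, hf, hfr⟩ := ShimuraCM.exists_injective_range_eq_CMp (O := O) (m := m) hα' hβ' Φ hs
    hgen h2 hθd hθ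
  rw [← hfr]
  refine ⟨Set.finite_range f, ?_, ?_⟩
  · exact (ENat.card_congr (Equiv.ofInjective f hf)).symm
  · rw [← Nat.card_coe_set_eq, ← Nat.card_congr (Equiv.ofInjective f hf)]
    exact ShimuraCM.even_card_quotient_embeddingSetoid hLunr hα' hβ' hO.isOrder hs hgen hm hθd hθ
      hx hxp
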